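/- Let $m,n\ge 1$, $N=m+n$, $\gamma>0$, $N_\gamma=m+(1+\gamma)n$, $1<p<N_\gamma$ and $p_\gamma^*=\frac{pN_\gamma}{N_\gamma-p}$. For $z=(x,y)\in\mathbb R^m\times\mathbb R^n=\mathbb R^N$ let $\nabla_\gamma=(\partial_{x_1},\dots,\partial_{x_m},|x|^\gamma\partial_{y_1},\dots,|x|^\gamma\partial_{y_n})=(X_1,\dots,X_N)$ be the Grushin gradient, $\Delta_{\gamma,p}u=\sum_{i=1}^N X_i(|\nabla_\gamma u|^{p-2}X_iu)$ the Grushin $p$-Laplacian, $d(z)=(|x|^{2(\gamma+1)}+(\gamma+1)^2|y|^2)^{\frac1{2(\gamma+1)}}$ and $B_R=\{z: d(z)<R\}$. Let $\Omega\subset\mathbb R^N$ be an exterior domain, i.e. a connected open set whose complement $K=\mathbb R^N\setminus\Omega$ is compact and not negligible, in the sense that its capacity $\inf\{\int_{\mathbb R^N}|\nabla_\gamma\varphi|^p\,dz:\ \varphi\in C_c^\infty(\mathbb R^N),\ \varphi\ge1 \text{ on } K\}$ is positive (as it is when $K$ has an interior point). Let $\mathcal D^{1,p}_\gamma(\Omega)$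 be the space of all $w\in L^{p_\gamma^*}(\Omega)$ whose weak Grushin gradient $\nabla_\gamma w$ exists and lies in $L^p(\Omega)$, and let $\mathcal D^{1,p}_{\gamma,0}(\Omega)$ be the closure of $C_c^\infty(\Omega)$ in it for the norm $\|w\|_{L^{p_\gamma^*}(\Omega)}+\|\nabla_\gamma w\|_{L^p(\Omega)}$. For functions $a,b$, the inequality $a\le b$ on $\partial\Omega$ means that $\chi\,(a-b)^+\in\mathcal D^{1,p}_{\gamma,0}(\Omega)$ for all $\chi\in C_c^\infty(\mathbb R^N)$, and $\inf_{\partial\Omega}u>0$ means that $\delta\le u$ on $\partial\Omega$ for some constant $\delta>0$. **Theorem (comparison principle on exterior domains).** Let $f,g\in L^{N_\gamma/p}(\Omega)$ with $f\le g$ a.e. in $\Omega$. Let $v\in\mathcal D^{1,p}_\gamma(\Omega)$ be a weak subsolution of $-\Delta_{\gamma,p}v=f|v|^{p-2}v$ in $\Omega$, and let $u\in\mathcal D^{1,p}_\gamma(\Omega)$, $u>0$ a.e. in $\Omega$, be a weak supersolution of $-\Delta_{\gamma,p}u=g|u|^{p-2}u$ in $\Omega$; that is, for all $\varphi\in C_c^\infty(\Omega)$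 with $\varphi\ge0$, $$\int_\Omega|\nabla_\gamma v|^{p-2}\nabla_\gamma v\cdot\nabla_\gamma\varphi\,dz\le\int_\Omega f|v|^{p-2}v\,\varphi\,dz,\qquad \int_\Omega|\nabla_\gamma u|^{p-2}\nabla_\gamma u\cdot\nabla_\gamma\varphi\,dz\ge\int_\Omega g|u|^{p-2}u\,\varphi\,dz .$$ Assume that $\inf_{\partial\Omega}u>0$ and that $$\limsup_{R\to\infty}\frac1R\int_{B_{2R}\setminus B_R}(v^+)^p\,|\nabla_\gamma\log u|^{p-1}\,dz=0,\qquad v^+=\max(v,0),\quad \nabla_\gamma\log u=\frac{\nabla_\gamma u}{u}.$$ If $u\ge v$ on $\partial\Omega$, then $u\ge v$ a.e. in $\Omega$. -/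

import Mathlib

open MeasureTheory Filter Topology
open scoped ENNReal ContDiff

namespace Grushin

noncomputable section

/-- The space `ℝ^N = ℝ^m × ℝ^n`, with points `z = (x, y)`, its usual topology and Lebesgue
measure. -/
abbrev Space (m n : ℕ) : Type := EuclideanSpace ℝ (Fin m) × EuclideanSpace ℝ (Fin n)

/-- The values of Grushin gradients: vectors of `ℝ^N` with the Euclidean norm, with one coordinate
for each of the vector fields `X_1, …, X_m` and `X_{m+1}, …, X_{m+n}`. -/
abbrev GradSpace (m n : ℕ) : Type := EuclideanSpace ℝ (Fin m ⊕ Fin n)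

variable {m n : ℕ}

/-- The homogeneous dimension `N_γ = m + (1 + γ) n`. -/
def homDim (m n : ℕ) (γ : ℝ) : ℝ := m + (1 + γ) * n

/-- The critical Sobolev exponent `p*_γ = p N_γ / (N_γ - p)`. -/
def critExp (m n : ℕ) (γ p : ℝ) : ℝ := p * homDim m n γ / (homDim m n γ - p)

/-- The homogeneous norm `d(x, y) = (|x|^{2(γ+1)} + (γ+1)^2 |y|^2)^{1/(2(γ+1))}`. -/
def homNorm (γ : ℝ) (z : Space m n) : ℝ :=
  (‖z.1‖ ^ (2 * (γ + 1)) + (γ + 1) ^ 2 * ‖z.2‖ ^ 2) ^ (1 / (2 * (γ + 1)))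

/-- The ball `B_R = {z | d(z) < R}`. -/
def homBall (m n : ℕ) (γ R : ℝ) : Set (Space m n) := {z | homNorm γ z < R}

/-- The Grushin gradient of a differentiable function `φ`: its coordinates are
`X_i φ = ∂φ/∂x_i` and `X_{m+j} φ = |x|^γ ∂φ/∂y_j`. -/
def grad (γ : ℝ) (φ : Space m n → ℝ) (z : Space m n) : GradSpace m n :=
  WithLp.toLp 2 fun k => match k with
    | Sum.inl i => fderiv ℝ φ z (EuclideanSpace.single i 1, 0)
    | Sum.inr j => ‖z.1‖ ^ γ * fderiv ℝ φ z (0, EuclideanSpace.single j 1)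

/-- `φ ∈ C_c^∞(Ω)`. -/
structure IsTest (Ω : Set (Space m n)) (φ : Space m n → ℝ) : Prop where
  smooth : ContDiff ℝ ∞ φ
  compact : HasCompactSupport φ
  supp : tsupport φ ⊆ Ω

/-- `G` is the weak Grushin gradient of `u` in the open set `Ω`: both are locally integrable in `Ω`
and `∫_Ω u X_k φ = - ∫_Ω G_k φ` for all `k` and all `φ ∈ C_c^∞(Ω)` (the formal adjoint of `X_k` is
`-X_k`, because `|x|^γ` does not depend on `y`). -/
structure HasWeakGrad (γ : ℝ) (Ω : Set (Space m n)) (u : Space m n → ℝ)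
    (G : Space m n → GradSpace m n) : Prop where
  locInt : LocallyIntegrableOn u Ω
  locInt_grad : LocallyIntegrableOn G Ω
  integral_eq : ∀ φ : Space m n → ℝ, IsTest Ω φ → ∀ k : Fin m ⊕ Fin n,
    ∫ z in Ω, u z * grad γ φ z k = - ∫ z in Ω, G z k * φ z

/-- `u` belongs to `𝒟_γ^{1,p}(Ω) = {u ∈ L^{p*_γ}(Ω) | ∇_γ u ∈ L^p(Ω)}`, with weak Grushin gradient
`G` (which `u` determines up to null sets). -/
structure MemD (γ p : ℝ) (Ω : Set (Space m n)) (u : Space m n → ℝ)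
    (G : Space m n → GradSpace m n) : Prop where
  weakGrad : HasWeakGrad γ Ω u G
  memLp : MemLp u (ENNReal.ofReal (critExp m n γ p)) (volume.restrict Ω)
  memLp_grad : MemLp G (ENNReal.ofReal p) (volume.restrict Ω)

/-- `w` belongs to `𝒟_{γ,0}^{1,p}(Ω)`, the closure of `C_c^∞(Ω)` in `𝒟_γ^{1,p}(Ω)` for the norm
`‖w‖_{L^{p*_γ}(Ω)} + ‖∇_γ w‖_{L^p(Ω)}`. -/
def MemD0 (γ p : ℝ) (Ω : Set (Space m n)) (w : Space m n → ℝ) : Prop :=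
  ∃ G : Space m n → GradSpace m n, MemD γ p Ω w G ∧
    ∃ φ : ℕ → Space m n → ℝ, (∀ k, IsTest Ω (φ k)) ∧
      Tendsto (fun k => eLpNorm (fun z => φ k z - w z)
        (ENNReal.ofReal (critExp m n γ p)) (volume.restrict Ω)) atTop (𝓝 0) ∧
      Tendsto (fun k => eLpNorm (fun z => grad γ (φ k) z - G z)
        (ENNReal.ofReal p) (volume.restrict Ω)) atTop (𝓝 0)

/-- `a ≤ b` on `∂Ω` in the Sobolev sense: `(a - b)^+` vanishes on `∂Ω`, i.e. each of its
localizations `χ (a - b)^+` with `χ ∈ C_c^∞(ℝ^N)` belongs to `𝒟_{γ,0}^{1,p}(Ω)`. -/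
def LeOnBoundary (γ p : ℝ) (Ω : Set (Space m n)) (a b : Space m n → ℝ) : Prop :=
  ∀ χ : Space m n → ℝ, IsTest Set.univ χ → MemD0 γ p Ω fun z => χ z * max (a z - b z) 0

/-- The Grushin `p`-capacity of a compact set `K`: the infimum of `∫ |∇_γ φ|^p` over all
`φ ∈ C_c^∞(ℝ^N)` with `φ ≥ 1` on `K`. -/
def capacity (γ p : ℝ) (K : Set (Space m n)) : ℝ≥0∞ :=
  ⨅ (φ : Space m n → ℝ) (_ : IsTest Set.univ φ) (_ : ∀ z ∈ K, 1 ≤ φ z),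
    ∫⁻ z, ENNReal.ofReal (‖grad γ φ z‖ ^ p)

/-- An exterior domain: a connected open set whose complement is compact and is not negligible for
`𝒟_γ^{1,p}` (in particular it is not empty). Complements with interior points are not negligible;
when the complement is negligible, boundary conditions in the Sobolev sense are void. -/
structure IsExteriorDomain (γ p : ℝ) (Ω : Set (Space m n)) : Prop where
  isOpen : IsOpen Ω
  isConnected : IsConnected Ω
  isCompact_compl : IsCompact Ωᶜ
  capacity_pos : 0 < capacity γ p Ωᶜ

/-- The function `u` with weak Grushin gradient `G` is a weak subsolution of
`-Δ_{γ,p} u = f |u|^{p-2} u` in `Ω`. -/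
def IsWeakSubsolution (γ p : ℝ) (Ω : Set (Space m n)) (f u : Space m n → ℝ)
    (G : Space m n → GradSpace m n) : Prop :=
  ∀ φ : Space m n → ℝ, IsTest Ω φ → (∀ z, 0 ≤ φ z) →
    ∫ z in Ω, ‖G z‖ ^ (p - 2) * inner ℝ (G z) (grad γ φ z) ≤
      ∫ z in Ω, f z * |u z| ^ (p - 2) * u z * φ z

/-- The function `u` with weak Grushin gradient `G` is a weak supersolution of
`-Δ_{γ,p} u = f |u|^{p-2} u` in `Ω`. -/
def IsWeakSupersolution (γ p : ℝ) (Ω : Set (Space m n)) (f u : Space m n → ℝ)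
    (G : Space m n → GradSpace m n) : Prop :=
  ∀ φ : Space m n → ℝ, IsTest Ω φ → (∀ z, 0 ≤ φ z) →
    ∫ z in Ω, f z * |u z| ^ (p - 2) * u z * φ z ≤
      ∫ z in Ω, ‖G z‖ ^ (p - 2) * inner ℝ (G z) (grad γ φ z)

end

end Grushin

/-!
The proof tests the two inequalities with functions built from the quotient `v / u` and reads off
the equality case of Picone's inequality where `v > u`.

Let `F` be a smooth nondecreasing step (`stepF`) that vanishes on `(-∞, 1]` and is positive on
`(1, ∞)`. With `t = v / u`, the subsolution inequality is tested with `v F(t) = u t F(t)` and the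
supersolution inequality with `v^p u^(1 - p) F(t) = u t^p F(t)`. In the difference of the two, the
zeroth order terms give `∫ F(t) (f - g) v^p ≤ 0`. The principal terms are bounded below by
`∫ F(t) (|∇v|^p - p |t ∇u|^(p - 2) ⟨t ∇u, ∇v⟩ + (p - 1) |t ∇u|^p)`, the integrand being the
nonnegative convexity gap `picone` times `F(t)`; the terms with `F'` have the right sign, because
`a ↦ |a|^(p - 2) a` is monotone and `F' ≥ 0`. This is made rigorous with the quotient of a
truncation of `v + ε` and a regularization of `u + ε`. The truncation spoils Picone's inequality on
a set that shrinks to the empty set, with an integrable error (`exists_neg_le_testedDiff`), and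
Fatou's lemma gives the localized estimate `lintegral_picone_le`.

These test functions are admissible by Friedrichs mollification
(`LocMemW.exists_smooth_approx`): the mollifier is a product whose scale in `x` is much smaller than
its scale in `y`, so that it almost commutes with the weight `|x|^γ`. Since `F(t)` vanishes where
`v ≤ u` and `(v - u)^+` vanishes on the boundary in the Sobolev sense, the localizing cutoff need
not vanish on the boundary of `Ω` (`integral_inner_chainGrad_le_of_leOnBoundary`).

With the cutoff between `B_R` and `B_{2R}`, the remaining terms tend to zero as `R → ∞`: for the
subsolution by Hölder's inequality, as `|B_R| ≤ c R^{N_γ}`, and for the supersolution by the growth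
condition. Hence `∇v = (v / u) ∇u` where `v > u` (`grad_eq_smul_of_lt`). By the logarithmic
Caccioppoli estimate `lintegral_log_grad_lt_top`, `∇ log u` belongs to `L^p_loc`, and therefore
`F(v / u)` has a weak gradient, which vanishes (`integral_stepF_mul_grad_eq_zero`). A function with
vanishing weak Grushin gradient on a connected open set is constant (`exists_ae_eq_const`): although
the fields in `y` degenerate on `{x = 0}`, its mollifications are locally independent of `x`, so
that `y` may be varied in a slice where `x ≠ 0`.

If the constant `F(v / u)` is zero, then `v ≤ u`. Otherwise `v ≥ (1 + a) u` in all of `Ω` for some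
`a > 0`. As `u ≥ δ` and `v ≤ u` on the boundary, a cutoff function `χ` of the complement would
satisfy `δ χ ≤ χ (δ - u)^+ + χ (v - u)^+ / a`, where the right-hand side is a limit of test
functions in `Ω`. Then the complement would have capacity zero (`capacity_eq_zero_of_mul_le`).
-/

namespace Grushin

/-! ### Convolution with a kernel in `L^p` -/

section Kernel

variable {E : Type*} [NormedAddCommGroup E] [NormedSpace ℝ E] [FiniteDimensional ℝ E]
  [MeasurableSpace E] [BorelSpace E] (μ : Measure E) [μ.IsAddHaarMeasure]

/-- Jensen's inequality for the finite measure with density `k`. -/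
lemma lintegral_mul_rpow_le {E : Type*} [MeasurableSpace E] (μ : Measure E) {p : ℝ} (hp : 1 < p)
    {k f : E → ℝ≥0∞} (hk : AEMeasurable k μ)
    (hf : AEMeasurable f μ) :
    (∫⁻ t, k t * f t ∂μ) ^ p ≤ (∫⁻ t, k t ∂μ) ^ (p - 1) * ∫⁻ t, k t * f t ^ p ∂μ := by
  have hpq := Real.HolderConjugate.conjExponent hp
  set q := p.conjExponent
  have h := ENNReal.lintegral_mul_le_Lp_mul_Lq μ hpq.symm (f := fun t => k t ^ (1 / q))
    (g := fun t => k t ^ (1 / p) * f t) (hk.pow_const _) ((hk.pow_const _).mul hf)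
  have hsum : 1 / q + 1 / p = 1 := by
    have := hpq.symm.inv_add_inv_eq_one
    simpa [one_div] using this
  have hp0 : 0 < p := hpq.pos
  have hq0 : 0 < q := hpq.symm.pos
  have e1 : ∀ t, ((fun t => k t ^ (1 / q)) * fun t => k t ^ (1 / p) * f t) t = k t * f t := by
    intro t
    simp only [Pi.mul_apply]
    rw [← mul_assoc, ← ENNReal.rpow_add_of_nonneg _ _ (by positivity) (by positivity), hsum,
      ENNReal.rpow_one]
  have e2 : ∀ t, (k t ^ (1 / q)) ^ q = k t := fun t => by
    rw [← ENNReal.rpow_mul, one_div_mul_cancel hq0.ne', ENNReal.rpow_one]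
  have e3 : ∀ t, (k t ^ (1 / p) * f t) ^ p = k t * f t ^ p := fun t => by
    rw [ENNReal.mul_rpow_of_nonneg _ _ hp0.le, ← ENNReal.rpow_mul, one_div_mul_cancel hp0.ne',
      ENNReal.rpow_one]
  simp only [e1, e2, e3] at h
  calc (∫⁻ t, k t * f t ∂μ) ^ p
      ≤ ((∫⁻ t, k t ∂μ) ^ (1 / q) * (∫⁻ t, k t * f t ^ p ∂μ) ^ (1 / p)) ^ p :=
        ENNReal.rpow_le_rpow h hp0.le
    _ = _ := by
        rw [ENNReal.mul_rpow_of_nonneg _ _ hp0.le, ← ENNReal.rpow_mul, ← ENNReal.rpow_mul,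
          one_div_mul_cancel hp0.ne', ENNReal.rpow_one]
        congr 2
        have : 1 / q = 1 - 1 / p := by linarith
        rw [this]; field_simp

/-- Young's inequality `‖k ∗ f‖_p ≤ ‖k‖_1 ‖f‖_p` for nonnegative functions. -/
lemma lintegral_rpow_conv_le {p : ℝ} (hp : 1 < p) {k f : E → ℝ≥0∞} (hk : AEMeasurable k μ)
    (hf : AEMeasurable f μ) :
    ∫⁻ x, (∫⁻ t, k t * f (x - t) ∂μ) ^ p ∂μ ≤ (∫⁻ t, k t ∂μ) ^ p * ∫⁻ x, f x ^ p ∂μ := by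
  have hsub : AEMeasurable (fun z : E × E => f (z.1 - z.2)) (μ.prod μ) :=
    hf.comp_quasiMeasurePreserving (quasiMeasurePreserving_sub_of_right_invariant μ μ)
  have hsub' : ∀ x, AEMeasurable (fun t => f (x - t)) μ := fun x =>
    hf.comp_quasiMeasurePreserving (quasiMeasurePreserving_sub_left_of_right_invariant μ x)
  calc ∫⁻ x, (∫⁻ t, k t * f (x - t) ∂μ) ^ p ∂μ
      ≤ ∫⁻ x, (∫⁻ t, k t ∂μ) ^ (p - 1) * ∫⁻ t, k t * f (x - t) ^ p ∂μ ∂μ :=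
        lintegral_mono fun x => lintegral_mul_rpow_le μ hp hk (hsub' x)
    _ = (∫⁻ t, k t ∂μ) ^ (p - 1) * ∫⁻ x, ∫⁻ t, k t * f (x - t) ^ p ∂μ ∂μ := by
        rw [lintegral_const_mul'']
        exact ((hk.comp_snd).mul (hsub.pow_const p)).lintegral_prod_right'
    _ = (∫⁻ t, k t ∂μ) ^ (p - 1) * ∫⁻ t, k t * ∫⁻ x, f x ^ p ∂μ ∂μ := by
        rw [lintegral_lintegral_swap ((hk.comp_snd).mul (hsub.pow_const p))]
        congr 1
        refine lintegral_congr fun t => ?_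
        rw [lintegral_const_mul'', lintegral_sub_right_eq_self (fun x => f x ^ p) t]
        exact (hf.comp_quasiMeasurePreserving
          (measurePreserving_sub_right μ t).quasiMeasurePreserving).pow_const p
    _ = _ := by
        rw [lintegral_mul_const'' _ hk, ← mul_assoc]
        congr 1
        rcases eq_or_ne (∫⁻ t, k t ∂μ) ⊤ with h | h
        · rw [h, ENNReal.top_rpow_of_pos (by linarith), ENNReal.top_rpow_of_pos (by linarith)]
          simp
        rcases eq_or_ne (∫⁻ t, k t ∂μ) 0 with h0 | h0
        · rw [h0, ENNReal.zero_rpow_of_pos (by linarith), ENNReal.zero_rpow_of_pos (by linarith)]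
          simp
        nth_rewrite 2 [← ENNReal.rpow_one (∫⁻ t, k t ∂μ)]
        rw [← ENNReal.rpow_add _ _ h0 h]
        congr 1; ring

/-- Young's inequality for a function that is dominated by the convolution of `‖k‖` and `‖f‖`. -/
lemma eLpNorm_le_of_le_conv {V W : Type*} [NormedAddCommGroup V] [NormedAddCommGroup W]
    {p : ℝ} (hp : 1 < p) {k : E → ℝ}
    {f : E → V} {F : E → W} (hk : AEStronglyMeasurable k μ) (hf : AEStronglyMeasurable f μ)
    {C : Set E} (hC : MeasurableSet C) (c : ℝ≥0∞)
    (hF : ∀ x ∈ C, ‖F x‖ₑ ≤ c * ∫⁻ t, ‖k t‖ₑ * ‖f (x - t)‖ₑ ∂μ) :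
    eLpNorm F (ENNReal.ofReal p) (μ.restrict C) ≤
      c * (∫⁻ t, ‖k t‖ₑ ∂μ) * eLpNorm f (ENNReal.ofReal p) μ := by
  have hp0 : 0 < p := by linarith
  have h0 : ENNReal.ofReal p ≠ 0 := by simpa using hp0
  have ht : ENNReal.ofReal p ≠ ⊤ := ENNReal.ofReal_ne_top
  rw [eLpNorm_eq_lintegral_rpow_enorm_toReal h0 ht, eLpNorm_eq_lintegral_rpow_enorm_toReal h0 ht,
    ENNReal.toReal_ofReal hp0.le]
  have key : ∫⁻ x in C, ‖F x‖ₑ ^ p ∂μ ≤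
      c ^ p * ((∫⁻ t, ‖k t‖ₑ ∂μ) ^ p * ∫⁻ x, ‖f x‖ₑ ^ p ∂μ) := by
    calc ∫⁻ x in C, ‖F x‖ₑ ^ p ∂μ
        ≤ ∫⁻ x in C, c ^ p * (∫⁻ t, ‖k t‖ₑ * ‖f (x - t)‖ₑ ∂μ) ^ p ∂μ := by
          refine setLIntegral_mono_ae' hC (ae_of_all _ fun x hx => ?_)
          rw [← ENNReal.mul_rpow_of_nonneg _ _ hp0.le]
          exact ENNReal.rpow_le_rpow (hF x hx) hp0.le
      _ ≤ ∫⁻ x, c ^ p * (∫⁻ t, ‖k t‖ₑ * ‖f (x - t)‖ₑ ∂μ) ^ p ∂μ := setLIntegral_le_lintegral _ _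
      _ = c ^ p * ∫⁻ x, (∫⁻ t, ‖k t‖ₑ * ‖f (x - t)‖ₑ ∂μ) ^ p ∂μ := by
          rw [lintegral_const_mul'']
          exact (AEMeasurable.lintegral_prod_right' ((hk.enorm.comp_snd).mul
            (hf.enorm.comp_quasiMeasurePreserving
              (quasiMeasurePreserving_sub_of_right_invariant μ μ)))).pow_const p
      _ ≤ _ := by
          gcongr
          exact lintegral_rpow_conv_le μ hp hk.enorm hf.enorm
  calc (∫⁻ x in C, ‖F x‖ₑ ^ p ∂μ) ^ (1 / p)
      ≤ (c ^ p * ((∫⁻ t, ‖k t‖ₑ ∂μ) ^ p * ∫⁻ x, ‖f x‖ₑ ^ p ∂μ)) ^ (1 / p) :=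
        ENNReal.rpow_le_rpow key (by positivity)
    _ = _ := by
        rw [ENNReal.mul_rpow_of_nonneg _ _ (by positivity),
          ENNReal.mul_rpow_of_nonneg _ _ (by positivity), ← ENNReal.rpow_mul, ← ENNReal.rpow_mul,
          mul_one_div_cancel hp0.ne', ENNReal.rpow_one, ENNReal.rpow_one, mul_assoc]

/-- Averaging with a kernel of mass one and small support moves a function of `L^p` little. -/
lemma exists_radius_eLpNorm_conv_sub_le {V : Type*} [NormedAddCommGroup V] [NormedSpace ℝ V]
    [CompleteSpace V] {p : ℝ} (hp : 1 < p) {f : E → V}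
    (hf : MemLp f (ENNReal.ofReal p) μ) {δ : ℝ≥0∞} (hδ : δ ≠ 0) :
    ∃ r > 0, ∀ k : E → ℝ, Continuous k → (∀ t, 0 ≤ k t) → ∫ t, k t ∂μ = 1 →
      HasCompactSupport k → Function.support k ⊆ Metric.ball 0 r →
      eLpNorm (fun x => (∫ t, k t • f (x - t) ∂μ) - f x) (ENNReal.ofReal p) μ ≤ δ := by
  have hp1 : (1 : ℝ≥0∞) ≤ ENNReal.ofReal p := by simpa using hp.le
  have hδ3 : δ / 3 ≠ 0 := by simp [ENNReal.div_eq_zero_iff, hδ]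
  obtain ⟨g, hgc, hfg, hg, hgp⟩ := hf.exists_hasCompactSupport_eLpNorm_sub_le
    ENNReal.ofReal_ne_top hδ3
  set S := Metric.cthickening 1 (tsupport g) with hS
  have hSc : IsCompact S := IsCompact.cthickening hgc
  -- a uniform error whose `L^p` norm on `S` is at most `δ / 3`
  obtain ⟨e, he0, he⟩ : ∃ e : ℝ, 0 < e ∧
      ENNReal.ofReal e * μ S ^ (1 / p) ≤ δ / 3 := by
    have hfin : μ S ^ (1 / p) ≠ ⊤ :=
      ENNReal.rpow_ne_top_of_nonneg (by positivity) hSc.measure_lt_top.ne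
    have : Tendsto (fun e : ℝ => ENNReal.ofReal e * μ S ^ (1 / p)) (𝓝[>] 0) (𝓝 0) := by
      have h1 : Tendsto (fun e : ℝ => ENNReal.ofReal e) (𝓝[>] 0) (𝓝 0) := by
        have := (ENNReal.continuous_ofReal.tendsto 0).mono_left
          (nhdsWithin_le_nhds (s := Set.Ioi (0 : ℝ)))
        simpa using this
      simpa using ENNReal.Tendsto.mul_const h1 (Or.inr hfin)
    have h2 := (this.eventually (gt_mem_nhds (pos_iff_ne_zero.2 hδ3))).and self_mem_nhdsWithin
    obtain ⟨e, h3, h4⟩ := h2.exists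
    exact ⟨e, h4, h3.le⟩
  obtain ⟨r, hr0, hr⟩ := Metric.uniformContinuous_iff.1
    (hgc.uniformContinuous_of_continuous hg) e he0
  refine ⟨min r 1, by positivity, fun k hk hk0 hk1 hkc hks => ?_⟩
  have hkint : Integrable k μ := hk.integrable_of_hasCompactSupport hkc
  have hkone : ∫⁻ t, ‖k t‖ₑ ∂μ = 1 := by
    rw [← ofReal_integral_norm_eq_lintegral_enorm hkint]
    simp only [Real.norm_of_nonneg (hk0 _), hk1, ENNReal.ofReal_one]
  have hkt : ∀ t, ‖t‖ < min r 1 ∨ k t = 0 := fun t => by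
    by_cases h : k t = 0
    · exact Or.inr h
    · left; simpa using hks h
  have hconvint : ∀ {h : E → V}, LocallyIntegrable h μ → ∀ x,
      Integrable (fun t => k t • h (x - t)) μ := by
    intro h hh x
    have := (hkc.convolutionExists_left (ContinuousLinearMap.lsmul ℝ ℝ) hk hh x).integrable
    simpa using this
  have hfl := hf.locallyIntegrable hp1
  have hgl := hg.locallyIntegrable (μ := μ)
  have hdecomp : (fun x => (∫ t, k t • f (x - t) ∂μ) - f x) =
      ((fun x => ∫ t, k t • (f - g) (x - t) ∂μ) + (fun x => (∫ t, k t • g (x - t) ∂μ) - g x)) +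
        (g - f) := by
    funext x
    have : ∫ t, k t • (f - g) (x - t) ∂μ =
        (∫ t, k t • f (x - t) ∂μ) - ∫ t, k t • g (x - t) ∂μ := by
      rw [← integral_sub (hconvint hfl x) (hconvint hgl x)]
      simp [smul_sub]
    rw [Pi.add_apply, Pi.add_apply, this, Pi.sub_apply]
    abel
  have hm1 : ∀ {h : E → V}, LocallyIntegrable h μ →
      AEStronglyMeasurable (fun x => ∫ t, k t • h (x - t) ∂μ) μ := by
    intro h hh
    have := hkc.continuous_convolution_left (μ := μ) (ContinuousLinearMap.lsmul ℝ ℝ) hk hh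
    exact this.aestronglyMeasurable
  have hE1 : eLpNorm (fun x => ∫ t, k t • (f - g) (x - t) ∂μ) (ENNReal.ofReal p) μ ≤ δ / 3 := by
    have := eLpNorm_le_of_le_conv μ hp (F := fun x => ∫ t, k t • (f - g) (x - t) ∂μ)
      hk.aestronglyMeasurable (hf.1.sub hgp.1) MeasurableSet.univ 1 (fun x _ => by
        rw [one_mul]
        refine (enorm_integral_le_lintegral_enorm _).trans (le_of_eq ?_)
        simp only [enorm_smul])
    rw [hkone, one_mul, one_mul, Measure.restrict_univ] at this
    exact this.trans hfg
  have hE2 : eLpNorm (fun x => (∫ t, k t • g (x - t) ∂μ) - g x) (ENNReal.ofReal p) μ ≤ δ / 3 := by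
    have hb : ∀ x, ‖(∫ t, k t • g (x - t) ∂μ) - g x‖ ≤ e := by
      intro x
      have : (∫ t, k t • g (x - t) ∂μ) - g x = ∫ t, k t • (g (x - t) - g x) ∂μ := by
        simp only [smul_sub]
        rw [integral_sub (hconvint hgl x) (hkint.smul_const _), integral_smul_const, hk1, one_smul]
      rw [this]
      calc ‖∫ t, k t • (g (x - t) - g x) ∂μ‖ ≤ ∫ t, k t * e ∂μ := by
            refine norm_integral_le_of_norm_le (hkint.mul_const _) (ae_of_all _ fun t => ?_)
            rw [norm_smul, Real.norm_of_nonneg (hk0 t)]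
            rcases hkt t with h | h
            · refine mul_le_mul_of_nonneg_left ?_ (hk0 t)
              rw [← dist_eq_norm]
              refine (hr ?_).le
              rw [dist_eq_norm]
              simpa using h.trans_le (min_le_left _ _)
            · simp [h]
        _ = e := by rw [integral_mul_const, hk1, one_mul]
    have hz : ∀ x, x ∉ S → (∫ t, k t • g (x - t) ∂μ) - g x = 0 := by
      intro x hx
      have hgx : ∀ t, ‖t‖ < min r 1 → g (x - t) = 0 := by
        intro t ht
        by_contra hne
        apply hx
        rw [hS]
        refine Metric.mem_cthickening_of_dist_le x (x - t) 1 _ (subset_tsupport _ hne) ?_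
        rw [dist_eq_norm]
        simpa using (ht.trans_le (min_le_right _ _)).le
      have h1 : g x = 0 := by simpa using hgx 0 (by simp [hr0])
      have h2 : ∀ t, k t • g (x - t) = 0 := fun t => by
        rcases hkt t with h | h
        · rw [hgx t h, smul_zero]
        · rw [h, zero_smul]
      simp [h1, h2]
    have hind : (fun x => (∫ t, k t • g (x - t) ∂μ) - g x) =
        S.indicator (fun x => (∫ t, k t • g (x - t) ∂μ) - g x) := by
      funext x
      by_cases hx : x ∈ S
      · rw [Set.indicator_of_mem hx]
      · rw [Set.indicator_of_notMem hx, hz x hx]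
    rw [hind, eLpNorm_indicator_eq_eLpNorm_restrict hSc.measurableSet]
    refine (eLpNorm_le_of_ae_bound (ae_of_all _ hb)).trans ?_
    rw [mul_comm, Measure.restrict_apply_univ, ENNReal.toReal_ofReal (by linarith), ← one_div]
    exact he
  have hE3 : eLpNorm (g - f) (ENNReal.ofReal p) μ ≤ δ / 3 := by
    rw [← eLpNorm_neg, neg_sub]; exact hfg
  rw [hdecomp]
  calc _ ≤ δ / 3 + δ / 3 + δ / 3 := by
        refine (eLpNorm_add_le (((hm1 ?_)).add ((hm1 hgl).sub hgp.1)) (hgp.1.sub hf.1) hp1).trans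
          (add_le_add ((eLpNorm_add_le (hm1 ?_) ((hm1 hgl).sub hgp.1) hp1).trans
            (add_le_add hE1 hE2)) hE3)
        · exact hfl.sub hgl
        · exact hfl.sub hgl
    _ = δ := ENNReal.add_thirds δ

end Kernel

/-! ### Mollification of Sobolev functions of Grushin type -/

section Mollification

variable {m n : ℕ}

instance : (volume : Measure (Space m n)).IsAddHaarMeasure :=
  inferInstanceAs ((volume : Measure (EuclideanSpace ℝ (Fin m))).prod
    (volume : Measure (EuclideanSpace ℝ (Fin n)))).IsAddHaarMeasure

instance : (volume : Measure (Space m n)).IsNegInvariant :=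
  Measure.IsAddHaarMeasure.isNegInvariant_of_regular volume

lemma grad_inl (γ : ℝ) (φ : Space m n → ℝ) (z : Space m n) (i : Fin m) :
    grad γ φ z (Sum.inl i) = fderiv ℝ φ z (EuclideanSpace.single i 1, 0) := rfl

lemma grad_inr (γ : ℝ) (φ : Space m n → ℝ) (z : Space m n) (j : Fin n) :
    grad γ φ z (Sum.inr j) = ‖z.1‖ ^ γ * fderiv ℝ φ z (0, EuclideanSpace.single j 1) := rfl

lemma enorm_le_sum_enorm {ι : Type*} [Fintype ι] (x : EuclideanSpace ℝ ι) :
    ‖x‖ₑ ≤ ∑ k, ‖x k‖ₑ := by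
  classical
  have hx : x = ∑ k, x k • EuclideanSpace.single k (1 : ℝ) := by
    ext i
    simp [Finset.sum_apply, Pi.single_apply]
  conv_lhs => rw [hx]
  refine (enorm_sum_le _ _).trans (Finset.sum_le_sum fun k _ => ?_)
  rw [enorm_smul]
  simp [enorm_eq_nnnorm]

lemma continuous_norm_fst_rpow {γ : ℝ} (hγ : 0 < γ) :
    Continuous fun z : Space m n => ‖z.1‖ ^ γ :=
  (continuous_norm.comp continuous_fst).rpow_const fun _ => Or.inr hγ.le

lemma continuous_grad {γ : ℝ} (hγ : 0 < γ) {φ : Space m n → ℝ} (hφ : ContDiff ℝ 1 φ) :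
    Continuous (grad γ φ) := by
  have hD : Continuous (fderiv ℝ φ) := hφ.continuous_fderiv (by simp)
  refine (PiLp.continuous_toLp 2 _).comp (continuous_pi fun k => ?_)
  cases k with
  | inl i => exact hD.clm_apply continuous_const
  | inr j => exact (continuous_norm_fst_rpow hγ).mul (hD.clm_apply continuous_const)

/-- The Grushin gradient of a mollification `u ∗ κ` is the mollification of the weak gradient, up to
the commutator of the mollification with the multiplication by `|x|^γ`. -/
lemma grad_convolution_sub {γ : ℝ} (hγ : 0 < γ) {Ω : Set (Space m n)} {u : Space m n → ℝ}
    {G : Space m n → GradSpace m n} (h : HasWeakGrad γ Ω u G) {κ : Space m n → ℝ}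
    (hκ : ContDiff ℝ ∞ κ) (hκc : HasCompactSupport κ) {C' : Set (Space m n)}
    (hC'Ω : C' ⊆ Ω)
    (hu : Integrable (C'.indicator u)) (hG : Integrable (C'.indicator G)) {x : Space m n}
    (hx : ∀ t, x - t ∈ tsupport κ → t ∈ C') (k : Fin m ⊕ Fin n) :
    (grad γ (convolution (C'.indicator u) κ (ContinuousLinearMap.mul ℝ ℝ) volume) x -
        ∫ t, κ t • C'.indicator G (x - t)) k =
      match k with
      | Sum.inl _ => 0
      | Sum.inr j => ∫ t, C'.indicator u t * ((‖x.1‖ ^ γ - ‖t.1‖ ^ γ) *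
          fderiv ℝ κ (x - t) (0, EuclideanSpace.single j 1)) := by
  have hul : LocallyIntegrable (C'.indicator u) := hu.locallyIntegrable
  have hκ1 : ContDiff ℝ 1 κ := hκ.of_le (by simp)
  have hcD : Continuous (fderiv ℝ κ) := hκ1.continuous_fderiv (by simp)
  have hcDc : HasCompactSupport (fderiv ℝ κ) := hκc.fderiv (𝕜 := ℝ)
  have hDw : ∀ e : Space m n, fderiv ℝ (convolution (C'.indicator u) κ
      (ContinuousLinearMap.mul ℝ ℝ) volume) x e =
      ∫ t, C'.indicator u t * fderiv ℝ κ (x - t) e := by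
    intro e
    rw [(hκc.hasFDerivAt_convolution_right (ContinuousLinearMap.mul ℝ ℝ) hul hκ1 x).fderiv,
      convolution_precompR_apply _ hul hcDc hcD]
    rfl
  -- the test function
  set φ : Space m n → ℝ := fun t => κ (x - t) with hφ
  have hφs : tsupport φ ⊆ C' := by
    intro t ht
    refine hx t ?_
    have : tsupport φ ⊆ (fun t => x - t) ⁻¹' tsupport κ := by
      refine closure_minimal (fun t ht => subset_tsupport _ ht)
        ((isClosed_tsupport κ).preimage (by fun_prop))
    exact this ht
  have htest : IsTest Ω φ := by
    refine ⟨hκ.comp (contDiff_const.sub contDiff_id), ?_, hφs.trans hC'Ω⟩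
    exact hκc.comp_homeomorph (Homeomorph.subLeft x)
  have hDφ : ∀ t e, fderiv ℝ φ t e = - fderiv ℝ κ (x - t) e := by
    intro t e
    have h1 : HasFDerivAt φ ((fderiv ℝ κ (x - t)).comp (-ContinuousLinearMap.id ℝ (Space m n))) t :=
      HasFDerivAt.comp t ((hκ1.differentiable (by simp)) (x - t)).hasFDerivAt
        ((hasFDerivAt_id t).const_sub x)
    rw [h1.fderiv]; simp
  have hDκ0 : ∀ t, t ∉ C' → fderiv ℝ κ (x - t) = 0 := by
    intro t ht
    by_contra hne
    exact ht (hx t (support_fderiv_subset ℝ hne))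
  have hset : ∀ a : Space m n → ℝ, ∀ e, ∫ t in Ω, u t * (a t * fderiv ℝ κ (x - t) e) =
      ∫ t, C'.indicator u t * (a t * fderiv ℝ κ (x - t) e) := by
    intro a e
    have : ∀ t, u t * (a t * fderiv ℝ κ (x - t) e) =
        C'.indicator u t * (a t * fderiv ℝ κ (x - t) e) := by
      intro t
      by_cases ht : t ∈ C'
      · rw [Set.indicator_of_mem ht]
      · rw [hDκ0 t ht]; simp
    simp_rw [this]
    refine setIntegral_eq_integral_of_forall_compl_eq_zero fun t ht => ?_
    rw [Set.indicator_of_notMem (fun h => ht (hC'Ω h)), zero_mul]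
  have hGint : Integrable fun t => κ (x - t) • C'.indicator G t := by
    have := (hκc.convolutionExists_left (μ := volume) (ContinuousLinearMap.lsmul ℝ ℝ)
      hκ1.continuous hG.locallyIntegrable x).integrable_swap
    simpa using this
  have hGset : ∀ k, ∫ t in Ω, G t k * φ t = (∫ t, κ t • C'.indicator G (x - t)) k := by
    intro k
    have e1 : ∫ t, κ t • C'.indicator G (x - t) = ∫ t, κ (x - t) • C'.indicator G t := by
      rw [← integral_sub_left_eq_self (fun t => κ t • C'.indicator G (x - t)) volume x]
      simp
    have e2 : (∫ t, κ (x - t) • C'.indicator G t) k = ∫ t, (κ (x - t) • C'.indicator G t) k :=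
      (ContinuousLinearMap.integral_comp_comm (EuclideanSpace.proj (𝕜 := ℝ) k) hGint).symm
    rw [e1, e2]
    have : ∀ t, G t k * φ t = (κ (x - t) • C'.indicator G t) k := by
      intro t
      by_cases ht : t ∈ C'
      · rw [Set.indicator_of_mem ht]; simp [hφ, mul_comm]
      · have : φ t = 0 := image_eq_zero_of_notMem_tsupport fun h => ht (hφs h)
        rw [Set.indicator_of_notMem ht, this]; simp
    simp_rw [this]
    refine setIntegral_eq_integral_of_forall_compl_eq_zero fun t ht => ?_
    rw [Set.indicator_of_notMem (fun h => ht (hC'Ω h))]; simp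
  have hweak := h.integral_eq φ htest k
  rw [hGset] at hweak
  have hint : ∀ e (a : Space m n → ℝ), Continuous a →
      Integrable fun t => C'.indicator u t * (a t * fderiv ℝ κ (x - t) e) := by
    intro e a ha
    have hc : Continuous fun t => a t * fderiv ℝ κ (x - t) e :=
      ha.mul ((hcD.comp (continuous_const.sub continuous_id)).clm_apply continuous_const)
    have hcs : HasCompactSupport fun t => a t * fderiv ℝ κ (x - t) e := by
      have h1 : HasCompactSupport fun t => fderiv ℝ κ (x - t) :=
        hcDc.comp_homeomorph (Homeomorph.subLeft x)
      exact (h1.comp_left (g := fun L : Space m n →L[ℝ] ℝ => L e) (by simp)).mul_left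
    obtain ⟨M, hM⟩ := hcs.exists_bound_of_continuous hc
    exact hu.mul_bdd hc.aestronglyMeasurable (ae_of_all _ hM)
  rw [PiLp.sub_apply]
  cases k with
  | inl i =>
    simp only [grad_inl, hDφ] at hweak
    have h1 := hset (fun _ => 1) (EuclideanSpace.single i 1, 0)
    simp only [one_mul] at h1
    simp only [mul_neg, integral_neg, neg_inj] at hweak
    rw [grad_inl, hDw, ← h1, hweak, sub_self]
  | inr j =>
    simp only [grad_inr, hDφ] at hweak
    have h1 := hset (fun t => ‖t.1‖ ^ γ) (0, EuclideanSpace.single j 1)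
    simp only [mul_neg, integral_neg, neg_inj] at hweak
    rw [grad_inr, hDw, ← hweak, h1, ← integral_const_mul, ← integral_sub]
    · congr 1
      funext t
      ring
    · have := (hint (0, EuclideanSpace.single j 1) (fun _ => ‖x.1‖ ^ γ) continuous_const)
      refine this.congr (ae_of_all _ fun t => ?_)
      simp only; ring
    · exact hint _ _ (continuous_norm_fst_rpow hγ)

/-- `u` is locally in `L^p` in `Ω`, and so is its weak Grushin gradient `G`. -/
structure LocMemW (γ p : ℝ) (Ω : Set (Space m n)) (u : Space m n → ℝ)
    (G : Space m n → GradSpace m n) : Prop where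
  weakGrad : HasWeakGrad γ Ω u G
  memLp : ∀ C, IsCompact C → C ⊆ Ω → MemLp u (ENNReal.ofReal p) (volume.restrict C)
  memLp_grad : ∀ C, IsCompact C → C ⊆ Ω → MemLp G (ENNReal.ofReal p) (volume.restrict C)

/-- Local density of smooth functions (Friedrichs). The weight `|x|^γ` may be merely Hölder
continuous, so the usual commutator estimate is not available; instead the mollifier acts on the
scale `η` in `y`, which commutes with the weight, and on a much smaller scale `ε` in `x`. -/
lemma LocMemW.exists_smooth_approx {γ p : ℝ} (hγ : 0 < γ) (hp : 1 < p) {Ω : Set (Space m n)}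
    (hΩ : IsOpen Ω) {u : Space m n → ℝ} {G : Space m n → GradSpace m n} (h : LocMemW γ p Ω u G)
    {C : Set (Space m n)} (hC : IsCompact C) (hCΩ : C ⊆ Ω) {δ : ℝ≥0∞} (hδ : δ ≠ 0) :
    ∃ w : Space m n → ℝ, ContDiff ℝ ∞ w ∧
      eLpNorm (fun z => w z - u z) (ENNReal.ofReal p) (volume.restrict C) ≤ δ ∧
      eLpNorm (fun z => grad γ w z - G z) (ENNReal.ofReal p) (volume.restrict C) ≤ δ := by
  have hp1 : (1 : ℝ≥0∞) ≤ ENNReal.ofReal p := by simpa using hp.le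
  obtain ⟨r, hr0, hrΩ⟩ := hC.exists_cthickening_subset_open hΩ hCΩ
  set C' := Metric.cthickening r C with hC'
  have hC'c : IsCompact C' := hC.cthickening
  have hC'm : MeasurableSet C' := hC'c.measurableSet
  set U := C'.indicator u with hU
  set H := C'.indicator G with hH
  have hUp : MemLp U (ENNReal.ofReal p) volume :=
    (memLp_indicator_iff_restrict hC'm).2 (h.memLp C' hC'c hrΩ)
  have hHp : MemLp H (ENNReal.ofReal p) volume :=
    (memLp_indicator_iff_restrict hC'm).2 (h.memLp_grad C' hC'c hrΩ)
  have hUi : Integrable U := by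
    refine (integrable_indicator_iff hC'm).2 ?_
    exact (hUp.locallyIntegrable hp1).integrableOn_isCompact hC'c |>.congr_fun
      (fun z hz => Set.indicator_of_mem hz u) hC'm
  have hHi : Integrable H := by
    refine (integrable_indicator_iff hC'm).2 ?_
    exact (hHp.locallyIntegrable hp1).integrableOn_isCompact hC'c |>.congr_fun
      (fun z hz => Set.indicator_of_mem hz G) hC'm
  have hδ2 : δ / 2 ≠ 0 := by simp [ENNReal.div_eq_zero_iff, hδ]
  obtain ⟨r1, hr1, hconv1⟩ := exists_radius_eLpNorm_conv_sub_le volume hp hUp hδ2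
  obtain ⟨r2, hr2, hconv2⟩ := exists_radius_eLpNorm_conv_sub_le volume hp hHp hδ2
  set s := min (min r1 r2) r with hs
  have hs0 : 0 < s := by positivity
  -- The mollifier in `y` is fixed first. Its derivative enters the commutator error, which is then
  -- made small by a mollifier in `x` of a much smaller scale, on which `|x|^γ` hardly oscillates.
  let ρy : ContDiffBump (0 : EuclideanSpace ℝ (Fin n)) := ⟨s / 2, s, by positivity, by linarith⟩
  set b := ρy.normed volume with hb
  have hbs : ContDiff ℝ ∞ b := ρy.contDiff_normed
  have hbc : HasCompactSupport b := ρy.hasCompactSupport_normed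
  have hbD : Continuous (fderiv ℝ b) := hbs.continuous_fderiv (by simp)
  have hbDi : Integrable (fderiv ℝ b) :=
    hbD.integrable_of_hasCompactSupport (hbc.fderiv (𝕜 := ℝ))
  -- the tolerance for the oscillation of the weight
  obtain ⟨θ, hθ0, hθ⟩ : ∃ θ : ℝ, 0 < θ ∧ (n * ENNReal.ofReal θ) * (∫⁻ y, ‖fderiv ℝ b y‖ₑ) *
      eLpNorm U (ENNReal.ofReal p) volume ≤ δ / 2 := by
    have : Tendsto (fun e : ℝ => (n * ENNReal.ofReal e) * (∫⁻ y, ‖fderiv ℝ b y‖ₑ) *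
        eLpNorm U (ENNReal.ofReal p) volume) (𝓝[>] 0) (𝓝 0) := by
      have h1 : Tendsto (fun e : ℝ => ENNReal.ofReal e) (𝓝[>] 0) (𝓝 0) := by
        have := (ENNReal.continuous_ofReal.tendsto 0).mono_left
          (nhdsWithin_le_nhds (s := Set.Ioi (0 : ℝ)))
        simpa using this
      have h2 := ENNReal.Tendsto.const_mul (a := (n : ℝ≥0∞)) h1 (Or.inr (by simp))
      have h3 := ENNReal.Tendsto.mul_const (b := ∫⁻ y, ‖fderiv ℝ b y‖ₑ) h2
        (Or.inr hbDi.2.ne)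
      have h4 := ENNReal.Tendsto.mul_const (b := eLpNorm U (ENNReal.ofReal p) volume) h3
        (Or.inr hUp.2.ne)
      simpa using h4
    have h2 := (this.eventually (gt_mem_nhds (pos_iff_ne_zero.2 hδ2))).and self_mem_nhdsWithin
    obtain ⟨e, h3, h4⟩ := h2.exists
    exact ⟨e, h4, h3.le⟩
  obtain ⟨ε, hε0, hε⟩ : ∃ ε > 0, ∀ x ∈ C', ∀ t ∈ C', ‖x.1 - t.1‖ < ε →
      |‖x.1‖ ^ γ - ‖t.1‖ ^ γ| < θ := by
    have huc : UniformContinuousOn (fun y : EuclideanSpace ℝ (Fin m) => ‖y‖ ^ γ)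
        (Prod.fst '' C') :=
      (hC'c.image continuous_fst).uniformContinuousOn_of_continuous
        (continuous_norm.rpow_const fun _ => Or.inr hγ.le).continuousOn
    obtain ⟨ε, hε0, hε⟩ := Metric.uniformContinuousOn_iff.1 huc θ hθ0
    refine ⟨ε, hε0, fun x hx t ht hxt => ?_⟩
    have := hε x.1 ⟨x, hx, rfl⟩ t.1 ⟨t, ht, rfl⟩ (by rwa [dist_eq_norm])
    rwa [Real.dist_eq] at this
  -- the mollifier in `x`
  let ρx : ContDiffBump (0 : EuclideanSpace ℝ (Fin m)) :=
    ⟨min (ε / 2) s / 2, min (ε / 2) s, by positivity,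
      by linarith [show 0 < min (ε / 2) s by positivity]⟩
  set a := ρx.normed volume with ha
  have has : ContDiff ℝ ∞ a := ρx.contDiff_normed
  have hac : HasCompactSupport a := ρx.hasCompactSupport_normed
  set κ : Space m n → ℝ := fun z => a z.1 * b z.2 with hκ
  have hκs : ContDiff ℝ ∞ κ := (has.comp contDiff_fst).mul (hbs.comp contDiff_snd)
  have hκ0 : ∀ z, 0 ≤ κ z := fun z => mul_nonneg (ρx.nonneg_normed _) (ρy.nonneg_normed _)
  have hκsupp : ∀ z, z ∈ tsupport κ → ‖z.1‖ ≤ min (ε / 2) s ∧ ‖z.2‖ ≤ s := by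
    intro z hz
    have hcl : tsupport κ ⊆ Metric.closedBall 0 (min (ε / 2) s) ×ˢ Metric.closedBall 0 s := by
      refine closure_minimal ?_ (Metric.isClosed_closedBall.prod Metric.isClosed_closedBall)
      intro z hz
      have h1 : a z.1 ≠ 0 := left_ne_zero_of_mul hz
      have h2 : b z.2 ≠ 0 := right_ne_zero_of_mul hz
      have h1' : z.1 ∈ Function.support a := h1
      have h2' : z.2 ∈ Function.support b := h2
      rw [ha, ρx.support_normed_eq] at h1'
      rw [hb, ρy.support_normed_eq] at h2'
      exact ⟨Metric.ball_subset_closedBall h1', Metric.ball_subset_closedBall h2'⟩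
    simpa using hcl hz
  have hκsupp' : Function.support κ ⊆ Metric.ball 0 s := by
    intro z hz
    have h1' : z.1 ∈ Function.support a := left_ne_zero_of_mul hz
    have h2' : z.2 ∈ Function.support b := right_ne_zero_of_mul hz
    rw [ha, ρx.support_normed_eq] at h1'
    rw [hb, ρy.support_normed_eq] at h2'
    rw [mem_ball_zero_iff] at h1' h2' ⊢
    exact max_lt (h1'.trans_le (min_le_right _ _)) h2'
  have hκc : HasCompactSupport κ := by
    refine HasCompactSupport.intro (isCompact_closedBall (0 : Space m n) s) fun z hz => ?_
    by_contra hne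
    exact hz (Metric.ball_subset_closedBall (hκsupp' hne))
  have hκ1 : ∫ z, κ z = 1 := by
    have := integral_prod_mul (μ := (volume : Measure (EuclideanSpace ℝ (Fin m))))
      (ν := (volume : Measure (EuclideanSpace ℝ (Fin n)))) a b
    rw [ha, hb, ρx.integral_normed, ρy.integral_normed, mul_one] at this
    exact this
  have hball : ∀ x ∈ C, ∀ t, x - t ∈ tsupport κ → t ∈ C' := by
    intro x hx t ht
    have h1 := hκsupp _ ht
    refine Metric.mem_cthickening_of_dist_le t x r C hx ?_
    rw [dist_comm, dist_eq_norm]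
    exact max_le (h1.1.trans ((min_le_right _ _).trans (min_le_right _ _)))
      (h1.2.trans (min_le_right _ _))
  set w := convolution U κ (ContinuousLinearMap.mul ℝ ℝ) volume with hw
  have hw' : ∀ x, w x = ∫ t, κ t • U (x - t) := by
    intro x
    rw [hw, convolution_mul, ← integral_sub_left_eq_self _ volume x]
    simp [mul_comm]
  have hle : ∀ {W : Type} [NormedAddCommGroup W] (F : Space m n → W),
      eLpNorm F (ENNReal.ofReal p) (volume.restrict C) ≤ eLpNorm F (ENNReal.ofReal p) volume :=
    fun F => eLpNorm_mono_measure F Measure.restrict_le_self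
  have hCC' : C ⊆ C' := Metric.self_subset_cthickening C
  refine ⟨w, hκc.contDiff_convolution_right (ContinuousLinearMap.mul ℝ ℝ) hUi.locallyIntegrable hκs,
    ?_, ?_⟩
  · have h1 := hconv1 κ hκs.continuous hκ0 hκ1 hκc
      (hκsupp'.trans (Metric.ball_subset_ball ((min_le_left _ _).trans (min_le_left _ _))))
    have h2 : eLpNorm (fun z => w z - u z) (ENNReal.ofReal p) (volume.restrict C) =
        eLpNorm (fun x => (∫ t, κ t • U (x - t)) - U x) (ENNReal.ofReal p)
          (volume.restrict C) := by
      refine eLpNorm_congr_ae ((ae_restrict_iff' hC.measurableSet).2 (ae_of_all _ fun z hz => ?_))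
      simp only [hw' z, hU, Set.indicator_of_mem (hCC' hz)]
    rw [h2]
    exact (hle _).trans (h1.trans ENNReal.half_le_self)
  · have h1 := hconv2 κ hκs.continuous hκ0 hκ1 hκc
      (hκsupp'.trans (Metric.ball_subset_ball ((min_le_left _ _).trans (min_le_right _ _))))
    -- `D` is the commutator of the Grushin gradient and the mollification
    set D : Space m n → GradSpace m n := fun x => grad γ w x - ∫ t, κ t • H (x - t) with hD
    have hDle : eLpNorm D (ENNReal.ofReal p) (volume.restrict C) ≤ δ / 2 := by
      have hκK : ∀ t j, ‖fderiv ℝ κ t (0, EuclideanSpace.single j 1)‖ₑ ≤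
          ‖a t.1 * ‖fderiv ℝ b t.2‖‖ₑ := by
        intro t j
        have hd : HasFDerivAt κ (a t.1 • (fderiv ℝ b t.2).comp (ContinuousLinearMap.snd ℝ _ _) +
            b t.2 • (fderiv ℝ a t.1).comp (ContinuousLinearMap.fst ℝ _ _)) t := by
          have d1 : HasFDerivAt (fun z : Space m n => a z.1)
              ((fderiv ℝ a t.1).comp (ContinuousLinearMap.fst ℝ _ _)) t :=
            ((has.differentiable (by simp)) t.1).hasFDerivAt.comp t hasFDerivAt_fst
          have d2 : HasFDerivAt (fun z : Space m n => b z.2)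
              ((fderiv ℝ b t.2).comp (ContinuousLinearMap.snd ℝ _ _)) t :=
            ((hbs.differentiable (by simp)) t.2).hasFDerivAt.comp t hasFDerivAt_snd
          exact d1.mul d2
        rw [hd.fderiv]
        simp only [add_apply, smul_apply,
          ContinuousLinearMap.comp_apply, ContinuousLinearMap.coe_snd',
          ContinuousLinearMap.coe_fst', map_zero, smul_eq_mul, mul_zero, add_zero]
        rw [enorm_mul, enorm_mul, enorm_norm]
        gcongr
        refine (ContinuousLinearMap.le_opENorm _ _).trans (le_of_eq ?_)
        simp [enorm_eq_nnnorm]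
      have hKm : AEStronglyMeasurable (fun t : Space m n => a t.1 * ‖fderiv ℝ b t.2‖) volume :=
        (((has.continuous.comp continuous_fst).mul
          (hbD.comp continuous_snd).norm)).aestronglyMeasurable
      have hKint : ∫⁻ t : Space m n, ‖a t.1 * ‖fderiv ℝ b t.2‖‖ₑ = ∫⁻ y, ‖fderiv ℝ b y‖ₑ := by
        have := lintegral_prod_mul (μ := (volume : Measure (EuclideanSpace ℝ (Fin m))))
          (ν := (volume : Measure (EuclideanSpace ℝ (Fin n)))) (f := fun x => ‖a x‖ₑ)
          (g := fun y => ‖fderiv ℝ b y‖ₑ) has.continuous.enorm.aemeasurable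
          hbD.enorm.aemeasurable
        have ha1 : ∫⁻ x, ‖a x‖ₑ = 1 := by
          rw [← ofReal_integral_norm_eq_lintegral_enorm (ρx.integrable_normed)]
          simp only [Real.norm_of_nonneg (ρx.nonneg_normed _), ρx.integral_normed,
            ENNReal.ofReal_one]
        rw [ha1, one_mul] at this
        simp only [enorm_mul, enorm_norm]
        exact this
      refine (eLpNorm_le_of_le_conv volume hp hKm hUp.1 hC.measurableSet (n * ENNReal.ofReal θ)
        fun x hx => ?_).trans ?_
      · refine (enorm_le_sum_enorm _).trans ?_
        have hk := grad_convolution_sub hγ h.weakGrad hκs hκc hrΩ hUi hHi (hball x hx)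
        rw [Fintype.sum_sum_type]
        have z1 : ∀ i, ‖D x (Sum.inl i)‖ₑ = 0 := fun i => by
          have := hk (Sum.inl i)
          simp only at this
          simp only [hD]
          rw [this]; simp
        have z2 : ∀ j, ‖D x (Sum.inr j)‖ₑ ≤
            ENNReal.ofReal θ * ∫⁻ t, ‖a t.1 * ‖fderiv ℝ b t.2‖‖ₑ * ‖U (x - t)‖ₑ := fun j => by
          have := hk (Sum.inr j)
          simp only at this
          simp only [hD]
          rw [this]
          refine (enorm_integral_le_lintegral_enorm _).trans ?_
          rw [← lintegral_sub_left_eq_self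
            (fun t => ‖a t.1 * ‖fderiv ℝ b t.2‖‖ₑ * ‖U (x - t)‖ₑ) x,
            ← lintegral_const_mul' _ _ ENNReal.ofReal_ne_top]
          refine lintegral_mono fun t => ?_
          simp only [sub_sub_cancel]
          rw [enorm_mul, enorm_mul, mul_comm]
          by_cases ht : x - t ∈ tsupport κ
          · have htC := hball x hx t ht
            have e1 : ‖‖x.1‖ ^ γ - ‖t.1‖ ^ γ‖ₑ ≤ ENNReal.ofReal θ := by
              rw [Real.enorm_eq_ofReal_abs]
              refine ENNReal.ofReal_le_ofReal ?_
              have hxt : ‖x.1 - t.1‖ ≤ ε / 2 := (hκsupp _ ht).1.trans (min_le_left _ _)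
              exact (hε x (hCC' hx) t htC (by linarith)).le
            calc _ ≤ ENNReal.ofReal θ * ‖a (x - t).1 * ‖fderiv ℝ b (x - t).2‖‖ₑ * ‖U t‖ₑ := by
                  gcongr
                  exact hκK _ j
              _ = _ := by rw [mul_assoc]
          · have : fderiv ℝ κ (x - t) = 0 := by
              by_contra hne
              exact ht (support_fderiv_subset ℝ hne)
            rw [this]; simp
        calc ∑ i, ‖D x (Sum.inl i)‖ₑ + ∑ j, ‖D x (Sum.inr j)‖ₑ
            ≤ 0 + ∑ j : Fin n, ENNReal.ofReal θ *
                ∫⁻ t, ‖a t.1 * ‖fderiv ℝ b t.2‖‖ₑ * ‖U (x - t)‖ₑ := by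
              refine add_le_add (le_of_eq (by simp [z1])) (Finset.sum_le_sum fun j _ => z2 j)
          _ = _ := by simp [mul_assoc]
      · rw [hKint]; exact hθ
    have hdec : eLpNorm (fun z => grad γ w z - G z) (ENNReal.ofReal p) (volume.restrict C) =
        eLpNorm (D + fun x => (∫ t, κ t • H (x - t)) - H x) (ENNReal.ofReal p)
          (volume.restrict C) := by
      refine eLpNorm_congr_ae ((ae_restrict_iff' hC.measurableSet).2 (ae_of_all _ fun z hz => ?_))
      simp only [hD, Pi.add_apply, hH, Set.indicator_of_mem (hCC' hz)]
      abel
    rw [hdec]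
    have hconvc : Continuous fun x => ∫ t, κ t • H (x - t) :=
      hκc.continuous_convolution_left (μ := volume) (ContinuousLinearMap.lsmul ℝ ℝ)
        hκs.continuous hHi.locallyIntegrable
    refine (eLpNorm_add_le ?_ ?_ hp1).trans ?_
    · exact ((continuous_grad hγ (hκc.contDiff_convolution_right (n := 1)
        (ContinuousLinearMap.mul ℝ ℝ) hUi.locallyIntegrable (hκs.of_le (by simp)))).sub
        hconvc).aestronglyMeasurable
    · exact (hconvc.aestronglyMeasurable.sub hHp.1).mono_measure Measure.restrict_le_self
    · exact (add_le_add hDle ((hle _).trans h1)).trans (le_of_eq (ENNReal.add_halves δ))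

end Mollification

/-! ### Limits of integrals of inner products -/

section Limits

variable {α : Type*} [MeasurableSpace α] {μ : Measure α}
  {V : Type*} [NormedAddCommGroup V] [InnerProductSpace ℝ V]

lemma integrable_inner_of_memLp {p q : ℝ} (hpq : p.HolderConjugate q) {A g : α → V}
    (hA : MemLp A (ENNReal.ofReal q) μ) (hg : MemLp g (ENNReal.ofReal p) μ) :
    Integrable (fun z => inner ℝ (A z) (g z)) μ := by
  have := hpq.symm.ennrealOfReal
  rw [← memLp_one_iff_integrable]
  refine ⟨hA.1.inner hg.1, ?_⟩
  refine (eLpNorm_le_eLpNorm_mul_eLpNorm'_of_norm (p := ENNReal.ofReal q) (q := ENNReal.ofReal p)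
    hA.1 hg.1 (fun x y => inner ℝ x y) 1
    (ae_of_all _ fun x => by simpa using norm_inner_le_norm (𝕜 := ℝ) (A x) (g x))).trans_lt ?_
  exact ENNReal.mul_lt_top (ENNReal.mul_lt_top (by simp) hA.2) hg.2

/-- Convergence of `∫ a ⟪A, g⟫` when the scalar factors converge boundedly a.e. and the vector
fields converge in `L^p`. -/
lemma tendsto_integral_mul_inner {p q : ℝ} (hpq : p.HolderConjugate q) {A g : α → V}
    {gs : ℕ → α → V} {a : α → ℝ} {as : ℕ → α → ℝ} {M : ℝ}
    (hA : MemLp A (ENNReal.ofReal q) μ) (hg : MemLp g (ENNReal.ofReal p) μ)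
    (hgs : ∀ i, MemLp (gs i) (ENNReal.ofReal p) μ)
    (hgt : Tendsto (fun i => eLpNorm (fun z => gs i z - g z) (ENNReal.ofReal p) μ) atTop (𝓝 0))
    (ham : ∀ i, AEStronglyMeasurable (as i) μ) (haM : ∀ i, ∀ᵐ z ∂μ, |as i z| ≤ M)
    (hat : ∀ᵐ z ∂μ, Tendsto (fun i => as i z) atTop (𝓝 (a z))) :
    Tendsto (fun i => ∫ z, as i z * inner ℝ (A z) (gs i z) ∂μ) atTop
      (𝓝 (∫ z, a z * inner ℝ (A z) (g z) ∂μ)) := by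
  have hAg := integrable_inner_of_memLp hpq hA hg
  have h1 : Tendsto (fun i => ∫ z, as i z * inner ℝ (A z) (g z) ∂μ) atTop
      (𝓝 (∫ z, a z * inner ℝ (A z) (g z) ∂μ)) := by
    refine tendsto_integral_of_dominated_convergence (fun z => M * |inner ℝ (A z) (g z)|)
      (fun i => (ham i).mul hAg.1) (hAg.abs.const_mul M) (fun i => ?_) ?_
    · filter_upwards [haM i] with z hz
      rw [norm_mul]
      exact mul_le_mul_of_nonneg_right hz (norm_nonneg _)
    · filter_upwards [hat] with z hz using hz.mul_const _
  have h2 : Tendsto (fun i => ∫ z, as i z * inner ℝ (A z) (gs i z - g z) ∂μ) atTop (𝓝 0) := by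
    have hb : ∀ i, ‖∫ z, as i z * inner ℝ (A z) (gs i z - g z) ∂μ‖ₑ ≤
        ENNReal.ofReal M * (eLpNorm A (ENNReal.ofReal q) μ *
          eLpNorm (fun z => gs i z - g z) (ENNReal.ofReal p) μ) := by
      intro i
      have := hpq.symm.ennrealOfReal
      have h3 := eLpNorm_le_eLpNorm_mul_eLpNorm'_of_norm (p := ENNReal.ofReal q)
        (q := ENNReal.ofReal p) (r := 1) hA.1 ((hgs i).1.sub hg.1) (fun x y => inner ℝ x y) 1
        (ae_of_all _ fun x => by simpa using norm_inner_le_norm (𝕜 := ℝ) (A x) ((gs i - g) x))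
      rw [eLpNorm_one_eq_lintegral_enorm] at h3
      calc _ ≤ ∫⁻ z, ‖as i z * inner ℝ (A z) (gs i z - g z)‖ₑ ∂μ :=
            enorm_integral_le_lintegral_enorm _
        _ ≤ ∫⁻ z, ENNReal.ofReal M * ‖inner ℝ (A z) (gs i z - g z)‖ₑ ∂μ := by
            refine lintegral_mono_ae ?_
            filter_upwards [haM i] with z hz
            rw [enorm_mul]
            gcongr
            rw [Real.enorm_eq_ofReal_abs]
            exact ENNReal.ofReal_le_ofReal hz
        _ = ENNReal.ofReal M * ∫⁻ z, ‖inner ℝ (A z) (gs i z - g z)‖ₑ ∂μ :=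
            lintegral_const_mul' _ _ ENNReal.ofReal_ne_top
        _ ≤ _ := by
            gcongr
            simp only [ENNReal.coe_one, one_mul] at h3
            exact h3
    rw [tendsto_iff_enorm_sub_tendsto_zero]
    simp only [sub_zero]
    refine tendsto_of_tendsto_of_tendsto_of_le_of_le tendsto_const_nhds ?_ (fun _ => zero_le) hb
    have h4 := ENNReal.Tendsto.const_mul (a := eLpNorm A (ENNReal.ofReal q) μ) hgt
      (Or.inr hA.2.ne)
    have h5 := ENNReal.Tendsto.const_mul (a := ENNReal.ofReal M) h4 (Or.inr ENNReal.ofReal_ne_top)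
    simpa using h5
  have h3 := h2.add h1
  rw [zero_add] at h3
  refine h3.congr fun i => ?_
  rw [← integral_add]
  · refine integral_congr_ae (ae_of_all _ fun z => ?_)
    simp only [inner_sub_right]; ring
  · exact (integrable_inner_of_memLp hpq hA ((hgs i).sub hg)).bdd_mul (ham i) (haM i)
  · exact hAg.bdd_mul (ham i) (haM i)

end Limits

/-! ### Calculus of the Grushin gradient for smooth functions -/

section Chain

variable {m n : ℕ}

/-- The gradient that the chain rule predicts for `Φ(u, v)`, when `Du` and `Dv` are the gradients of
`u` and `v`. -/
noncomputable def chainGrad (Φ : ℝ × ℝ → ℝ) (u v : Space m n → ℝ)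
    (Du Dv : Space m n → GradSpace m n) (z : Space m n) : GradSpace m n :=
  fderiv ℝ Φ (u z, v z) (1, 0) • Du z + fderiv ℝ Φ (u z, v z) (0, 1) • Dv z

lemma grad_comp {Φ : ℝ × ℝ → ℝ} (hΦ : ContDiff ℝ 1 Φ) {γ : ℝ} {u v : Space m n → ℝ}
    (hu : ContDiff ℝ 1 u) (hv : ContDiff ℝ 1 v) (z : Space m n) :
    grad γ (fun z => Φ (u z, v z)) z = chainGrad Φ u v (grad γ u) (grad γ v) z := by
  have h : HasFDerivAt (fun z => Φ (u z, v z))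
      ((fderiv ℝ Φ (u z, v z)).comp ((fderiv ℝ u z).prod (fderiv ℝ v z))) z :=
    (hΦ.differentiable (by simp) (u z, v z)).hasFDerivAt.comp z
      ((hu.differentiable (by simp) z).hasFDerivAt.prodMk
        (hv.differentiable (by simp) z).hasFDerivAt)
  have key : ∀ s t : ℝ, fderiv ℝ Φ (u z, v z) (s, t) =
      fderiv ℝ Φ (u z, v z) (1, 0) * s + fderiv ℝ Φ (u z, v z) (0, 1) * t := by
    intro s t
    have : ((s, t) : ℝ × ℝ) = s • (1, 0) + t • (0, 1) := by simp
    rw [this, map_add, map_smul, map_smul, smul_eq_mul, smul_eq_mul]; ring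
  ext k
  cases k with
  | inl i =>
    simp only [chainGrad, PiLp.add_apply, PiLp.smul_apply, grad_inl, h.fderiv, smul_eq_mul]
    exact key _ _
  | inr j =>
    simp only [chainGrad, PiLp.add_apply, PiLp.smul_apply, grad_inr, h.fderiv, smul_eq_mul]
    rw [ContinuousLinearMap.comp_apply, ContinuousLinearMap.prod_apply, key]
    ring

lemma grad_mul {γ : ℝ} {φ ψ : Space m n → ℝ} (hφ : ContDiff ℝ 1 φ) (hψ : ContDiff ℝ 1 ψ)
    (z : Space m n) :
    grad γ (fun z => φ z * ψ z) z = ψ z • grad γ φ z + φ z • grad γ ψ z := by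
  have h := (hφ.differentiable (by simp) z).hasFDerivAt.mul
    (hψ.differentiable (by simp) z).hasFDerivAt
  ext k
  cases k with
  | inl i =>
    simp only [PiLp.add_apply, PiLp.smul_apply, grad_inl, smul_eq_mul]
    erw [h.fderiv]
    simp [add_comm]
  | inr j =>
    simp only [PiLp.add_apply, PiLp.smul_apply, grad_inr, smul_eq_mul]
    erw [h.fderiv]
    simp; ring

lemma grad_eq_zero_of_notMem_tsupport {γ : ℝ} {φ : Space m n → ℝ} {z : Space m n}
    (hz : z ∉ tsupport φ) : grad γ φ z = 0 := by
  have : fderiv ℝ φ z = 0 := by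
    by_contra hne
    exact hz (support_fderiv_subset ℝ hne)
  ext k
  cases k with
  | inl i => simp [grad_inl, this]
  | inr j => simp [grad_inr, this]

/-- Integration by parts for smooth functions; `|x|^γ` need not be differentiable, but it does not
depend on `y`. -/
lemma integral_mul_grad {γ : ℝ} (hγ : 0 < γ) {w φ : Space m n → ℝ} (hw : ContDiff ℝ 1 w)
    (hφ : ContDiff ℝ 1 φ) (hφc : HasCompactSupport φ) (k : Fin m ⊕ Fin n) :
    ∫ z, w z * grad γ φ z k = - ∫ z, grad γ w z k * φ z := by
  have hcw := continuous_grad hγ hw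
  have hcφ := continuous_grad hγ hφ
  have hgc : HasCompactSupport fun z => grad γ φ z k := by
    refine HasCompactSupport.intro hφc.isCompact fun z hz => ?_
    rw [grad_eq_zero_of_notMem_tsupport hz]; rfl
  have hck : ∀ {f : Space m n → GradSpace m n}, Continuous f → Continuous fun z => f z k :=
    fun hf => (EuclideanSpace.proj (𝕜 := ℝ) k).continuous.comp hf
  have i1 : Integrable fun z => grad γ w z k * φ z :=
    ((hck hcw).mul hφ.continuous).integrable_of_hasCompactSupport hφc.mul_left
  have i2 : Integrable fun z => w z * grad γ φ z k :=
    (hw.continuous.mul (hck hcφ)).integrable_of_hasCompactSupport hgc.mul_left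
  have hline : ∀ {f : Space m n → ℝ}, ContDiff ℝ 1 f → ∀ x e,
      HasLineDerivAt ℝ f (fderiv ℝ f x e) x e := fun hf x e =>
    ((hf.differentiable (by simp) x).hasFDerivAt).hasLineDerivAt e
  cases k with
  | inl i =>
    have i3 : Integrable fun z => w z * φ z :=
      (hw.continuous.mul hφ.continuous).integrable_of_hasCompactSupport hφc.mul_left
    exact integral_bilinear_hasLineDerivAt_right_eq_neg_left_of_integrable
      (B := ContinuousLinearMap.mul ℝ ℝ) (v := (EuclideanSpace.single i 1, 0)) i1 i2 i3
      (fun x _ => hline hw x _) (fun x _ => hline hφ x _)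
  | inr j =>
    have hc : Continuous fun z : Space m n => ‖z.1‖ ^ γ := continuous_norm_fst_rpow hγ
    have i3 : Integrable fun z => w z * (‖z.1‖ ^ γ * φ z) :=
      (hw.continuous.mul (hc.mul hφ.continuous)).integrable_of_hasCompactSupport
        hφc.mul_left.mul_left
    have hφ' : ∀ x, HasLineDerivAt ℝ (fun z : Space m n => ‖z.1‖ ^ γ * φ z)
        (grad γ φ x (Sum.inr j)) x (0, EuclideanSpace.single j 1) := by
      intro x
      have h1 := hline hφ x (0, EuclideanSpace.single j 1)
      unfold HasLineDerivAt at h1 ⊢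
      have h2 := h1.const_mul (‖x.1‖ ^ γ)
      simpa [grad_inr] using h2
    have := integral_bilinear_hasLineDerivAt_right_eq_neg_left_of_integrable (μ := volume)
      (B := ContinuousLinearMap.mul ℝ ℝ) (v := ((0, EuclideanSpace.single j 1) : Space m n))
      (f := w) (f' := fun z => fderiv ℝ w z (0, EuclideanSpace.single j 1))
      (g := fun z : Space m n => ‖z.1‖ ^ γ * φ z) (g' := fun z => grad γ φ z (Sum.inr j))
      (i1.congr (ae_of_all _ fun z => by simp only [grad_inr, ContinuousLinearMap.mul_apply']; ring))
      i2 i3 (fun x _ => hline hw x _) (fun x _ => hφ' x)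
    simp only [ContinuousLinearMap.mul_apply'] at this
    rw [this]
    congr 2
    funext z
    simp only [grad_inr]; ring

end Chain

/-! ### The weak chain rule and weak inequalities with Sobolev test functions -/

section WeakCalculus

variable {m n : ℕ}

/-- Smooth functions that converge to `u` on a compact set, with their gradients, in `L^p` and
almost everywhere. -/
lemma LocMemW.exists_smooth_seq {γ p : ℝ} (hγ : 0 < γ) (hp : 1 < p) {Ω : Set (Space m n)}
    (hΩ : IsOpen Ω) {u : Space m n → ℝ} {G : Space m n → GradSpace m n} (h : LocMemW γ p Ω u G)
    {C : Set (Space m n)} (hC : IsCompact C) (hCΩ : C ⊆ Ω) :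
    ∃ w : ℕ → Space m n → ℝ, (∀ i, ContDiff ℝ ∞ (w i)) ∧
      Tendsto (fun i => eLpNorm (fun z => w i z - u z) (ENNReal.ofReal p) (volume.restrict C))
        atTop (𝓝 0) ∧
      Tendsto (fun i => eLpNorm (fun z => grad γ (w i) z - G z) (ENNReal.ofReal p)
        (volume.restrict C)) atTop (𝓝 0) ∧
      ∀ᵐ z ∂volume.restrict C, Tendsto (fun i => w i z) atTop (𝓝 (u z)) := by
  have hδ : ∀ i : ℕ, (i + 1 : ℝ≥0∞)⁻¹ ≠ 0 := fun i => by
    simp only [ne_eq, ENNReal.inv_eq_zero]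
    exact ENNReal.add_ne_top.2 ⟨ENNReal.natCast_ne_top i, ENNReal.one_ne_top⟩
  choose w hws hw1 hw2 using fun i : ℕ => h.exists_smooth_approx hγ hp hΩ hC hCΩ (hδ i)
  have hlim : Tendsto (fun i : ℕ => (i + 1 : ℝ≥0∞)⁻¹) atTop (𝓝 0) := by
    have := ENNReal.tendsto_inv_nat_nhds_zero.comp (tendsto_add_atTop_nat 1)
    refine this.congr fun i => ?_
    simp
  have t1 : Tendsto (fun i => eLpNorm (fun z => w i z - u z) (ENNReal.ofReal p)
      (volume.restrict C)) atTop (𝓝 0) :=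
    tendsto_of_tendsto_of_tendsto_of_le_of_le tendsto_const_nhds hlim (fun _ => zero_le) hw1
  have t2 : Tendsto (fun i => eLpNorm (fun z => grad γ (w i) z - G z) (ENNReal.ofReal p)
      (volume.restrict C)) atTop (𝓝 0) :=
    tendsto_of_tendsto_of_tendsto_of_le_of_le tendsto_const_nhds hlim (fun _ => zero_le) hw2
  obtain ⟨ns, hns, hae⟩ := (tendstoInMeasure_of_tendsto_eLpNorm
    (by simpa using by linarith) (fun i => (hws i).continuous.aestronglyMeasurable)
    (h.memLp C hC hCΩ).1 t1).exists_seq_tendsto_ae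
  exact ⟨fun i => w (ns i), fun i => hws _, t1.comp hns.tendsto_atTop, t2.comp hns.tendsto_atTop,
    hae⟩

/-- Passage to the limit in the weak form of an inequality tested with `ψ Φ(u, v)`; the gradient of
the test function is `Φ(u, v) B + ψ (∂₁Φ Du + ∂₂Φ Dv)` with `B = ∇ψ`. -/
lemma tendsto_integral_inner_chainGrad {μ : Measure (Space m n)} {p q : ℝ}
    (hpq : p.HolderConjugate q) {Φ : ℝ × ℝ → ℝ} (hΦ : ContDiff ℝ 1 Φ) {M : ℝ}
    (hM : ∀ s, |Φ s| ≤ M) (hM' : ∀ s, ‖fderiv ℝ Φ s‖ ≤ M)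
    {A B : Space m n → GradSpace m n} (hA : MemLp A (ENNReal.ofReal q) μ)
    (hB : MemLp B (ENNReal.ofReal p) μ) {ψ : Space m n → ℝ} (hψ : AEStronglyMeasurable ψ μ)
    {M₁ : ℝ} (hψM : ∀ z, |ψ z| ≤ M₁)
    {u v : Space m n → ℝ} {Du Dv : Space m n → GradSpace m n}
    {us vs : ℕ → Space m n → ℝ} {Dus Dvs : ℕ → Space m n → GradSpace m n}
    (husm : ∀ i, AEStronglyMeasurable (us i) μ) (hvsm : ∀ i, AEStronglyMeasurable (vs i) μ)
    (hut : ∀ᵐ z ∂μ, Tendsto (fun i => us i z) atTop (𝓝 (u z)))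
    (hvt : ∀ᵐ z ∂μ, Tendsto (fun i => vs i z) atTop (𝓝 (v z)))
    (hDu : MemLp Du (ENNReal.ofReal p) μ) (hDv : MemLp Dv (ENNReal.ofReal p) μ)
    (hDus : ∀ i, MemLp (Dus i) (ENNReal.ofReal p) μ)
    (hDvs : ∀ i, MemLp (Dvs i) (ENNReal.ofReal p) μ)
    (hDut : Tendsto (fun i => eLpNorm (fun z => Dus i z - Du z) (ENNReal.ofReal p) μ) atTop (𝓝 0))
    (hDvt : Tendsto (fun i => eLpNorm (fun z => Dvs i z - Dv z) (ENNReal.ofReal p) μ) atTop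
      (𝓝 0)) :
    Tendsto (fun i => ∫ z, inner ℝ (A z) (Φ (us i z, vs i z) • B z +
        ψ z • chainGrad Φ (us i) (vs i) (Dus i) (Dvs i) z) ∂μ) atTop
      (𝓝 (∫ z, inner ℝ (A z) (Φ (u z, v z) • B z + ψ z • chainGrad Φ u v Du Dv z) ∂μ)) := by
  have hum : AEStronglyMeasurable u μ := aestronglyMeasurable_of_tendsto_ae atTop husm hut
  have hvm : AEStronglyMeasurable v μ := aestronglyMeasurable_of_tendsto_ae atTop hvsm hvt
  have hcD : ∀ e, Continuous fun s => fderiv ℝ Φ s e := fun e =>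
    (hΦ.continuous_fderiv (by simp)).clm_apply continuous_const
  have hM0 : 0 ≤ M := (abs_nonneg _).trans (hM 0)
  have hM10 : 0 ≤ M₁ := (abs_nonneg _).trans (hψM 0)
  have hMe : ∀ s (e : ℝ × ℝ), ‖e‖ ≤ 1 → |fderiv ℝ Φ s e| ≤ M := fun s e he => by
    calc |fderiv ℝ Φ s e| ≤ ‖fderiv ℝ Φ s‖ * ‖e‖ := (fderiv ℝ Φ s).le_opNorm e
      _ ≤ M * 1 := mul_le_mul (hM' s) he (norm_nonneg _) hM0
      _ = M := mul_one _
  have he1 : ‖((1, 0) : ℝ × ℝ)‖ ≤ 1 := by simp [Prod.norm_def]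
  have he2 : ‖((0, 1) : ℝ × ℝ)‖ ≤ 1 := by simp [Prod.norm_def]
  have hψe : ∀ (e : ℝ × ℝ), ‖e‖ ≤ 1 → ∀ s z, |ψ z * fderiv ℝ Φ s e| ≤ M₁ * M := by
    intro e he s z
    rw [abs_mul]
    exact mul_le_mul (hψM z) (hMe s e he) (abs_nonneg _) hM10
  have hpt : ∀ᵐ z ∂μ, Tendsto (fun i => (us i z, vs i z)) atTop (𝓝 (u z, v z)) := by
    filter_upwards [hut, hvt] with z h1 h2 using h1.prodMk_nhds h2
  have hcm : ∀ {F : ℝ × ℝ → ℝ}, Continuous F → ∀ {a b : Space m n → ℝ},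
      AEStronglyMeasurable a μ → AEStronglyMeasurable b μ →
      AEStronglyMeasurable (fun z => F (a z, b z)) μ :=
    fun hF _ _ ha hb => hF.comp_aestronglyMeasurable (ha.prodMk hb)
  have hconst : Tendsto (fun _ : ℕ => eLpNorm (fun z => B z - B z) (ENNReal.ofReal p) μ) atTop
      (𝓝 0) := by simp
  have t1 := tendsto_integral_mul_inner hpq hA hB (fun _ => hB) hconst
    (fun i => hcm hΦ.continuous (husm i) (hvsm i)) (fun i => ae_of_all _ fun z => hM _)
    (by filter_upwards [hpt] with z hz using (hΦ.continuous.tendsto _).comp hz)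
  have t2 := tendsto_integral_mul_inner hpq hA hDu hDus hDut
    (fun i => hψ.mul (hcm (hcD (1, 0)) (husm i) (hvsm i)))
    (fun i => ae_of_all _ fun z => hψe _ he1 _ z)
    (a := fun z => ψ z * fderiv ℝ Φ (u z, v z) (1, 0))
    (by filter_upwards [hpt] with z hz using (((hcD (1, 0)).tendsto _).comp hz).const_mul _)
  have t3 := tendsto_integral_mul_inner hpq hA hDv hDvs hDvt
    (fun i => hψ.mul (hcm (hcD (0, 1)) (husm i) (hvsm i)))
    (fun i => ae_of_all _ fun z => hψe _ he2 _ z)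
    (a := fun z => ψ z * fderiv ℝ Φ (u z, v z) (0, 1))
    (by filter_upwards [hpt] with z hz using (((hcD (0, 1)).tendsto _).comp hz).const_mul _)
  -- the limit is taken separately in the three terms of the product rule
  have hsplit : ∀ {a b : Space m n → ℝ} {Da Db : Space m n → GradSpace m n},
      AEStronglyMeasurable a μ → AEStronglyMeasurable b μ → MemLp Da (ENNReal.ofReal p) μ →
      MemLp Db (ENNReal.ofReal p) μ →
      ∫ z, inner ℝ (A z) (Φ (a z, b z) • B z + ψ z • chainGrad Φ a b Da Db z) ∂μ =
        ∫ z, Φ (a z, b z) * inner ℝ (A z) (B z) ∂μ +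
        ∫ z, (ψ z * fderiv ℝ Φ (a z, b z) (1, 0)) * inner ℝ (A z) (Da z) ∂μ +
        ∫ z, (ψ z * fderiv ℝ Φ (a z, b z) (0, 1)) * inner ℝ (A z) (Db z) ∂μ := by
    intro a b Da Db ha hb hDa hDb
    have j1 : Integrable (fun z => Φ (a z, b z) * inner ℝ (A z) (B z)) μ :=
      (integrable_inner_of_memLp hpq hA hB).bdd_mul (hcm hΦ.continuous ha hb)
        (ae_of_all _ fun z => hM _)
    have j2 : Integrable (fun z => (ψ z * fderiv ℝ Φ (a z, b z) (1, 0)) *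
        inner ℝ (A z) (Da z)) μ :=
      (integrable_inner_of_memLp hpq hA hDa).bdd_mul (hψ.mul (hcm (hcD (1, 0)) ha hb))
        (ae_of_all _ fun z => hψe _ he1 _ z)
    have j3 : Integrable (fun z => (ψ z * fderiv ℝ Φ (a z, b z) (0, 1)) *
        inner ℝ (A z) (Db z)) μ :=
      (integrable_inner_of_memLp hpq hA hDb).bdd_mul (hψ.mul (hcm (hcD (0, 1)) ha hb))
        (ae_of_all _ fun z => hψe _ he2 _ z)
    have e := integral_add (j1.add j2) j3
    simp only [Pi.add_apply] at e
    rw [← integral_add j1 j2, ← e]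
    refine integral_congr_ae (ae_of_all _ fun z => ?_)
    simp only [chainGrad, inner_add_right, real_inner_smul_right]
    ring
  rw [hsplit hum hvm hDu hDv]
  refine ((t1.add t2).add t3).congr fun i => ?_
  rw [hsplit (husm i) (hvsm i) (hDus i) (hDvs i)]
  rfl

lemma memLp_restrict_of_continuous {V : Type*} [NormedAddCommGroup V] {r : ℝ≥0∞}
    {C : Set (Space m n)} (hC : IsCompact C) {f : Space m n → V} (hf : Continuous f) :
    MemLp f r (volume.restrict C) := by
  have : IsFiniteMeasure (volume.restrict C) := ⟨by simpa using hC.measure_lt_top⟩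
  obtain ⟨b, hb⟩ := hC.exists_bound_of_continuousOn hf.continuousOn
  exact MemLp.of_bound (hf.continuousOn.aestronglyMeasurable_of_isCompact hC hC.measurableSet) b
    ((ae_restrict_iff' hC.measurableSet).2 (ae_of_all _ hb))

/-- The chain rule for a smooth function of two Sobolev functions. -/
lemma integral_comp_mul_grad {γ p : ℝ} (hγ : 0 < γ) (hp : 1 < p) {Ω : Set (Space m n)}
    (hΩ : IsOpen Ω) {u v : Space m n → ℝ} {Du Dv : Space m n → GradSpace m n}
    (hu : LocMemW γ p Ω u Du) (hv : LocMemW γ p Ω v Dv) {Φ : ℝ × ℝ → ℝ} (hΦ : ContDiff ℝ 1 Φ)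
    {M : ℝ} (hM : ∀ s, |Φ s| ≤ M) (hM' : ∀ s, ‖fderiv ℝ Φ s‖ ≤ M) {φ : Space m n → ℝ}
    (hφ : IsTest Ω φ) (k : Fin m ⊕ Fin n) :
    ∫ z in Ω, Φ (u z, v z) * grad γ φ z k = - ∫ z in Ω, chainGrad Φ u v Du Dv z k * φ z := by
  have hpq := Real.HolderConjugate.conjExponent hp
  set C := tsupport φ with hCdef
  have hC : IsCompact C := hφ.compact
  have hCΩ : C ⊆ Ω := hφ.supp
  obtain ⟨us, hus, -, hDut, hut⟩ := hu.exists_smooth_seq hγ hp hΩ hC hCΩ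
  obtain ⟨vs, hvs, -, hDvt, hvt⟩ := hv.exists_smooth_seq hγ hp hΩ hC hCΩ
  have hrestr : ∀ F : Space m n → ℝ, (∀ z ∉ C, F z = 0) → ∫ z in Ω, F z = ∫ z in C, F z :=
    fun F hF => setIntegral_eq_of_subset_of_forall_sdiff_eq_zero hΩ.measurableSet hCΩ
      fun z hz => hF z hz.2
  have hφz : ∀ z ∉ C, φ z = 0 := fun z hz => image_eq_zero_of_notMem_tsupport hz
  have hgz : ∀ z ∉ C, grad γ φ z = 0 := fun z hz => grad_eq_zero_of_notMem_tsupport hz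
  have hrestr' : ∀ F : Space m n → ℝ, (∀ z ∉ C, F z = 0) → ∫ z, F z = ∫ z in C, F z :=
    fun F hF => (setIntegral_eq_integral_of_forall_compl_eq_zero hF).symm
  rw [hrestr _ fun z hz => by rw [hgz z hz]; simp, hrestr _ fun z hz => by rw [hφz z hz]; simp]
  have c1 : ∀ {f : Space m n → ℝ}, ContDiff ℝ ∞ f → ContDiff ℝ 1 f := fun hf => hf.of_le (by simp)
  have hgc : Continuous fun z => grad γ φ z k :=
    (EuclideanSpace.proj (𝕜 := ℝ) k).continuous.comp (continuous_grad hγ (c1 hφ.smooth))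
  obtain ⟨M₁, hM₁⟩ := hφ.compact.exists_bound_of_continuous hφ.smooth.continuous
  have t1 : Tendsto (fun i => ∫ z in C, Φ (us i z, vs i z) * grad γ φ z k) atTop
      (𝓝 (∫ z in C, Φ (u z, v z) * grad γ φ z k)) := by
    refine tendsto_integral_of_dominated_convergence (fun z => M * |grad γ φ z k|)
      (fun i => ?_) ?_ (fun i => ae_of_all _ fun z => ?_) ?_
    · exact ((hΦ.continuous.comp ((hus i).continuous.prodMk (hvs i).continuous)).mul
        hgc).aestronglyMeasurable
    · exact (continuous_const.mul hgc.abs).continuousOn.integrableOn_compact hC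
    · rw [norm_mul]
      exact mul_le_mul_of_nonneg_right (hM _) (norm_nonneg _)
    · filter_upwards [hut, hvt] with z h1 h2
      exact ((hΦ.continuous.tendsto _).comp (h1.prodMk_nhds h2)).mul_const _
  have : IsFiniteMeasure (volume.restrict C) := ⟨by simpa using hC.measure_lt_top⟩
  have t2 := tendsto_integral_inner_chainGrad hpq hΦ hM hM' (μ := volume.restrict C)
    (A := fun _ => EuclideanSpace.single k 1) (memLp_const _) (B := 0) MemLp.zero
    hφ.smooth.continuous.aestronglyMeasurable hM₁
    (fun i => (hus i).continuous.aestronglyMeasurable)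
    (fun i => (hvs i).continuous.aestronglyMeasurable) hut hvt (hu.memLp_grad C hC hCΩ)
    (hv.memLp_grad C hC hCΩ)
    (fun i => memLp_restrict_of_continuous hC (continuous_grad hγ (c1 (hus i))))
    (fun i => memLp_restrict_of_continuous hC (continuous_grad hγ (c1 (hvs i)))) hDut hDvt
  have e : ∀ x : GradSpace m n, ∀ z, inner ℝ (EuclideanSpace.single k (1 : ℝ)) (φ z • x) =
      x k * φ z := fun x z => by
    simp [EuclideanSpace.inner_single_left, mul_comm]
  simp only [Pi.zero_apply, smul_zero, zero_add, e] at t2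
  refine tendsto_nhds_unique t1 (t2.neg.congr fun i => ?_)
  have hparts := integral_mul_grad hγ (w := fun z => Φ (us i z, vs i z))
    (hΦ.comp ((c1 (hus i)).prodMk (c1 (hvs i)))) (c1 hφ.smooth) hφ.compact k
  rw [hrestr' _ fun z hz => by rw [hgz z hz]; simp,
    hrestr' _ fun z hz => by rw [hφz z hz]; simp] at hparts
  rw [hparts]
  simp only [grad_comp hΦ (c1 (hus i)) (c1 (hvs i))]

/-- A weak inequality `∫ ⟪A, ∇φ⟫ ≤ ∫ h φ` may be tested with `φ = ψ Φ(u, v)`. -/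
lemma integral_inner_chainGrad_le {γ p q : ℝ} (hγ : 0 < γ) (hpq : p.HolderConjugate q)
    {Ω : Set (Space m n)} (hΩ : IsOpen Ω) {u v : Space m n → ℝ}
    {Du Dv : Space m n → GradSpace m n}
    (hu : LocMemW γ p Ω u Du) (hv : LocMemW γ p Ω v Dv) {Φ : ℝ × ℝ → ℝ} (hΦ : ContDiff ℝ ∞ Φ)
    {M : ℝ} (hM : ∀ s, |Φ s| ≤ M) (hM' : ∀ s, ‖fderiv ℝ Φ s‖ ≤ M) (hΦ0 : ∀ s, 0 ≤ Φ s)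
    {A : Space m n → GradSpace m n} {h : Space m n → ℝ}
    (hA : ∀ C, IsCompact C → C ⊆ Ω → MemLp A (ENNReal.ofReal q) (volume.restrict C))
    (hh : ∀ C, IsCompact C → C ⊆ Ω → IntegrableOn h C)
    (hineq : ∀ φ, IsTest Ω φ → (∀ z, 0 ≤ φ z) →
      ∫ z in Ω, inner ℝ (A z) (grad γ φ z) ≤ ∫ z in Ω, h z * φ z)
    {ψ : Space m n → ℝ} (hψ : IsTest Ω ψ) (hψ0 : ∀ z, 0 ≤ ψ z) :
    ∫ z in Ω, inner ℝ (A z) (Φ (u z, v z) • grad γ ψ z + ψ z • chainGrad Φ u v Du Dv z) ≤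
      ∫ z in Ω, h z * (ψ z * Φ (u z, v z)) := by
  have hp : 1 < p := hpq.lt
  set C := tsupport ψ with hCdef
  have hC : IsCompact C := hψ.compact
  have hCΩ : C ⊆ Ω := hψ.supp
  obtain ⟨us, hus, -, hDut, hut⟩ := hu.exists_smooth_seq hγ hp hΩ hC hCΩ
  obtain ⟨vs, hvs, -, hDvt, hvt⟩ := hv.exists_smooth_seq hγ hp hΩ hC hCΩ
  have hrestr : ∀ F : Space m n → ℝ, (∀ z ∉ C, F z = 0) → ∫ z in Ω, F z = ∫ z in C, F z :=
    fun F hF => setIntegral_eq_of_subset_of_forall_sdiff_eq_zero hΩ.measurableSet hCΩ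
      fun z hz => hF z hz.2
  have hψz : ∀ z ∉ C, ψ z = 0 := fun z hz => image_eq_zero_of_notMem_tsupport hz
  have hgz : ∀ z ∉ C, grad γ ψ z = 0 := fun z hz => grad_eq_zero_of_notMem_tsupport hz
  rw [hrestr _ fun z hz => by rw [hψz z hz, hgz z hz]; simp,
    hrestr _ fun z hz => by rw [hψz z hz]; simp]
  obtain ⟨M₁, hM₁⟩ := hψ.compact.exists_bound_of_continuous hψ.smooth.continuous
  have c1 : ∀ {f : Space m n → ℝ}, ContDiff ℝ ∞ f → ContDiff ℝ 1 f := fun hf => hf.of_le (by simp)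
  have L := tendsto_integral_inner_chainGrad hpq (hΦ.of_le (by simp)) hM hM' (hA C hC hCΩ)
    (memLp_restrict_of_continuous hC (continuous_grad hγ (c1 hψ.smooth)))
    hψ.smooth.continuous.aestronglyMeasurable hM₁
    (fun i => (hus i).continuous.aestronglyMeasurable)
    (fun i => (hvs i).continuous.aestronglyMeasurable) hut hvt (hu.memLp_grad C hC hCΩ)
    (hv.memLp_grad C hC hCΩ)
    (fun i => memLp_restrict_of_continuous hC (continuous_grad hγ (c1 (hus i))))
    (fun i => memLp_restrict_of_continuous hC (continuous_grad hγ (c1 (hvs i)))) hDut hDvt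
  have R : Tendsto (fun i => ∫ z in C, h z * (ψ z * Φ (us i z, vs i z))) atTop
      (𝓝 (∫ z in C, h z * (ψ z * Φ (u z, v z)))) := by
    refine tendsto_integral_of_dominated_convergence (fun z => |h z| * (M₁ * M))
      (fun i => ?_) ((hh C hC hCΩ).abs.mul_const _) (fun i => ae_of_all _ fun z => ?_) ?_
    · exact (hh C hC hCΩ).1.mul (hψ.smooth.continuous.mul
        (hΦ.continuous.comp ((hus i).continuous.prodMk (hvs i).continuous))).aestronglyMeasurable
    · rw [norm_mul, norm_mul]
      exact mul_le_mul_of_nonneg_left (mul_le_mul (hM₁ z) (hM _) (norm_nonneg _)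
        ((norm_nonneg _).trans (hM₁ z))) (norm_nonneg _)
    · filter_upwards [hut, hvt] with z h1 h2
      exact (((hΦ.continuous.tendsto _).comp (h1.prodMk_nhds h2)).const_mul _).const_mul _
  refine le_of_tendsto_of_tendsto' L R fun i => ?_
  have hΦi : ContDiff ℝ ∞ fun z => Φ (us i z, vs i z) := hΦ.comp ((hus i).prodMk (hvs i))
  -- for smooth approximations of `u` and `v` the test function is admissible
  have htest : IsTest Ω fun z => ψ z * Φ (us i z, vs i z) :=
    ⟨hψ.smooth.mul hΦi, hψ.compact.mul_right, (tsupport_mul_subset_left).trans hψ.supp⟩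
  have := hineq _ htest fun z => mul_nonneg (hψ0 z) (hΦ0 _)
  simp only [grad_mul (c1 hψ.smooth) (c1 hΦi), grad_comp (hΦ.of_le (by simp)) (c1 (hus i))
    (c1 (hvs i))] at this
  rwa [hrestr _ fun z hz => by rw [hψz z hz, hgz z hz]; simp,
    hrestr _ fun z hz => by rw [hψz z hz]; simp] at this

end WeakCalculus

/-! ### Smooth truncations and steps on the real line -/

section SmoothFunctions

/-- A smooth version of the positive part: it is `0` for `s ≤ 0` and `s` for `s ≥ 1`. -/
noncomputable def smoothPos (s : ℝ) : ℝ := s * Real.smoothTransition s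

lemma smoothPos_contDiff : ContDiff ℝ ∞ smoothPos :=
  contDiff_id.mul Real.smoothTransition.contDiff

lemma smoothPos_of_nonpos {s : ℝ} (hs : s ≤ 0) : smoothPos s = 0 := by
  simp [smoothPos, Real.smoothTransition.zero_of_nonpos hs]

lemma smoothPos_of_one_le {s : ℝ} (hs : 1 ≤ s) : smoothPos s = s := by
  simp [smoothPos, Real.smoothTransition.one_of_one_le hs]

lemma smoothPos_nonneg (s : ℝ) : 0 ≤ smoothPos s := by
  rcases le_total s 0 with h | h
  · rw [smoothPos_of_nonpos h]
  · exact mul_nonneg h (Real.smoothTransition.nonneg s)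

lemma smoothPos_le (s : ℝ) : smoothPos s ≤ max s 0 := by
  rcases le_total s 0 with h | h
  · rw [smoothPos_of_nonpos h]; exact le_max_right _ _
  · exact (mul_le_of_le_one_right h (Real.smoothTransition.le_one s)).trans (le_max_left _ _)

lemma le_smoothPos_add_one (s : ℝ) : s - 1 ≤ smoothPos s := by
  rcases le_total s 1 with h | h
  · linarith [smoothPos_nonneg s]
  · rw [smoothPos_of_one_le h]; linarith

/-- A continuous function is bounded if it takes constant values to the left of `0` and to the
right of `1`. -/
lemma exists_bound_of_eq_const {f : ℝ → ℝ} (hf : Continuous f) {a b : ℝ}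
    (h0 : ∀ s < 0, f s = a) (h1 : ∀ s, 1 < s → f s = b) : ∃ M, ∀ s, |f s| ≤ M := by
  obtain ⟨M, hM⟩ := (isCompact_Icc (a := (0 : ℝ)) (b := 1)).exists_bound_of_continuousOn
    hf.continuousOn
  refine ⟨max M (max |a| |b|), fun s => ?_⟩
  rcases lt_or_ge s 0 with hs | hs
  · rw [h0 s hs]; exact (le_max_left _ _).trans (le_max_right _ _)
  rcases lt_or_ge 1 s with hs' | hs'
  · rw [h1 s hs']; exact (le_max_right _ _).trans (le_max_right _ _)
  · exact (hM s ⟨hs, hs'⟩).trans (le_max_left _ _)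

lemma deriv_eq_zero_of_eq_zero_of_lt {f : ℝ → ℝ} (hf : ContDiff ℝ 1 f) {a : ℝ}
    (h : ∀ s < a, f s = 0) {s : ℝ} (hs : s ≤ a) : deriv f s = 0 := by
  have hlt : ∀ s < a, deriv f s = 0 := fun s hs => by
    have : f =ᶠ[𝓝 s] fun _ => 0 := by
      filter_upwards [gt_mem_nhds hs] with t ht using h t ht
    rw [this.deriv_eq, deriv_const]
  rcases hs.lt_or_eq with hs | rfl
  · exact hlt s hs
  · have hc : Continuous (deriv f) := hf.continuous_deriv (by simp)
    refine tendsto_nhds_unique ((hc.tendsto s).mono_left (nhdsWithin_le_nhds (s := Set.Iio s))) ?_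
    refine tendsto_const_nhds.congr' ?_
    filter_upwards [self_mem_nhdsWithin] with t ht using (hlt t ht).symm

lemma deriv_smoothPos_of_nonpos {s : ℝ} (hs : s ≤ 0) : deriv smoothPos s = 0 :=
  deriv_eq_zero_of_eq_zero_of_lt (smoothPos_contDiff.of_le (by simp))
    (fun _ h => smoothPos_of_nonpos h.le) hs

lemma deriv_smoothPos_of_one_lt {s : ℝ} (hs : 1 < s) : deriv smoothPos s = 1 := by
  have : smoothPos =ᶠ[𝓝 s] id := by
    filter_upwards [lt_mem_nhds hs] with t ht using smoothPos_of_one_le ht.le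
  rw [this.deriv_eq, deriv_id]

lemma hasDerivAt_smoothPos (s : ℝ) : HasDerivAt smoothPos (deriv smoothPos s) s :=
  (smoothPos_contDiff.differentiable (by simp) s).hasDerivAt

lemma exists_bound_deriv_smoothPos : ∃ M, ∀ s, |deriv smoothPos s| ≤ M :=
  exists_bound_of_eq_const (smoothPos_contDiff.continuous_deriv (by simp))
    (fun _ h => deriv_smoothPos_of_nonpos h.le) (fun _ h => deriv_smoothPos_of_one_lt h)

/-- A smooth truncation from above: it is `s` for `s ≤ 1` and `1` for `s ≥ 2`. -/
noncomputable def smoothTrunc (s : ℝ) : ℝ := s - smoothPos (s - 1)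

lemma smoothTrunc_contDiff : ContDiff ℝ ∞ smoothTrunc :=
  contDiff_id.sub (smoothPos_contDiff.comp (contDiff_id.sub contDiff_const))

lemma smoothTrunc_le (s : ℝ) : smoothTrunc s ≤ s := by
  simp only [smoothTrunc]; linarith [smoothPos_nonneg (s - 1)]

lemma smoothTrunc_le_two (s : ℝ) : smoothTrunc s ≤ 2 := by
  simp only [smoothTrunc]; linarith [le_smoothPos_add_one (s - 1)]

lemma smoothTrunc_of_le_one {s : ℝ} (hs : s ≤ 1) : smoothTrunc s = s := by
  simp [smoothTrunc, smoothPos_of_nonpos (sub_nonpos.2 hs)]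

lemma smoothTrunc_nonneg {s : ℝ} (hs : 0 ≤ s) : 0 ≤ smoothTrunc s := by
  simp only [smoothTrunc]
  have := smoothPos_le (s - 1)
  rcases le_total (s - 1) 0 with h | h
  · rw [max_eq_right h] at this; linarith
  · rw [max_eq_left h] at this; linarith

lemma hasDerivAt_smoothTrunc (s : ℝ) : HasDerivAt smoothTrunc (deriv smoothTrunc s) s :=
  (smoothTrunc_contDiff.differentiable (by simp) s).hasDerivAt

lemma deriv_smoothTrunc (s : ℝ) : deriv smoothTrunc s = 1 - deriv smoothPos (s - 1) := by
  have h := (hasDerivAt_id s).sub ((hasDerivAt_smoothPos (s - 1)).comp_sub_const s 1)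
  exact h.deriv

lemma deriv_smoothTrunc_of_le_one {s : ℝ} (hs : s ≤ 1) : deriv smoothTrunc s = 1 := by
  rw [deriv_smoothTrunc, deriv_smoothPos_of_nonpos (sub_nonpos.2 hs), sub_zero]

lemma exists_bound_deriv_smoothTrunc : ∃ M, ∀ s, |deriv smoothTrunc s| ≤ M := by
  obtain ⟨M, hM⟩ := exists_bound_deriv_smoothPos
  refine ⟨1 + M, fun s => ?_⟩
  rw [deriv_smoothTrunc]
  exact (abs_sub _ _).trans (by simpa using hM (s - 1))

/-- A smooth function that is `a + ε` for `a ≥ 0` and stays above `ε / 2`. -/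
noncomputable def posShift (ε a : ℝ) : ℝ := a + ε + ε * smoothPos (-(2 / ε) * a) / 2

lemma posShift_contDiff (ε : ℝ) : ContDiff ℝ ∞ (posShift ε) := by
  have := smoothPos_contDiff.comp (contDiff_const.mul contDiff_id : ContDiff ℝ ∞ fun a : ℝ =>
    -(2 / ε) * a)
  exact (contDiff_id.add contDiff_const).add ((contDiff_const.mul this).div_const 2)

lemma posShift_of_nonneg {ε a : ℝ} (hε : 0 < ε) (ha : 0 ≤ a) : posShift ε a = a + ε := by
  have : -(2 / ε) * a ≤ 0 := by
    have : 0 ≤ 2 / ε * a := by positivity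
    linarith
  rw [posShift, smoothPos_of_nonpos this]; ring

lemma le_posShift {ε : ℝ} (hε : 0 < ε) (a : ℝ) : a + ε ≤ posShift ε a := by
  have := smoothPos_nonneg (-(2 / ε) * a)
  simp only [posShift]
  have : 0 ≤ ε * smoothPos (-(2 / ε) * a) / 2 := by positivity
  linarith

lemma half_le_posShift {ε : ℝ} (hε : 0 < ε) (a : ℝ) : ε / 2 ≤ posShift ε a := by
  have h1 := le_smoothPos_add_one (-(2 / ε) * a)
  simp only [posShift]
  have : ε * (-(2 / ε) * a - 1) ≤ ε * smoothPos (-(2 / ε) * a) := mul_le_mul_of_nonneg_left h1 hε.le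
  have e : ε * (-(2 / ε) * a - 1) = -2 * a - ε := by field_simp
  linarith

lemma posShift_pos {ε : ℝ} (hε : 0 < ε) (a : ℝ) : 0 < posShift ε a :=
  (half_pos hε).trans_le (half_le_posShift hε a)

lemma hasDerivAt_posShift {ε : ℝ} (a : ℝ) :
    HasDerivAt (posShift ε) (deriv (posShift ε) a) a :=
  ((posShift_contDiff ε).differentiable (by simp) a).hasDerivAt

lemma deriv_posShift {ε : ℝ} (hε : 0 < ε) (a : ℝ) :
    deriv (posShift ε) a = 1 - deriv smoothPos (-(2 / ε) * a) := by
  have h1 : HasDerivAt (fun a : ℝ => -(2 / ε) * a) (-(2 / ε)) a := by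
    simpa using (hasDerivAt_id a).const_mul (-(2 / ε))
  have h2 := (((hasDerivAt_smoothPos (-(2 / ε) * a)).comp a h1).const_mul ε).div_const 2
  have h3 := ((hasDerivAt_id a).add_const ε).add h2
  refine h3.deriv.trans ?_
  field_simp
  ring

lemma deriv_posShift_of_nonneg {ε a : ℝ} (hε : 0 < ε) (ha : 0 ≤ a) :
    deriv (posShift ε) a = 1 := by
  have : -(2 / ε) * a ≤ 0 := by
    have : 0 ≤ 2 / ε * a := by positivity
    linarith
  rw [deriv_posShift hε, deriv_smoothPos_of_nonpos this, sub_zero]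

lemma exists_bound_deriv_posShift : ∃ M, ∀ ε > 0, ∀ a, |deriv (posShift ε) a| ≤ M := by
  obtain ⟨M, hM⟩ := exists_bound_deriv_smoothPos
  refine ⟨1 + M, fun ε hε a => ?_⟩
  rw [deriv_posShift hε]
  exact (abs_sub _ _).trans (by simpa using hM _)

/-- The nonlinearity `F(t)` that cuts off the region `t = v / u ≤ 1`. -/
noncomputable def stepF (t : ℝ) : ℝ := Real.smoothTransition (t - 1)

lemma stepF_contDiff : ContDiff ℝ ∞ stepF :=
  Real.smoothTransition.contDiff.comp (contDiff_id.sub contDiff_const)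

lemma stepF_nonneg (t : ℝ) : 0 ≤ stepF t := Real.smoothTransition.nonneg _

lemma stepF_le_one (t : ℝ) : stepF t ≤ 1 := Real.smoothTransition.le_one _

lemma stepF_of_le_one {t : ℝ} (ht : t ≤ 1) : stepF t = 0 :=
  Real.smoothTransition.zero_of_nonpos (sub_nonpos.2 ht)

lemma stepF_pos {t : ℝ} (ht : 1 < t) : 0 < stepF t :=
  Real.smoothTransition.pos_of_pos (sub_pos.2 ht)

lemma stepF_mono : Monotone stepF := fun _ _ h =>
  Real.smoothTransition.monotone (sub_le_sub_right h 1)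

lemma deriv_stepF_of_le_one {t : ℝ} (ht : t ≤ 1) : deriv stepF t = 0 :=
  deriv_eq_zero_of_eq_zero_of_lt (stepF_contDiff.of_le (by simp))
    (fun _ h => stepF_of_le_one h.le) ht

lemma deriv_stepF_of_two_lt {t : ℝ} (ht : 2 < t) : deriv stepF t = 0 := by
  have : stepF =ᶠ[𝓝 t] fun _ => 1 := by
    filter_upwards [lt_mem_nhds ht] with s hs
    exact Real.smoothTransition.one_of_one_le (by linarith)
  rw [this.deriv_eq, deriv_const]

lemma deriv_stepF_nonneg (t : ℝ) : 0 ≤ deriv stepF t := stepF_mono.deriv_nonneg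

lemma hasDerivAt_stepF (t : ℝ) : HasDerivAt stepF (deriv stepF t) t :=
  (stepF_contDiff.differentiable (by simp) t).hasDerivAt

lemma exists_bound_deriv_stepF : ∃ M, ∀ t, |deriv stepF t| ≤ M := by
  have hc : Continuous (deriv stepF) := stepF_contDiff.continuous_deriv (by simp)
  obtain ⟨M, hM⟩ := exists_bound_of_eq_const (f := fun s => deriv stepF (s + 1))
    (hc.comp (by fun_prop)) (a := 0) (b := 0)
    (fun s h => deriv_stepF_of_le_one (by linarith)) (fun s h => deriv_stepF_of_two_lt (by linarith))
  exact ⟨M, fun t => by simpa using hM (t - 1)⟩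

end SmoothFunctions

/-! ### The functions of two variables that generate the test functions -/

section TestFunctions

/-- `b + ε`, truncated smoothly from above at height of order `k`. -/
noncomputable def truncShift (ε k b : ℝ) : ℝ := k * smoothTrunc ((b + ε) / k)

lemma truncShift_contDiff (ε k : ℝ) : ContDiff ℝ ∞ (truncShift ε k) :=
  contDiff_const.mul (smoothTrunc_contDiff.comp ((contDiff_id.add contDiff_const).div_const k))

lemma truncShift_le {ε k : ℝ} (hk : 0 < k) (b : ℝ) : truncShift ε k b ≤ b + ε := by
  have := mul_le_mul_of_nonneg_left (smoothTrunc_le ((b + ε) / k)) hk.le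
  rwa [mul_div_cancel₀ _ hk.ne'] at this

lemma truncShift_le_two_mul {ε k : ℝ} (hk : 0 < k) (b : ℝ) : truncShift ε k b ≤ 2 * k := by
  have := mul_le_mul_of_nonneg_left (smoothTrunc_le_two ((b + ε) / k)) hk.le
  rwa [mul_comm k 2] at this

lemma truncShift_eq {ε k b : ℝ} (hk : 0 < k) (hb : b + ε ≤ k) : truncShift ε k b = b + ε := by
  rw [truncShift, smoothTrunc_of_le_one ((div_le_one hk).2 hb), mul_div_cancel₀ _ hk.ne']

lemma truncShift_nonneg {ε k b : ℝ} (hk : 0 < k) (hb : 0 ≤ b + ε) : 0 ≤ truncShift ε k b :=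
  mul_nonneg hk.le (smoothTrunc_nonneg (div_nonneg hb hk.le))

lemma deriv_truncShift {ε k : ℝ} (hk : 0 < k) (b : ℝ) :
    deriv (truncShift ε k) b = deriv smoothTrunc ((b + ε) / k) := by
  have h1 : HasDerivAt (fun b : ℝ => (b + ε) / k) (1 / k) b :=
    ((hasDerivAt_id b).add_const ε).div_const k
  have h2 := ((hasDerivAt_smoothTrunc ((b + ε) / k)).comp b h1).const_mul k
  refine h2.deriv.trans ?_
  field_simp

lemma hasDerivAt_truncShift {ε k : ℝ} (b : ℝ) :
    HasDerivAt (truncShift ε k) (deriv (truncShift ε k) b) b :=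
  ((truncShift_contDiff ε k).differentiable (by simp) b).hasDerivAt

lemma exists_bound_deriv_truncShift :
    ∃ M, 1 ≤ M ∧ ∀ ε k, 0 < k → ∀ b, |deriv (truncShift ε k) b| ≤ M := by
  obtain ⟨M, hM⟩ := exists_bound_deriv_smoothTrunc
  exact ⟨max M 1, le_max_right _ _, fun ε k hk b => by
    rw [deriv_truncShift hk]; exact (hM _).trans (le_max_left _ _)⟩

/-- The function `(a, b) ↦ q E(τ / q)`, positively homogeneous of degree one in the regularization
`q ≈ a + ε` of the first variable and the truncated regularization `τ ≈ min (b + ε) k` of the second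
one. -/
noncomputable def testFun (E : ℝ → ℝ) (ε k : ℝ) (s : ℝ × ℝ) : ℝ :=
  posShift ε s.1 * E (truncShift ε k s.2 / posShift ε s.1)

variable {E : ℝ → ℝ} {ε k : ℝ}

lemma testFun_contDiff (hE : ContDiff ℝ ∞ E) (hε : 0 < ε) :
    ContDiff ℝ ∞ (testFun E ε k) := by
  have h1 : ContDiff ℝ ∞ fun s : ℝ × ℝ => posShift ε s.1 := (posShift_contDiff ε).comp contDiff_fst
  have h2 : ContDiff ℝ ∞ fun s : ℝ × ℝ => truncShift ε k s.2 :=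
    (truncShift_contDiff ε k).comp contDiff_snd
  exact h1.mul (hE.comp (h2.div h1 fun s => (posShift_pos hε s.1).ne'))

lemma fderiv_apply_one_zero {Φ : ℝ × ℝ → ℝ} (hΦ : Differentiable ℝ Φ) {a b c : ℝ}
    (h : HasDerivAt (fun a => Φ (a, b)) c a) : fderiv ℝ Φ (a, b) (1, 0) = c := by
  have h1 : HasDerivAt (fun a : ℝ => (a, b)) ((1, 0) : ℝ × ℝ) a :=
    (hasDerivAt_id a).prodMk (hasDerivAt_const a b)
  exact ((hΦ (a, b)).hasFDerivAt.comp_hasDerivAt a h1).unique h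

lemma fderiv_apply_zero_one {Φ : ℝ × ℝ → ℝ} (hΦ : Differentiable ℝ Φ) {a b c : ℝ}
    (h : HasDerivAt (fun b => Φ (a, b)) c b) : fderiv ℝ Φ (a, b) (0, 1) = c := by
  have h1 : HasDerivAt (fun b : ℝ => (a, b)) ((0, 1) : ℝ × ℝ) b :=
    (hasDerivAt_const b a).prodMk (hasDerivAt_id b)
  exact ((hΦ (a, b)).hasFDerivAt.comp_hasDerivAt b h1).unique h

lemma norm_le_abs_add_abs (L : ℝ × ℝ →L[ℝ] ℝ) : ‖L‖ ≤ |L (1, 0)| + |L (0, 1)| := by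
  refine L.opNorm_le_bound (by positivity) fun s => ?_
  have hs : s = s.1 • ((1, 0) : ℝ × ℝ) + s.2 • ((0, 1) : ℝ × ℝ) := by ext <;> simp
  have h1 : |s.1| ≤ ‖s‖ := norm_fst_le s
  have h2 : |s.2| ≤ ‖s‖ := norm_snd_le s
  calc ‖L s‖ = |s.1 * L (1, 0) + s.2 * L (0, 1)| := by
        conv_lhs => rw [hs, map_add, map_smul, map_smul, smul_eq_mul, smul_eq_mul]
        rfl
    _ ≤ |s.1| * |L (1, 0)| + |s.2| * |L (0, 1)| := by
        rw [← abs_mul, ← abs_mul]; exact abs_add_le _ _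
    _ ≤ ‖s‖ * |L (1, 0)| + ‖s‖ * |L (0, 1)| := by gcongr
    _ = _ := by ring

lemma fderiv_testFun_fst (hE : ContDiff ℝ ∞ E) (hε : 0 < ε) (a b : ℝ) :
    fderiv ℝ (testFun E ε k) (a, b) (1, 0) = deriv (posShift ε) a *
      (E (truncShift ε k b / posShift ε a) - truncShift ε k b / posShift ε a *
        deriv E (truncShift ε k b / posShift ε a)) := by
  refine fderiv_apply_one_zero ((testFun_contDiff hE hε).differentiable (by simp)) ?_
  have hq := posShift_pos hε a
  have h1 := (hasDerivAt_const a (truncShift ε k b)).div (hasDerivAt_posShift (ε := ε) a) hq.ne'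
  have h2 := (hasDerivAt_posShift (ε := ε) a).mul
    (((hE.differentiable (by simp) (truncShift ε k b / posShift ε a)).hasDerivAt).comp a h1)
  refine h2.congr_deriv ?_
  simp only [Function.comp_apply, Pi.div_apply]
  field_simp
  ring

lemma fderiv_testFun_snd (hE : ContDiff ℝ ∞ E) (hε : 0 < ε) (a b : ℝ) :
    fderiv ℝ (testFun E ε k) (a, b) (0, 1) =
      deriv E (truncShift ε k b / posShift ε a) * deriv (truncShift ε k) b := by
  refine fderiv_apply_zero_one ((testFun_contDiff hE hε).differentiable (by simp)) ?_
  have hq := posShift_pos hε a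
  have h1 := (hasDerivAt_truncShift (ε := ε) (k := k) b).div_const (posShift ε a)
  have h2 := (((hE.differentiable (by simp)
    (truncShift ε k b / posShift ε a)).hasDerivAt).comp b h1).const_mul (posShift ε a)
  refine h2.congr_deriv ?_
  field_simp

lemma testFun_nonneg (hE0 : ∀ t, 0 ≤ E t) (hε : 0 < ε) (s : ℝ × ℝ) : 0 ≤ testFun E ε k s :=
  mul_nonneg (posShift_pos hε _).le (hE0 _)

lemma testFun_of_le (hE1 : ∀ t ≤ 1, E t = 0) (hε : 0 < ε) (hk : 0 < k) {a b : ℝ} (h : b ≤ a) :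
    testFun E ε k (a, b) = 0 := by
  have hq := posShift_pos hε a
  rw [testFun, hE1, mul_zero]
  rw [div_le_one hq]
  exact (truncShift_le hk b).trans ((add_le_add_left h ε).trans (le_posShift hε a))

/-- The test functions and their derivatives are bounded although `q` is not: where `q E(τ / q)`
does not vanish, `q` is at most `τ ≤ 2 k`. -/
lemma testFun_bounds (hE : ContDiff ℝ ∞ E) (hE1 : ∀ t ≤ 1, E t = 0) (hε : 0 < ε) (hk : 0 < k) :
    ∃ M, (∀ s, |testFun E ε k s| ≤ M) ∧ ∀ s, ‖fderiv ℝ (testFun E ε k) s‖ ≤ M := by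
  set K := 4 * k / ε with hK
  have hE' : ContDiff ℝ 1 E := hE.of_le (by simp)
  have hdE : ∀ t ≤ 1, deriv E t = 0 := fun t ht =>
    deriv_eq_zero_of_eq_zero_of_lt hE' (fun s hs => hE1 s hs.le) ht
  obtain ⟨M₁, hM₁⟩ := (isCompact_Icc (a := (1 : ℝ)) (b := K)).exists_bound_of_continuousOn
    hE.continuous.continuousOn
  obtain ⟨M₂, hM₂⟩ := (isCompact_Icc (a := (1 : ℝ)) (b := K)).exists_bound_of_continuousOn
    (hE'.continuous_deriv (by simp)).continuousOn
  obtain ⟨M₃, hM₃⟩ := exists_bound_deriv_posShift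
  obtain ⟨M₄, hM41, hM₄⟩ := exists_bound_deriv_truncShift
  have hM₃0 : 0 ≤ M₃ := (abs_nonneg _).trans (hM₃ ε hε 0)
  -- either `t ≤ 1`, where everything vanishes, or `t ∈ [1, 4k/ε]` and `q ≤ 2k`
  have key : ∀ a b : ℝ, truncShift ε k b / posShift ε a ≤ 1 ∨
      (truncShift ε k b / posShift ε a ∈ Set.Icc 1 K ∧ posShift ε a ≤ 2 * k) := by
    intro a b
    have hq := posShift_pos hε a
    rcases le_or_gt (truncShift ε k b / posShift ε a) 1 with h | h
    · exact Or.inl h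
    · right
      have h1 : posShift ε a ≤ truncShift ε k b := ((one_lt_div hq).1 h).le
      have h2 := truncShift_le_two_mul (ε := ε) hk b
      refine ⟨⟨h.le, ?_⟩, h1.trans h2⟩
      rw [hK, div_le_div_iff₀ hq hε]
      have := half_le_posShift hε a
      nlinarith
  have hk0 : 0 ≤ 2 * k := by positivity
  have hK0 : 0 ≤ K := by positivity
  have b0 : ∀ s, |testFun E ε k s| ≤ 2 * k * |M₁| := by
    rintro ⟨a, b⟩
    have hq := posShift_pos hε a
    simp only [testFun]
    rcases key a b with h | ⟨h, h'⟩
    · rw [hE1 _ h, mul_zero, abs_zero]; positivity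
    · rw [abs_mul, abs_of_pos hq]
      exact mul_le_mul h' ((hM₁ _ h).trans (le_abs_self _)) (abs_nonneg _) hk0
  have b1 : ∀ s, ‖fderiv ℝ (testFun E ε k) s‖ ≤ M₃ * (|M₁| + K * |M₂|) + |M₂| * M₄ := by
    rintro ⟨a, b⟩
    refine (norm_le_abs_add_abs _).trans ?_
    rw [fderiv_testFun_fst hE hε, fderiv_testFun_snd hE hε]
    rcases key a b with h | ⟨h, h'⟩
    · rw [hE1 _ h, hdE _ h]
      simp only [mul_zero, sub_zero, abs_zero, zero_mul, add_zero]
      positivity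
    · set t := truncShift ε k b / posShift ε a
      have ht0 : 0 ≤ t := by linarith [h.1]
      have e1 : |E t| ≤ |M₁| := (hM₁ t h).trans (le_abs_self _)
      have e2 : |deriv E t| ≤ |M₂| := (hM₂ t h).trans (le_abs_self _)
      rw [abs_mul, abs_mul]
      refine add_le_add (mul_le_mul (hM₃ ε hε a) ?_ (abs_nonneg _) hM₃0)
        (mul_le_mul e2 (hM₄ ε k hk b) (abs_nonneg _) (abs_nonneg _))
      refine (abs_sub _ _).trans (add_le_add e1 ?_)
      rw [abs_mul, abs_of_nonneg ht0]
      exact mul_le_mul h.2 e2 (abs_nonneg _) hK0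
  exact ⟨max _ _, fun s => (b0 s).trans (le_max_left _ _), fun s => (b1 s).trans (le_max_right _ _)⟩

/-- The profile of the test function for the subsolution: `E(t) = t F(t)`. -/
noncomputable def profileSub (t : ℝ) : ℝ := t * stepF t

/-- The profile of the test function for the supersolution: `E(t) = t ^ p F(t)`. -/
noncomputable def profileSuper (p t : ℝ) : ℝ := t ^ p * stepF t

lemma profileSub_contDiff : ContDiff ℝ ∞ profileSub := contDiff_id.mul stepF_contDiff

lemma profileSub_of_le_one {t : ℝ} (ht : t ≤ 1) : profileSub t = 0 := by
  rw [profileSub, stepF_of_le_one ht, mul_zero]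

lemma profileSub_nonneg (t : ℝ) : 0 ≤ profileSub t := by
  rcases le_total t 1 with h | h
  · rw [profileSub_of_le_one h]
  · exact mul_nonneg (by linarith) (stepF_nonneg t)

lemma deriv_profileSub (t : ℝ) : deriv profileSub t = stepF t + t * deriv stepF t := by
  refine ((hasDerivAt_id t).mul (hasDerivAt_stepF t)).deriv.trans ?_
  simp

lemma profileSuper_of_le_one (p : ℝ) {t : ℝ} (ht : t ≤ 1) : profileSuper p t = 0 := by
  rw [profileSuper, stepF_of_le_one ht, mul_zero]

lemma profileSuper_contDiff (p : ℝ) : ContDiff ℝ ∞ (profileSuper p) := by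
  rw [contDiff_iff_contDiffAt]
  intro t
  rcases lt_or_ge t 1 with h | h
  · have : profileSuper p =ᶠ[𝓝 t] fun _ => 0 := by
      filter_upwards [gt_mem_nhds h] with s hs using profileSuper_of_le_one p hs.le
    exact contDiffAt_const.congr_of_eventuallyEq this
  · exact (contDiffAt_id.rpow_const_of_ne (by simp; linarith)).mul stepF_contDiff.contDiffAt

lemma profileSuper_nonneg (p t : ℝ) : 0 ≤ profileSuper p t := by
  rcases le_total t 1 with h | h
  · rw [profileSuper_of_le_one p h]
  · exact mul_nonneg (Real.rpow_nonneg (by linarith) p) (stepF_nonneg t)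

lemma deriv_profileSuper (p : ℝ) {t : ℝ} (ht : 0 < t) :
    deriv (profileSuper p) t = p * t ^ (p - 1) * stepF t + t ^ p * deriv stepF t :=
  ((Real.hasDerivAt_rpow_const (Or.inl ht.ne')).mul (hasDerivAt_stepF t)).deriv

end TestFunctions

/-! ### Picone's inequality and its regularized version -/

section Picone

variable {V : Type*} [NormedAddCommGroup V] [InnerProductSpace ℝ V] {p : ℝ}

/-- The convexity gap `|a|^p - p |c|^{p-2} ⟨c, a⟩ + (p - 1) |c|^p` of Picone's inequality. -/
noncomputable def picone (p : ℝ) (a c : V) : ℝ :=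
  ‖a‖ ^ p - p * (‖c‖ ^ (p - 2) * inner ℝ c a) + (p - 1) * ‖c‖ ^ p

lemma rpow_sub_two_mul_sq (hp : 1 < p) {x : ℝ} (hx : 0 ≤ x) : x ^ (p - 2) * x ^ 2 = x ^ p := by
  rcases hx.eq_or_lt with rfl | hx
  · rw [Real.zero_rpow (show p ≠ 0 by linarith)]; simp
  · rw [← Real.rpow_natCast, ← Real.rpow_add hx]; congr 1; push_cast; ring

lemma rpow_sub_two_mul_self (hp : 1 < p) {x : ℝ} (hx : 0 ≤ x) :
    x ^ (p - 2) * x = x ^ (p - 1) := by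
  rcases hx.eq_or_lt with rfl | hx
  · rw [Real.zero_rpow (show p - 1 ≠ 0 by linarith)]; simp
  · nth_rewrite 2 [← Real.rpow_one x]
    rw [← Real.rpow_add hx]; congr 1; ring

lemma rpow_sub_one_mul_self (hp : 1 < p) {x : ℝ} (hx : 0 ≤ x) : x ^ (p - 1) * x = x ^ p := by
  rw [← rpow_sub_two_mul_self hp hx, mul_assoc, ← sq, rpow_sub_two_mul_sq hp hx]

lemma abs_rpow_mul_inner_le (hp : 1 < p) (a c : V) :
    |‖c‖ ^ (p - 2) * inner ℝ c a| ≤ ‖c‖ ^ (p - 1) * ‖a‖ := by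
  rw [abs_mul, abs_of_nonneg (Real.rpow_nonneg (norm_nonneg c) _),
    ← rpow_sub_two_mul_self hp (norm_nonneg c), mul_assoc]
  exact mul_le_mul_of_nonneg_left (abs_real_inner_le_norm c a)
    (Real.rpow_nonneg (norm_nonneg c) _)

lemma young_rpow (hp : 1 < p) {x y : ℝ} (hx : 0 ≤ x) (hy : 0 ≤ y) :
    p * (x ^ (p - 1) * y) ≤ (p - 1) * x ^ p + y ^ p := by
  have hpq := Real.HolderConjugate.conjExponent hp
  have h := Real.young_inequality_of_nonneg hy (Real.rpow_nonneg hx (p - 1)) hpq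
  have hq : (x ^ (p - 1)) ^ p.conjExponent = x ^ p := by
    rw [← Real.rpow_mul hx, Real.conjExponent, mul_div_cancel₀ _ (by linarith)]
  rw [hq, Real.conjExponent] at h
  have hp0 : 0 < p := by linarith
  have hp1 : p - 1 ≠ 0 := by linarith
  calc p * (x ^ (p - 1) * y) = p * (y * x ^ (p - 1)) := by ring
    _ ≤ p * (y ^ p / p + x ^ p / (p / (p - 1))) := mul_le_mul_of_nonneg_left h hp0.le
    _ = _ := by field_simp; ring

lemma eq_of_young_rpow_eq (hp : 1 < p) {x y : ℝ} (hx : 0 ≤ x) (hy : 0 ≤ y)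
    (h : p * (x ^ (p - 1) * y) = (p - 1) * x ^ p + y ^ p) : x = y := by
  have hpq := Real.HolderConjugate.conjExponent hp
  have hp0 : 0 < p := by linarith
  have hp1 : p - 1 ≠ 0 := by linarith
  have hq : (x ^ (p - 1)) ^ p.conjExponent = x ^ p := by
    rw [← Real.rpow_mul hx, Real.conjExponent, mul_div_cancel₀ _ (by linarith)]
  have h2 := (Real.young_inequality_eq_iff_of_nonneg hy (Real.rpow_nonneg hx (p - 1)) hpq).1 (by
    rw [hq, Real.conjExponent]
    field_simp
    linarith)
  rw [hq] at h2
  exact ((Real.rpow_left_inj hy hx hp0.ne').1 h2).symm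

lemma rpow_sub_one_mul_le (hp : 1 < p) {x y : ℝ} (hx : 0 ≤ x) (hy : 0 ≤ y) :
    x ^ (p - 1) * y ≤ x ^ p + y ^ p := by
  have hx' := Real.rpow_nonneg hx p
  have hy' := Real.rpow_nonneg hy p
  rcases le_total x y with h | h
  · have : x ^ (p - 1) * y ≤ y ^ (p - 1) * y :=
      mul_le_mul_of_nonneg_right (Real.rpow_le_rpow hx h (by linarith)) hy
    rw [rpow_sub_one_mul_self hp hy] at this
    linarith
  · have : x ^ (p - 1) * y ≤ x ^ (p - 1) * x :=
      mul_le_mul_of_nonneg_left h (Real.rpow_nonneg hx _)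
    rw [rpow_sub_one_mul_self hp hx] at this
    linarith

lemma picone_nonneg (hp : 1 < p) (a c : V) : 0 ≤ picone p a c := by
  have h1 := (le_abs_self _).trans (abs_rpow_mul_inner_le hp a c)
  have h2 := young_rpow hp (norm_nonneg c) (norm_nonneg a)
  have h3 := mul_le_mul_of_nonneg_left h1 (by linarith : 0 ≤ p)
  rw [picone]; linarith

/-- The equality case of Picone's inequality. -/
lemma eq_of_picone_eq_zero (hp : 1 < p) {a c : V} (h : picone p a c = 0) : a = c := by
  have h1 := (le_abs_self _).trans (abs_rpow_mul_inner_le hp a c)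
  have h2 := young_rpow hp (norm_nonneg c) (norm_nonneg a)
  have hp0 : 0 < p := by linarith
  have h3 := mul_le_mul_of_nonneg_left h1 hp0.le
  rw [picone] at h
  have hn := eq_of_young_rpow_eq hp (norm_nonneg c) (norm_nonneg a) (by linarith)
  rcases (norm_nonneg c).eq_or_lt with hc | hc
  · rw [norm_eq_zero.1 hc.symm, ← norm_eq_zero, ← hn, ← hc]
  · have h4 : ‖c‖ ^ (p - 2) * inner ℝ c a = ‖c‖ ^ (p - 1) * ‖a‖ := by
      apply le_antisymm h1
      have : p * (‖c‖ ^ (p - 1) * ‖a‖) ≤ p * (‖c‖ ^ (p - 2) * inner ℝ c a) := by linarith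
      exact le_of_mul_le_mul_left this hp0
    rw [← rpow_sub_two_mul_self hp hc.le, mul_assoc] at h4
    have h5 := mul_left_cancel₀ (Real.rpow_pos_of_pos hc (p - 2)).ne' h4
    have h6 := inner_eq_norm_mul_iff_real.1 h5
    rw [← hn] at h6
    exact (smul_right_injective V hc.ne' h6).symm

/-- Monotonicity of the vector field `a ↦ |a|^{p-2} a`. -/
lemma monotone_rpow_smul (hp : 1 < p) (a c : V) :
    0 ≤ ‖a‖ ^ p - ‖a‖ ^ (p - 2) * inner ℝ a c - ‖c‖ ^ (p - 2) * inner ℝ c a + ‖c‖ ^ p := by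
  have h1 := picone_nonneg hp a c
  have h2 := picone_nonneg hp c a
  rw [picone] at h1 h2
  have hp0 : 0 < p := by linarith
  have : 0 ≤ p * (‖a‖ ^ p - ‖a‖ ^ (p - 2) * inner ℝ a c - ‖c‖ ^ (p - 2) * inner ℝ c a + ‖c‖ ^ p) := by
    linarith
  exact nonneg_of_mul_nonneg_right this hp0

/-- The principal parts of the subsolution inequality, tested with `q E₁(t)`, and of the
supersolution inequality, tested with `q E₂(t)`, where `t = τ / q`: here `a`, `b`, `d a` stand for
the gradients of `v`, of `q` and of `τ`. -/
noncomputable def testedDiff (p t d : ℝ) (a b : V) : ℝ :=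
  ‖a‖ ^ (p - 2) * inner ℝ a ((profileSub t - t * deriv profileSub t) • b +
      (deriv profileSub t * d) • a) -
    ‖b‖ ^ (p - 2) * inner ℝ b ((profileSuper p t - t * deriv (profileSuper p) t) • b +
      (deriv (profileSuper p) t * d) • a)

lemma testedDiff_of_le_one {t : ℝ} (ht : t ≤ 1) (d : ℝ) (a b : V) : testedDiff p t d a b = 0 := by
  have h1 : deriv profileSub t = 0 := deriv_eq_zero_of_eq_zero_of_lt
    (profileSub_contDiff.of_le (by simp)) (fun s hs => profileSub_of_le_one hs.le) ht
  have h2 : deriv (profileSuper p) t = 0 := deriv_eq_zero_of_eq_zero_of_lt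
    ((profileSuper_contDiff p).of_le (by simp)) (fun s hs => profileSuper_of_le_one p hs.le) ht
  rw [testedDiff, h1, h2, profileSub_of_le_one ht, profileSuper_of_le_one p ht]
  simp

/-- With `c = t b`, the terms with `F(t)` form `picone p a c` and the terms with `F'(t)` form the
monotonicity expression of `monotone_rpow_smul`, up to the factor `d`, which is `1` where the
truncation is inactive. -/
lemma testedDiff_eq (hp : 1 < p) {t : ℝ} (ht : 0 < t) (d : ℝ) (a b : V) :
    testedDiff p t d a b =
      stepF t * (d * ‖a‖ ^ p - d * p * (‖t • b‖ ^ (p - 2) * inner ℝ (t • b) a) +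
        (p - 1) * ‖t • b‖ ^ p) +
      t * deriv stepF t * (d * ‖a‖ ^ p - ‖a‖ ^ (p - 2) * inner ℝ a (t • b) -
        d * (‖t • b‖ ^ (p - 2) * inner ℝ (t • b) a) + ‖t • b‖ ^ p) := by
  have ha := rpow_sub_two_mul_sq hp (norm_nonneg a)
  have hb := rpow_sub_two_mul_sq hp (norm_nonneg b)
  have htp := rpow_sub_two_mul_sq hp ht.le
  have htp1 := rpow_sub_two_mul_self hp ht.le
  have hn : ‖t • b‖ = t * ‖b‖ := by rw [norm_smul, Real.norm_of_nonneg ht.le]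
  rw [testedDiff, deriv_profileSub, deriv_profileSuper p ht, profileSub, profileSuper, hn,
    Real.mul_rpow ht.le (norm_nonneg b), Real.mul_rpow ht.le (norm_nonneg b), ← ha, ← hb, ← htp,
    ← htp1]
  simp only [inner_add_right, real_inner_smul_right, real_inner_smul_left,
    real_inner_self_eq_norm_sq, real_inner_comm a b]
  ring

/-- Picone's inequality in the region where `v` is not truncated. -/
lemma picone_le_testedDiff (hp : 1 < p) (t : ℝ) (a b : V) :
    stepF t * picone p a (t • b) ≤ testedDiff p t 1 a b := by
  rcases le_or_gt t 1 with ht | ht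
  · rw [testedDiff_of_le_one ht, stepF_of_le_one ht, zero_mul]
  have ht0 : 0 < t := by linarith
  rw [testedDiff_eq hp ht0]
  have h1 := mul_nonneg (mul_nonneg ht0.le (deriv_stepF_nonneg t)) (monotone_rpow_smul hp a (t • b))
  rw [picone]
  linarith

/-- A lower bound in the region where `v` is truncated; it does not depend on `t`, although the test
function for the supersolution grows with `t`. -/
lemma exists_neg_le_testedDiff (hp : 1 < p) {D : ℝ} (hD : 0 ≤ D) :
    ∃ C, 0 ≤ C ∧ ∀ (t d : ℝ) (a b : V), |d| ≤ D →
      -(C * (‖a‖ ^ p + ‖b‖ ^ p)) ≤ testedDiff p t d a b := by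
  obtain ⟨M, hM⟩ := exists_bound_deriv_stepF
  have hM0 : 0 ≤ M := (abs_nonneg _).trans (hM 0)
  refine ⟨D + D ^ p + 2 * M * ((2 * D + 1) * 2 ^ p), by positivity, fun t d a b hd => ?_⟩
  have hap : 0 ≤ ‖a‖ ^ p := by positivity
  have hbp : 0 ≤ ‖b‖ ^ p := by positivity
  rcases le_or_gt t 1 with ht | ht
  · rw [testedDiff_of_le_one ht]
    have : 0 ≤ (D + D ^ p + 2 * M * ((2 * D + 1) * 2 ^ p)) * (‖a‖ ^ p + ‖b‖ ^ p) := by positivity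
    linarith
  have ht0 : 0 < t := by linarith
  rw [testedDiff_eq hp ht0]
  set c := t • b with hc
  have hcp : 0 ≤ ‖c‖ ^ p := by positivity
  have hx := abs_rpow_mul_inner_le hp a c
  have hy := abs_rpow_mul_inner_le hp c a
  set X := ‖c‖ ^ (p - 2) * inner ℝ c a
  set Y := ‖a‖ ^ (p - 2) * inner ℝ a c
  have hdX : |d * X| ≤ D * (‖c‖ ^ (p - 1) * ‖a‖) := by
    rw [abs_mul]; exact mul_le_mul hd hx (abs_nonneg _) hD
  have hda : -(D * ‖a‖ ^ p) ≤ d * ‖a‖ ^ p := by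
    have : |d * ‖a‖ ^ p| ≤ D * ‖a‖ ^ p := by
      rw [abs_mul, abs_of_nonneg hap]; exact mul_le_mul_of_nonneg_right hd hap
    linarith [neg_abs_le (d * ‖a‖ ^ p)]
  -- the part with `F`: the superlinear growth in `t` is absorbed by Young's inequality
  have h1 : -((D + D ^ p) * (‖a‖ ^ p + ‖b‖ ^ p)) ≤
      stepF t * (d * ‖a‖ ^ p - d * p * X + (p - 1) * ‖c‖ ^ p) := by
    have hy' := young_rpow hp (norm_nonneg c) (mul_nonneg hD (norm_nonneg a))
    rw [Real.mul_rpow hD (norm_nonneg a)] at hy'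
    have e : d * p * X ≤ p * (‖c‖ ^ (p - 1) * (D * ‖a‖)) := by
      calc d * p * X = p * (d * X) := by ring
        _ ≤ p * (D * (‖c‖ ^ (p - 1) * ‖a‖)) :=
            mul_le_mul_of_nonneg_left ((le_abs_self _).trans hdX) (by linarith)
        _ = _ := by ring
    have low : -((D + D ^ p) * ‖a‖ ^ p) ≤ d * ‖a‖ ^ p - d * p * X + (p - 1) * ‖c‖ ^ p := by
      linarith
    have hDp : 0 ≤ D + D ^ p := by positivity
    have hF0 := stepF_nonneg t
    have hF1 := stepF_le_one t
    have h2 := mul_le_mul_of_nonneg_left low hF0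
    have h3 : stepF t * ((D + D ^ p) * ‖a‖ ^ p) ≤ 1 * ((D + D ^ p) * ‖a‖ ^ p) :=
      mul_le_mul_of_nonneg_right hF1 (by positivity)
    have h4 : 0 ≤ (D + D ^ p) * ‖b‖ ^ p := by positivity
    linarith
  -- the part with `F'`, which is supported in `t ≤ 2`
  have h2 : -(2 * M * ((2 * D + 1) * 2 ^ p) * (‖a‖ ^ p + ‖b‖ ^ p)) ≤
      t * deriv stepF t * (d * ‖a‖ ^ p - Y - d * X + ‖c‖ ^ p) := by
    rcases le_or_gt t 2 with ht2 | ht2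
    · have hcb : ‖c‖ ^ p ≤ 2 ^ p * ‖b‖ ^ p := by
        rw [← Real.mul_rpow (by norm_num) (norm_nonneg b), hc, norm_smul,
          Real.norm_of_nonneg ht0.le]
        exact Real.rpow_le_rpow (by positivity)
          (mul_le_mul_of_nonneg_right ht2 (norm_nonneg b)) (by linarith)
      have h2p : (1 : ℝ) ≤ 2 ^ p := Real.one_le_rpow (by norm_num) (by linarith)
      have e1 := rpow_sub_one_mul_le hp (norm_nonneg a) (norm_nonneg c)
      have e2 := rpow_sub_one_mul_le hp (norm_nonneg c) (norm_nonneg a)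
      have e3 : Y ≤ ‖a‖ ^ p + ‖c‖ ^ p := ((le_abs_self _).trans hy).trans e1
      have e4 : d * X ≤ D * (‖c‖ ^ p + ‖a‖ ^ p) :=
        ((le_abs_self _).trans hdX).trans (mul_le_mul_of_nonneg_left e2 hD)
      have low : -((2 * D + 1) * (‖a‖ ^ p + ‖c‖ ^ p)) ≤ d * ‖a‖ ^ p - Y - d * X + ‖c‖ ^ p := by
        have : 0 ≤ D * ‖c‖ ^ p := by positivity
        nlinarith
      have low2 : (2 * D + 1) * (‖a‖ ^ p + ‖c‖ ^ p) ≤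
          (2 * D + 1) * 2 ^ p * (‖a‖ ^ p + ‖b‖ ^ p) := by
        rw [mul_assoc]
        refine mul_le_mul_of_nonneg_left ?_ (by positivity)
        have : ‖a‖ ^ p ≤ 2 ^ p * ‖a‖ ^ p := le_mul_of_one_le_left hap h2p
        linarith
      have hk0 : 0 ≤ t * deriv stepF t := mul_nonneg ht0.le (deriv_stepF_nonneg t)
      have hk1 : t * deriv stepF t ≤ 2 * M :=
        mul_le_mul ht2 ((le_abs_self _).trans (hM t)) (deriv_stepF_nonneg t) (by norm_num)
      have low3 : -((2 * D + 1) * 2 ^ p * (‖a‖ ^ p + ‖b‖ ^ p)) ≤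
          d * ‖a‖ ^ p - Y - d * X + ‖c‖ ^ p := by linarith
      have h5 := mul_le_mul_of_nonneg_left low3 hk0
      have h6 := mul_le_mul_of_nonneg_right hk1
        (show 0 ≤ (2 * D + 1) * 2 ^ p * (‖a‖ ^ p + ‖b‖ ^ p) by positivity)
      linarith
    · rw [deriv_stepF_of_two_lt ht2, mul_zero, zero_mul]
      have : 0 ≤ 2 * M * ((2 * D + 1) * 2 ^ p) * (‖a‖ ^ p + ‖b‖ ^ p) := by positivity
      linarith
  linarith

end Picone

/-! ### Cutoff functions adapted to the homogeneous norm -/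

section Cutoff

/-- A smooth function on an inner product space that is `1` for `κ ‖x‖ ≤ 1` and `0` for
`κ ‖x‖ ≥ √2`. -/
noncomputable def radialBump {V : Type*} [NormedAddCommGroup V] (κ : ℝ) (x : V) : ℝ :=
  Real.smoothTransition (2 - κ ^ 2 * ‖x‖ ^ 2)

section Radial

variable {V : Type*} [NormedAddCommGroup V] {κ : ℝ}

lemma radialBump_contDiff [InnerProductSpace ℝ V] : ContDiff ℝ ∞ (radialBump κ : V → ℝ) :=
  Real.smoothTransition.contDiff.comp (contDiff_const.sub (contDiff_const.mul (contDiff_norm_sq ℝ)))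

lemma radialBump_nonneg (x : V) : 0 ≤ radialBump κ x := Real.smoothTransition.nonneg _

lemma radialBump_le_one (x : V) : radialBump κ x ≤ 1 := Real.smoothTransition.le_one _

lemma radialBump_eq_one {x : V} (h : (κ * ‖x‖) ^ 2 ≤ 1) : radialBump κ x = 1 :=
  Real.smoothTransition.one_of_one_le (by rw [mul_pow] at h; linarith)

lemma radialBump_eq_zero {x : V} (h : 2 ≤ (κ * ‖x‖) ^ 2) : radialBump κ x = 0 :=
  Real.smoothTransition.zero_of_nonpos (by rw [mul_pow] at h; linarith)

lemma exists_bound_fderiv_radialBump : ∃ M, 0 ≤ M ∧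
    ∀ {V : Type} [NormedAddCommGroup V] [InnerProductSpace ℝ V] {κ : ℝ}, 0 ≤ κ → ∀ x e : V,
      |fderiv ℝ (radialBump κ) x e| ≤ M * κ * ‖e‖ := by
  have hσ : ContDiff ℝ 1 Real.smoothTransition := Real.smoothTransition.contDiff (n := 1)
  have h0 : ∀ s ≤ 0, deriv Real.smoothTransition s = 0 := fun s hs =>
    deriv_eq_zero_of_eq_zero_of_lt hσ (fun s hs => Real.smoothTransition.zero_of_nonpos hs.le) hs
  obtain ⟨M, hM⟩ := exists_bound_of_eq_const (hσ.continuous_deriv (by simp)) (a := 0) (b := 0)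
    (fun s hs => h0 s hs.le) (fun s hs => by
      have : Real.smoothTransition =ᶠ[𝓝 s] fun _ => 1 := by
        filter_upwards [lt_mem_nhds hs] with t ht using Real.smoothTransition.one_of_one_le ht.le
      rw [this.deriv_eq, deriv_const])
  have hM0 : 0 ≤ M := (abs_nonneg _).trans (hM 0)
  refine ⟨4 * M, by positivity, fun {V} _ _ {κ} hκ x e => ?_⟩
  have hd1 : HasFDerivAt (fun x : V => 2 - κ ^ 2 * ‖x‖ ^ 2)
      (-(κ ^ 2 • (2 • innerSL ℝ x))) x :=
    ((hasStrictFDerivAt_norm_sq x).hasFDerivAt.const_mul (κ ^ 2)).const_sub 2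
  have hd2 := ((hσ.differentiable (by simp)
    (2 - κ ^ 2 * ‖x‖ ^ 2)).hasDerivAt).comp_hasFDerivAt x hd1
  have hd3 : fderiv ℝ (radialBump κ) x e =
      deriv Real.smoothTransition (2 - κ ^ 2 * ‖x‖ ^ 2) * -(κ ^ 2 * (2 * inner ℝ x e)) := by
    have : HasFDerivAt (radialBump κ) _ x := hd2
    rw [this.fderiv]
    simp
  rw [hd3, abs_mul, abs_neg, abs_mul, abs_mul, abs_of_nonneg (sq_nonneg κ), abs_two]
  rcases le_or_gt (2 - κ ^ 2 * ‖x‖ ^ 2) 0 with h | h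
  · rw [h0 _ h, abs_zero, zero_mul]; positivity
  · have h1 : κ * ‖x‖ ≤ 2 := by
      refine abs_le_of_sq_le_sq' ?_ (by norm_num) |>.2
      rw [mul_pow]; linarith
    calc |deriv Real.smoothTransition (2 - κ ^ 2 * ‖x‖ ^ 2)| * (κ ^ 2 * (2 * |inner ℝ x e|))
        ≤ M * (κ ^ 2 * (2 * (‖x‖ * ‖e‖))) := by
          gcongr
          · exact hM _
          · exact abs_real_inner_le_norm x e
      _ = 2 * M * κ * ‖e‖ * (κ * ‖x‖) := by ring
      _ ≤ 2 * M * κ * ‖e‖ * 2 := mul_le_mul_of_nonneg_left h1 (by positivity)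
      _ = _ := by ring

end Radial

variable {m n : ℕ} {γ : ℝ}

lemma homNorm_lt_iff (hγ : 0 < γ) {R : ℝ} (hR : 0 < R) (z : Space m n) :
    homNorm γ z < R ↔
      (R⁻¹ * ‖z.1‖) ^ (2 * (γ + 1)) + ((γ + 1) / R ^ (γ + 1) * ‖z.2‖) ^ 2 < 1 := by
  have hγ2 : 0 < 2 * (γ + 1) := by linarith
  have hS : 0 < R ^ (γ + 1) := Real.rpow_pos_of_pos hR _
  have hR2 : R ^ (2 * (γ + 1)) = (R ^ (γ + 1)) ^ 2 := by
    rw [← Real.rpow_natCast, ← Real.rpow_mul hR.le]; congr 1; push_cast; ring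
  have hnn : 0 ≤ ‖z.1‖ ^ (2 * (γ + 1)) + (γ + 1) ^ 2 * ‖z.2‖ ^ 2 := by positivity
  rw [homNorm, one_div, Real.rpow_inv_lt_iff_of_pos hnn hR.le hγ2,
    Real.mul_rpow (by positivity) (norm_nonneg _), Real.inv_rpow hR.le, hR2, mul_pow, div_pow]
  rw [show ((R ^ (γ + 1)) ^ 2)⁻¹ * ‖z.1‖ ^ (2 * (γ + 1)) +
    (γ + 1) ^ 2 / (R ^ (γ + 1)) ^ 2 * ‖z.2‖ ^ 2 =
    (‖z.1‖ ^ (2 * (γ + 1)) + (γ + 1) ^ 2 * ‖z.2‖ ^ 2) / (R ^ (γ + 1)) ^ 2 by field_simp,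
    div_lt_one (by positivity)]

/-- A smooth cutoff between `B_R` and `B_{2R}` that is adapted to the anisotropic dilations. It is
built from `|x|²` and `|y|²`, because the homogeneous norm need not be smooth. -/
noncomputable def cutoff (γ R : ℝ) (z : Space m n) : ℝ :=
  radialBump R⁻¹ z.1 * radialBump ((γ + 1) / R ^ (γ + 1)) z.2

lemma cutoff_contDiff (R : ℝ) : ContDiff ℝ ∞ (cutoff γ R : Space m n → ℝ) :=
  (radialBump_contDiff.comp contDiff_fst).mul (radialBump_contDiff.comp contDiff_snd)

lemma cutoff_nonneg (R : ℝ) (z : Space m n) : 0 ≤ cutoff γ R z :=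
  mul_nonneg (radialBump_nonneg _) (radialBump_nonneg _)

lemma cutoff_eq_one (hγ : 0 < γ) {R : ℝ} (hR : 0 < R) {z : Space m n} (hz : z ∈ homBall m n γ R) :
    cutoff γ R z = 1 := by
  have h := (homNorm_lt_iff hγ hR z).1 hz
  have h0 : 0 ≤ R⁻¹ * ‖z.1‖ := by positivity
  have h1 := Real.rpow_nonneg h0 (2 * (γ + 1))
  have h2 := sq_nonneg ((γ + 1) / R ^ (γ + 1) * ‖z.2‖)
  have hx : R⁻¹ * ‖z.1‖ ≤ 1 := by
    by_contra hc
    have := Real.one_le_rpow (not_le.1 hc).le (by linarith : 0 ≤ 2 * (γ + 1))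
    linarith
  rw [cutoff, radialBump_eq_one (pow_le_one₀ h0 hx), radialBump_eq_one (by linarith), mul_one]

lemma mem_homBall_of_cutoff_ne_zero (hγ : 0 < γ) {R : ℝ} (hR : 0 < R) {z : Space m n}
    (hz : cutoff γ R z ≠ 0) : (R⁻¹ * ‖z.1‖) ^ 2 < 2 ∧ z ∈ homBall m n γ (2 * R) := by
  have hx : (R⁻¹ * ‖z.1‖) ^ 2 < 2 := by
    by_contra hc
    exact left_ne_zero_of_mul hz (radialBump_eq_zero (not_lt.1 hc))
  have hy : ((γ + 1) / R ^ (γ + 1) * ‖z.2‖) ^ 2 < 2 := by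
    by_contra hc
    exact right_ne_zero_of_mul hz (radialBump_eq_zero (not_lt.1 hc))
  refine ⟨hx, ?_⟩
  have h0 : 0 ≤ R⁻¹ * ‖z.1‖ := by positivity
  have hs1 : (2 : ℝ) ≤ 2 ^ (γ + 1) := by
    have := Real.rpow_le_rpow_of_exponent_le (by norm_num : (1 : ℝ) ≤ 2)
      (by linarith : (1 : ℝ) ≤ γ + 1)
    rwa [Real.rpow_one] at this
  have hs2 : (2 : ℝ) ^ (2 * (γ + 1)) = (2 ^ (γ + 1)) ^ 2 := by
    rw [← Real.rpow_natCast, ← Real.rpow_mul (by norm_num)]; congr 1; push_cast; ring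
  have hX : (R⁻¹ * ‖z.1‖) ^ (2 * (γ + 1)) ≤ 2 ^ (γ + 1) := by
    rw [Real.rpow_mul h0]
    refine Real.rpow_le_rpow (by positivity) ?_ (by linarith)
    exact_mod_cast hx.le
  refine (homNorm_lt_iff hγ (by positivity) z).2 ?_
  have e1 : ((2 * R)⁻¹ * ‖z.1‖) ^ (2 * (γ + 1)) =
      (R⁻¹ * ‖z.1‖) ^ (2 * (γ + 1)) / (2 ^ (γ + 1)) ^ 2 := by
    rw [mul_inv, mul_assoc, Real.mul_rpow (by norm_num) h0, Real.inv_rpow (by norm_num), hs2]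
    field_simp
  have e2 : ((γ + 1) / (2 * R) ^ (γ + 1) * ‖z.2‖) ^ 2 =
      ((γ + 1) / R ^ (γ + 1) * ‖z.2‖) ^ 2 / (2 ^ (γ + 1)) ^ 2 := by
    rw [Real.mul_rpow (by norm_num) hR.le]
    field_simp
  rw [e1, e2, ← add_div, div_lt_one (by positivity)]
  set s : ℝ := 2 ^ (γ + 1)
  nlinarith

lemma homBall_mono {R R' : ℝ} (h : R ≤ R') : homBall m n γ R ⊆ homBall m n γ R' :=
  fun _ hz => lt_of_lt_of_le hz h

lemma homBall_subset (hγ : 0 < γ) {R : ℝ} (hR : 0 < R) :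
    homBall m n γ R ⊆ Metric.closedBall (0 : EuclideanSpace ℝ (Fin m)) R ×ˢ
      Metric.closedBall (0 : EuclideanSpace ℝ (Fin n)) (R ^ (γ + 1)) := by
  intro z hz
  have h := (homNorm_lt_iff hγ hR z).1 hz
  have h0 : 0 ≤ R⁻¹ * ‖z.1‖ := by positivity
  have h1 := Real.rpow_nonneg h0 (2 * (γ + 1))
  have h2 := sq_nonneg ((γ + 1) / R ^ (γ + 1) * ‖z.2‖)
  have hS : 0 < R ^ (γ + 1) := Real.rpow_pos_of_pos hR _
  have hx : R⁻¹ * ‖z.1‖ ≤ 1 := by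
    by_contra hc
    have := Real.one_le_rpow (not_le.1 hc).le (by linarith : 0 ≤ 2 * (γ + 1))
    linarith
  have hy : (γ + 1) / R ^ (γ + 1) * ‖z.2‖ ≤ 1 := by
    refine (abs_le_of_sq_le_sq' (b := 1) ?_ (by norm_num)).2
    linarith
  simp only [Set.mem_prod, mem_closedBall_zero_iff]
  refine ⟨?_, ?_⟩
  · rwa [inv_mul_le_iff₀ hR, mul_one] at hx
  · rw [div_mul_eq_mul_div, div_le_one hS] at hy
    nlinarith [norm_nonneg z.2]

/-- The ball `B_R` lies in a product of Euclidean balls of radii proportional to `R` and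
`R^(γ+1)`. -/
lemma exists_volume_homBall_le (hγ : 0 < γ) : ∃ c : ℝ≥0∞, c ≠ ⊤ ∧ ∀ R : ℝ, 0 < R →
    volume (homBall m n γ R) ≤ c * ENNReal.ofReal (R ^ homDim m n γ) := by
  refine ⟨volume (Metric.ball (0 : EuclideanSpace ℝ (Fin m)) 1) *
    volume (Metric.ball (0 : EuclideanSpace ℝ (Fin n)) 1),
    ENNReal.mul_ne_top measure_ball_lt_top.ne measure_ball_lt_top.ne, fun R hR => ?_⟩
  have hS : 0 < R ^ (γ + 1) := Real.rpow_pos_of_pos hR _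
  refine (measure_mono (homBall_subset hγ hR)).trans (le_of_eq ?_)
  have := Measure.prod_prod (μ := (volume : Measure (EuclideanSpace ℝ (Fin m))))
    (ν := (volume : Measure (EuclideanSpace ℝ (Fin n)))) (Metric.closedBall 0 R)
    (Metric.closedBall 0 (R ^ (γ + 1)))
  refine this.trans ?_
  rw [Measure.addHaar_closedBall _ _ hR.le, Measure.addHaar_closedBall _ _ hS.le,
    finrank_euclideanSpace_fin, finrank_euclideanSpace_fin]
  have e : R ^ homDim m n γ = R ^ m * (R ^ (γ + 1)) ^ n := by
    rw [homDim, Real.rpow_add hR, Real.rpow_natCast, ← Real.rpow_natCast (R ^ (γ + 1)) n,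
      ← Real.rpow_mul hR.le, add_comm 1 γ]
  rw [e, ENNReal.ofReal_mul (by positivity)]
  ring

lemma continuous_homNorm (hγ : 0 < γ) : Continuous (homNorm γ : Space m n → ℝ) := by
  refine Continuous.rpow_const ?_ fun z => Or.inr (by positivity)
  refine ((continuous_norm.comp continuous_fst).rpow_const fun z => Or.inr (by positivity)).add ?_
  exact continuous_const.mul ((continuous_norm.comp continuous_snd).pow 2)

lemma isOpen_homBall (hγ : 0 < γ) (R : ℝ) : IsOpen (homBall m n γ R) :=
  isOpen_lt (continuous_homNorm hγ) continuous_const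

lemma exists_subset_homBall (hγ : 0 < γ) {K : Set (Space m n)} (hK : IsCompact K) :
    ∃ R : ℝ, 1 ≤ R ∧ K ⊆ homBall m n γ R := by
  obtain ⟨B, hB⟩ := hK.exists_bound_of_continuousOn (continuous_homNorm hγ).continuousOn
  refine ⟨max 1 (B + 1), le_max_left _ _, fun z hz => ?_⟩
  have h1 := (le_abs_self _).trans (hB z hz)
  exact (h1.trans_lt (lt_add_one B)).trans_le (le_max_right _ _)

lemma isTest_cutoff (hγ : 0 < γ) {R : ℝ} (hR : 0 < R) :
    IsTest Set.univ (cutoff γ R : Space m n → ℝ) := by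
  refine ⟨cutoff_contDiff R, ?_, Set.subset_univ _⟩
  refine HasCompactSupport.intro ((isCompact_closedBall (0 : EuclideanSpace ℝ (Fin m)) (2 * R)).prod
    (isCompact_closedBall (0 : EuclideanSpace ℝ (Fin n)) ((2 * R) ^ (γ + 1)))) fun z hz => ?_
  by_contra hne
  exact hz (homBall_subset hγ (by positivity) (mem_homBall_of_cutoff_ne_zero hγ hR hne).2)

lemma grad_cutoff_eq_zero (hγ : 0 < γ) {R : ℝ} (hR : 0 < R) {z : Space m n}
    (hz : z ∉ homBall m n γ (2 * R) \ homBall m n γ R) : grad γ (cutoff γ R) z = 0 := by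
  have hc := cutoff_contDiff (m := m) (n := n) (γ := γ) R
  have key : fderiv ℝ (cutoff γ R) z = 0 := by
    by_cases h : z ∈ homBall m n γ R
    · have : (cutoff γ R : Space m n → ℝ) =ᶠ[𝓝 z] fun _ => 1 := by
        filter_upwards [(isOpen_homBall hγ R).mem_nhds h] with w hw using cutoff_eq_one hγ hR hw
      rw [this.fderiv_eq]; simp
    · have h2 : z ∉ homBall m n γ (2 * R) := fun h2 => hz ⟨h2, h⟩
      -- a nonnegative function has zero derivative at its zeros
      have h0 : cutoff γ R z = 0 := by
        by_contra hne
        exact h2 (mem_homBall_of_cutoff_ne_zero hγ hR hne).2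
      have : IsLocalMin (cutoff γ R) z := by
        refine Eventually.of_forall fun w => ?_
        rw [h0]; exact cutoff_nonneg R w
      exact this.fderiv_eq_zero
  ext k
  cases k with
  | inl i => simp [grad_inl, key]
  | inr j => simp [grad_inr, key]

/-- The cutoff varies in `y` on the scale `R^(γ+1)`, which compensates the weight `|x|^γ ≤ (2R)^γ` on
its support. -/
lemma exists_norm_grad_cutoff_le (hγ : 0 < γ) : ∃ c : ℝ, 0 ≤ c ∧ ∀ R : ℝ, 0 < R →
    ∀ z : Space m n, ‖grad γ (cutoff γ R) z‖ ≤ c / R := by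
  obtain ⟨M, hM0, hM⟩ := exists_bound_fderiv_radialBump
  refine ⟨m * M + n * (2 ^ γ * (M * (γ + 1))), by positivity, fun R hR z => ?_⟩
  have hS : 0 < R ^ (γ + 1) := Real.rpow_pos_of_pos hR _
  set κ := (γ + 1) / R ^ (γ + 1) with hκ
  have hκ0 : 0 ≤ κ := by positivity
  have hd : HasFDerivAt (cutoff γ R)
      (radialBump R⁻¹ z.1 • (fderiv ℝ (radialBump κ) z.2).comp (ContinuousLinearMap.snd ℝ _ _) +
        radialBump κ z.2 • (fderiv ℝ (radialBump R⁻¹) z.1).comp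
          (ContinuousLinearMap.fst ℝ _ _)) z := by
    have d1 : HasFDerivAt (fun z : Space m n => radialBump R⁻¹ z.1)
        ((fderiv ℝ (radialBump R⁻¹) z.1).comp (ContinuousLinearMap.fst ℝ _ _)) z :=
      ((radialBump_contDiff.differentiable (by simp)) z.1).hasFDerivAt.comp z hasFDerivAt_fst
    have d2 : HasFDerivAt (fun z : Space m n => radialBump κ z.2)
        ((fderiv ℝ (radialBump κ) z.2).comp (ContinuousLinearMap.snd ℝ _ _)) z :=
      ((radialBump_contDiff.differentiable (by simp)) z.2).hasFDerivAt.comp z hasFDerivAt_snd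
    exact d1.mul d2
  have hsum : ‖grad γ (cutoff γ R) z‖ ≤ ∑ k, |grad γ (cutoff γ R) z k| := by
    have h := enorm_le_sum_enorm (grad γ (cutoff γ R) z)
    simp only [Real.enorm_eq_ofReal_abs] at h
    rw [← ENNReal.ofReal_sum_of_nonneg (fun _ _ => abs_nonneg _), ← ofReal_norm] at h
    exact (ENNReal.ofReal_le_ofReal_iff (Finset.sum_nonneg fun _ _ => abs_nonneg _)).1 h
  refine hsum.trans ?_
  rw [Fintype.sum_sum_type]
  have b1 : ∀ i, |grad γ (cutoff γ R) z (Sum.inl i)| ≤ M / R := by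
    intro i
    rw [grad_inl, hd.fderiv]
    simp only [add_apply, smul_apply, ContinuousLinearMap.comp_apply, ContinuousLinearMap.coe_snd',
      ContinuousLinearMap.coe_fst', map_zero, smul_eq_mul, mul_zero, zero_add]
    rw [abs_mul, abs_of_nonneg (radialBump_nonneg _)]
    have h1 := hM (κ := R⁻¹) (by positivity) z.1 (EuclideanSpace.single i (1 : ℝ))
    rw [show ‖EuclideanSpace.single i (1 : ℝ)‖ = 1 by simp, mul_one] at h1
    calc _ ≤ 1 * (M * R⁻¹) := mul_le_mul (radialBump_le_one _) h1 (abs_nonneg _) zero_le_one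
      _ = _ := by rw [one_mul, div_eq_mul_inv]
  have b2 : ∀ j, |grad γ (cutoff γ R) z (Sum.inr j)| ≤ 2 ^ γ * (M * (γ + 1)) / R := by
    intro j
    rw [grad_inr, hd.fderiv]
    simp only [add_apply, smul_apply, ContinuousLinearMap.comp_apply, ContinuousLinearMap.coe_snd',
      ContinuousLinearMap.coe_fst', map_zero, smul_eq_mul, mul_zero, add_zero]
    rw [abs_mul, abs_mul, abs_of_nonneg (radialBump_nonneg _),
      abs_of_nonneg (Real.rpow_nonneg (norm_nonneg _) _)]
    have h1 := hM hκ0 z.2 (EuclideanSpace.single j (1 : ℝ))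
    rw [show ‖EuclideanSpace.single j (1 : ℝ)‖ = 1 by simp, mul_one] at h1
    have h2 : ‖z.1‖ ^ γ * radialBump R⁻¹ z.1 ≤ (2 * R) ^ γ := by
      by_cases hb : radialBump R⁻¹ z.1 = 0
      · rw [hb, mul_zero]; positivity
      · have hx : (R⁻¹ * ‖z.1‖) ^ 2 < 2 := by
          by_contra hc
          exact hb (radialBump_eq_zero (not_lt.1 hc))
        have hx' : R⁻¹ * ‖z.1‖ ≤ 2 := (abs_le_of_sq_le_sq' (by linarith) (by norm_num)).2
        rw [inv_mul_le_iff₀ hR] at hx'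
        calc ‖z.1‖ ^ γ * radialBump R⁻¹ z.1 ≤ (2 * R) ^ γ * 1 :=
              mul_le_mul (Real.rpow_le_rpow (norm_nonneg _) (by linarith) hγ.le)
                (radialBump_le_one _) (radialBump_nonneg _) (by positivity)
          _ = _ := mul_one _
    calc _ = (‖z.1‖ ^ γ * radialBump R⁻¹ z.1) *
          |fderiv ℝ (radialBump κ) z.2 (EuclideanSpace.single j 1)| := by ring
      _ ≤ (2 * R) ^ γ * (M * κ) := mul_le_mul h2 h1 (abs_nonneg _) (by positivity)
      _ = _ := by
        rw [hκ, Real.mul_rpow (by norm_num) hR.le, Real.rpow_add hR, Real.rpow_one]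
        field_simp
  calc _ ≤ ∑ _i : Fin m, M / R + ∑ _j : Fin n, 2 ^ γ * (M * (γ + 1)) / R :=
        add_le_add (Finset.sum_le_sum fun i _ => b1 i) (Finset.sum_le_sum fun j _ => b2 j)
    _ = _ := by simp; ring

end Cutoff

/-! ### Positive parts and their weak gradients -/

section Boundary

variable {m n : ℕ} {γ p : ℝ} {Ω : Set (Space m n)}

lemma le_critExp (hp : 1 < p) (hpN : p < homDim m n γ) : p ≤ critExp m n γ p := by
  rw [critExp, le_div_iff₀ (by linarith)]
  nlinarith

lemma MemD.locMemW (hp : 1 < p) (hpN : p < homDim m n γ) {u : Space m n → ℝ}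
    {G : Space m n → GradSpace m n} (h : MemD γ p Ω u G) : LocMemW γ p Ω u G := by
  refine ⟨h.weakGrad, fun C hC hCΩ => ?_, fun C hC hCΩ =>
    h.memLp_grad.mono_measure (Measure.restrict_mono hCΩ le_rfl)⟩
  have : IsFiniteMeasure (volume.restrict C) := ⟨by simpa using hC.measure_lt_top⟩
  exact (h.memLp.mono_measure (Measure.restrict_mono hCΩ le_rfl)).mono_exponent
    (ENNReal.ofReal_le_ofReal (le_critExp hp hpN))

lemma IsTest.mono {Ω' : Set (Space m n)} (h : Ω ⊆ Ω') {φ : Space m n → ℝ} (hφ : IsTest Ω φ) :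
    IsTest Ω' φ := ⟨hφ.smooth, hφ.compact, hφ.supp.trans h⟩

lemma IsTest.grad_hasCompactSupport {φ : Space m n → ℝ} (hφ : IsTest Ω φ) :
    HasCompactSupport (grad γ φ) :=
  HasCompactSupport.intro hφ.compact.isCompact fun _ hz => grad_eq_zero_of_notMem_tsupport hz

lemma IsTest.memLp_grad (hγ : 0 < γ) {φ : Space m n → ℝ} (hφ : IsTest Ω φ) {r : ℝ≥0∞} :
    MemLp (grad γ φ) r volume :=
  (continuous_grad hγ (hφ.smooth.of_le (by simp))).memLp_of_hasCompactSupport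
    hφ.grad_hasCompactSupport

lemma IsTest.locMemW (hγ : 0 < γ) {Ω' : Set (Space m n)} {φ : Space m n → ℝ} (hφ : IsTest Ω' φ) :
    LocMemW γ p Ω φ (grad γ φ) := by
  have c1 : ContDiff ℝ 1 φ := hφ.smooth.of_le (by simp)
  have hc := continuous_grad hγ c1
  refine ⟨⟨c1.continuous.locallyIntegrable.locallyIntegrableOn _,
    hc.locallyIntegrable.locallyIntegrableOn _, fun ψ hψ k => ?_⟩,
    fun C hC _ => memLp_restrict_of_continuous hC c1.continuous,
    fun C hC _ => memLp_restrict_of_continuous hC hc⟩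
  rw [setIntegral_eq_integral_of_forall_compl_eq_zero,
    setIntegral_eq_integral_of_forall_compl_eq_zero]
  · exact integral_mul_grad hγ c1 (hψ.smooth.of_le (by simp)) hψ.compact k
  · intro z hz
    rw [image_eq_zero_of_notMem_tsupport fun h => hz (hψ.supp h), mul_zero]
  · intro z hz
    rw [grad_eq_zero_of_notMem_tsupport fun h => hz (hψ.supp h)]; simp

lemma exists_isTest_eq_one (hΩ : IsOpen Ω) {K : Set (Space m n)} (hK : IsCompact K) (hKΩ : K ⊆ Ω) :
    ∃ η : Space m n → ℝ, IsTest Ω η ∧ (∀ z, 0 ≤ η z) ∧ (∀ z, η z ≤ 1) ∧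
      ∀ᶠ z in 𝓝ˢ K, η z = 1 := by
  obtain ⟨L, hL, hKL, hLΩ⟩ := exists_compact_between hK hΩ hKΩ
  obtain ⟨η, h1, h0, h01⟩ := exists_contMDiffMap_one_nhds_of_subset_interior
    (modelWithCornersSelf ℝ (Space m n)) (n := ⊤) hK.isClosed hKL
  have hsupp : tsupport (η : Space m n → ℝ) ⊆ L := by
    refine closure_minimal (fun z hz => ?_) hL.isClosed
    by_contra hne
    exact hz (h0 z hne)
  exact ⟨η, ⟨η.contMDiff.contDiff, HasCompactSupport.intro hL h0, hsupp.trans hLΩ⟩,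
    fun z => (h01 z).1, fun z => (h01 z).2, h1⟩

/-- Smooth approximation of the positive part: it is bounded, and it agrees with the positive part
on `[1 / j, j]`. -/
noncomputable def approxPos (j s : ℝ) : ℝ := truncShift 0 j (smoothPos (j * s) / j)

lemma approxPos_contDiff (j : ℝ) : ContDiff ℝ ∞ (approxPos j) :=
  (truncShift_contDiff 0 j).comp
    ((smoothPos_contDiff.comp (contDiff_const.mul contDiff_id)).div_const j)

lemma approxPos_nonneg {j : ℝ} (hj : 0 < j) (s : ℝ) : 0 ≤ approxPos j s :=
  truncShift_nonneg hj (by have := smoothPos_nonneg (j * s); positivity)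

lemma approxPos_le {j : ℝ} (hj : 0 < j) (s : ℝ) : approxPos j s ≤ max s 0 := by
  refine (truncShift_le hj _).trans ?_
  rw [add_zero, div_le_iff₀ hj, max_mul_of_nonneg _ _ hj.le, zero_mul, mul_comm s]
  exact smoothPos_le _

lemma hasDerivAt_approxPos {j : ℝ} (hj : 0 < j) (s : ℝ) :
    HasDerivAt (approxPos j) (deriv (truncShift 0 j) (smoothPos (j * s) / j) *
      deriv smoothPos (j * s)) s := by
  have h1 : HasDerivAt (fun s : ℝ => j * s) j s := by simpa using (hasDerivAt_id s).const_mul j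
  have h2 := ((hasDerivAt_smoothPos (j * s)).comp s h1).div_const j
  have h3 := (hasDerivAt_truncShift (ε := 0) (k := j) (smoothPos (j * s) / j)).comp s h2
  refine h3.congr_deriv ?_
  field_simp

lemma approxPos_of_nonpos {j s : ℝ} (hj : 0 < j) (hs : s ≤ 0) : approxPos j s = 0 :=
  le_antisymm ((approxPos_le hj s).trans (by rw [max_eq_right hs])) (approxPos_nonneg hj s)

lemma deriv_approxPos_of_nonpos {j s : ℝ} (hj : 0 < j) (hs : s ≤ 0) :
    deriv (approxPos j) s = 0 := by
  rw [(hasDerivAt_approxPos hj s).deriv,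
    deriv_smoothPos_of_nonpos (mul_nonpos_of_nonneg_of_nonpos hj.le hs), mul_zero]

lemma eventually_approxPos_eq {s : ℝ} (hs : 0 < s) :
    ∀ᶠ j : ℕ in atTop, approxPos (j + 1) s = s ∧ deriv (approxPos (j + 1)) s = 1 := by
  filter_upwards [eventually_ge_atTop ⌈s⌉₊, eventually_ge_atTop ⌈s⁻¹⌉₊] with j h1 h2
  have h1' : s ≤ j := Nat.ceil_le.1 h1
  have h2' : s⁻¹ ≤ j := Nat.ceil_le.1 h2
  have hj : (0 : ℝ) < j + 1 := by positivity
  have hjs : 1 < ((j : ℝ) + 1) * s := by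
    have : 1 ≤ j * s := by rwa [inv_le_iff_one_le_mul₀ hs] at h2'
    nlinarith
  have e : smoothPos (((j : ℝ) + 1) * s) / (j + 1) = s := by
    rw [smoothPos_of_one_le hjs.le, mul_div_cancel_left₀ _ hj.ne']
  refine ⟨?_, ?_⟩
  · rw [approxPos, e, truncShift_eq hj (by linarith), add_zero]
  · rw [(hasDerivAt_approxPos hj s).deriv, e, deriv_truncShift hj,
      deriv_smoothTrunc_of_le_one ((div_le_one hj).2 (by linarith)), deriv_smoothPos_of_one_lt hjs,
      one_mul]

lemma exists_bound_deriv_approxPos :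
    ∃ M, 0 ≤ M ∧ ∀ j, 0 < j → ∀ s, |deriv (approxPos j) s| ≤ M := by
  obtain ⟨M₁, hM1, hM₁⟩ := exists_bound_deriv_truncShift
  obtain ⟨M₂, hM₂⟩ := exists_bound_deriv_smoothPos
  have hM20 : 0 ≤ M₂ := (abs_nonneg _).trans (hM₂ 0)
  refine ⟨M₁ * M₂, by positivity, fun j hj s => ?_⟩
  rw [(hasDerivAt_approxPos hj s).deriv, abs_mul]
  exact mul_le_mul (hM₁ 0 j hj _) (hM₂ _) (abs_nonneg _) (by linarith)

/-- The weak gradient of a localization of `(v - u)^+`, where the localizing function is `1`. -/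
lemma ae_eq_indicator_of_hasWeakGrad (hγ : 0 < γ) (hp : 1 < p) (hΩ : IsOpen Ω)
    {u v : Space m n → ℝ} {Du Dv : Space m n → GradSpace m n}
    (hu : LocMemW γ p Ω u Du) (hv : LocMemW γ p Ω v Dv) {χ : Space m n → ℝ}
    {G : Space m n → GradSpace m n}
    (hG : HasWeakGrad γ Ω (fun z => χ z * max (v z - u z) 0) G) {O : Set (Space m n)}
    (hO : IsOpen O) (hOΩ : O ⊆ Ω) (hχ : ∀ z ∈ O, χ z = 1) :
    ∀ᵐ z, z ∈ O → G z = {z | u z < v z}.indicator (fun z => Dv z - Du z) z := by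
  set W : Space m n → GradSpace m n := {z | u z < v z}.indicator (fun z => Dv z - Du z) with hW
  have hp1 : (1 : ℝ≥0∞) ≤ ENNReal.ofReal p := by simpa using hp.le
  have hint : ∀ C, IsCompact C → C ⊆ Ω → IntegrableOn u C ∧ IntegrableOn v C ∧
      IntegrableOn Du C ∧ IntegrableOn Dv C := by
    intro C hC hCΩ
    have : IsFiniteMeasure (volume.restrict C) := ⟨by simpa using hC.measure_lt_top⟩
    exact ⟨(hu.memLp C hC hCΩ).integrable hp1, (hv.memLp C hC hCΩ).integrable hp1,
      (hu.memLp_grad C hC hCΩ).integrable hp1, (hv.memLp_grad C hC hCΩ).integrable hp1⟩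
  have hWint : ∀ C, IsCompact C → C ⊆ Ω → IntegrableOn W C := by
    intro C hC hCΩ
    obtain ⟨h1, h2, h3, h4⟩ := hint C hC hCΩ
    exact (h4.sub h3).indicator₀ (nullMeasurableSet_lt h1.1.aemeasurable h2.1.aemeasurable)
  obtain ⟨M, hM0, hM⟩ := exists_bound_deriv_approxPos
  -- the chain rule for `approxPos (v - u)`, in the limit
  have key : ∀ φ, IsTest O φ → ∀ k, ∫ z in Ω, W z k * φ z = ∫ z in Ω, G z k * φ z := by
    intro φ hφ k
    have hφΩ := hφ.mono hOΩ
    set C := tsupport φ with hCdef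
    have hC : IsCompact C := hφ.compact
    have hCΩ : C ⊆ Ω := hφΩ.supp
    have hφz : ∀ z ∉ C, φ z = 0 := fun z hz => image_eq_zero_of_notMem_tsupport hz
    have hgz : ∀ z ∉ C, grad γ φ z = 0 := fun z hz => grad_eq_zero_of_notMem_tsupport hz
    have hrestr : ∀ F : Space m n → ℝ, (∀ z ∉ C, F z = 0) → ∫ z in Ω, F z = ∫ z in C, F z :=
      fun F hF => setIntegral_eq_of_subset_of_forall_sdiff_eq_zero hΩ.measurableSet hCΩ
        fun z hz => hF z hz.2
    have hgc : Continuous fun z => grad γ φ z k := (EuclideanSpace.proj (𝕜 := ℝ) k).continuous.comp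
      (continuous_grad hγ (hφ.smooth.of_le (by simp)))
    obtain ⟨i1, i2, i3, i4⟩ := hint C hC hCΩ
    let Φ : ℕ → ℝ × ℝ → ℝ := fun j s => approxPos (j + 1) (s.2 - s.1)
    have hj : ∀ j : ℕ, (0 : ℝ) < j + 1 := fun j => by positivity
    have hΦ : ∀ j, ContDiff ℝ ∞ (Φ j) := fun j =>
      (approxPos_contDiff _).comp (contDiff_snd.sub contDiff_fst)
    have hD1 : ∀ (j : ℕ) (a b : ℝ), fderiv ℝ (Φ j) (a, b) (1, 0) =
        -deriv (approxPos (j + 1)) (b - a) := by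
      intro j a b
      refine fderiv_apply_one_zero ((hΦ j).differentiable (by simp)) ?_
      have h := ((approxPos_contDiff (j + 1)).differentiable (by simp) (b - a)).hasDerivAt.comp a
        ((hasDerivAt_id a).const_sub b)
      exact h.congr_deriv (by simp)
    have hD2 : ∀ (j : ℕ) (a b : ℝ), fderiv ℝ (Φ j) (a, b) (0, 1) =
        deriv (approxPos (j + 1)) (b - a) := by
      intro j a b
      refine fderiv_apply_zero_one ((hΦ j).differentiable (by simp)) ?_
      have h := ((approxPos_contDiff (j + 1)).differentiable (by simp) (b - a)).hasDerivAt.comp b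
        ((hasDerivAt_id b).sub_const a)
      exact h.congr_deriv (by simp)
    have hchain : ∀ j : ℕ, ∫ z in C, approxPos (j + 1) (v z - u z) * grad γ φ z k =
        - ∫ z in C, (deriv (approxPos (j + 1)) (v z - u z) * (Dv z - Du z) k) * φ z := by
      intro j
      have := integral_comp_mul_grad hγ hp hΩ hu hv ((hΦ j).of_le (by simp))
        (M := 2 * ((j : ℕ) + 1 : ℝ) + 2 * M)
        (fun s => by
          rw [abs_of_nonneg (approxPos_nonneg (hj j) _)]
          exact (truncShift_le_two_mul (hj j) _).trans (by linarith))
        (fun s => by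
          refine (norm_le_abs_add_abs _).trans ?_
          obtain ⟨a, b⟩ := s
          rw [hD1, hD2, abs_neg]
          have := hM _ (hj j) (b - a)
          have := hj j
          linarith) hφΩ k
      rw [hrestr _ fun z hz => by rw [hgz z hz]; simp,
        hrestr _ fun z hz => by rw [hφz z hz]; simp] at this
      rw [this]
      congr 1
      refine integral_congr_ae (ae_of_all _ fun z => ?_)
      simp only [chainGrad, hD1, hD2, PiLp.add_apply, PiLp.smul_apply, PiLp.sub_apply, smul_eq_mul]
      ring
    have t1 : Tendsto (fun j : ℕ => ∫ z in C, approxPos (j + 1) (v z - u z) * grad γ φ z k) atTop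
        (𝓝 (∫ z in C, max (v z - u z) 0 * grad γ φ z k)) := by
      obtain ⟨B, hB⟩ := hC.exists_bound_of_continuousOn hgc.continuousOn
      refine tendsto_integral_of_dominated_convergence (fun z => |v z - u z| * B)
        (fun j => ?_) ((i2.sub i1).abs.mul_const B) (fun j => ?_) (ae_of_all _ fun z => ?_)
      · exact ((approxPos_contDiff _).continuous.comp_aestronglyMeasurable (i2.1.sub i1.1)).mul
          hgc.aestronglyMeasurable
      · refine (ae_restrict_iff' hC.measurableSet).2 (ae_of_all _ fun z hz => ?_)
        rw [norm_mul]
        refine mul_le_mul ?_ (hB z hz) (norm_nonneg _) (abs_nonneg _)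
        rw [Real.norm_of_nonneg (approxPos_nonneg (hj j) _)]
        exact (approxPos_le (hj j) _).trans (max_le (le_abs_self _) (abs_nonneg _))
      · refine Tendsto.mul_const _ ?_
        rcases le_or_gt (v z - u z) 0 with h | h
        · simp only [approxPos_of_nonpos (hj _) h, max_eq_right h]; exact tendsto_const_nhds
        · rw [max_eq_left h.le]
          exact tendsto_const_nhds.congr'
            ((eventually_approxPos_eq h).mono fun j hj => hj.1.symm)
    have t2 : Tendsto (fun j : ℕ => ∫ z in C, (deriv (approxPos (j + 1)) (v z - u z) *
        (Dv z - Du z) k) * φ z) atTop (𝓝 (∫ z in C, W z k * φ z)) := by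
      obtain ⟨B, hB⟩ := hC.exists_bound_of_continuousOn hφ.smooth.continuous.continuousOn
      have i5 : IntegrableOn (fun z => (Dv z - Du z) k) C :=
        (EuclideanSpace.proj (𝕜 := ℝ) k).integrable_comp (i4.sub i3)
      refine tendsto_integral_of_dominated_convergence (fun z => M * |(Dv z - Du z) k| * B)
        (fun j => ?_) ((i5.abs.const_mul M).mul_const B) (fun j => ?_) (ae_of_all _ fun z => ?_)
      · exact ((((approxPos_contDiff _).continuous_deriv (by simp)).comp_aestronglyMeasurable
          (i2.1.sub i1.1)).mul i5.1).mul hφ.smooth.continuous.aestronglyMeasurable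
      · refine (ae_restrict_iff' hC.measurableSet).2 (ae_of_all _ fun z hz => ?_)
        rw [norm_mul, norm_mul]
        exact mul_le_mul (mul_le_mul_of_nonneg_right (hM _ (hj j) _) (norm_nonneg _)) (hB z hz)
          (norm_nonneg _) (by positivity)
      · refine Tendsto.mul_const _ ?_
        rcases le_or_gt (v z - u z) 0 with h | h
        · have : W z = 0 := Set.indicator_of_notMem (by simpa using h) _
          simp only [deriv_approxPos_of_nonpos (hj _) h, this, zero_mul]
          exact tendsto_const_nhds
        · have : W z = Dv z - Du z := Set.indicator_of_mem (by simpa using h) _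
          rw [this]
          exact tendsto_const_nhds.congr'
            ((eventually_approxPos_eq h).mono fun j hj => by simp only [hj.2, one_mul])
    have e1 := tendsto_nhds_unique t1 (t2.neg.congr fun j => (hchain j).symm)
    have e2 := hG.integral_eq φ hφΩ k
    rw [hrestr _ fun z hz => by rw [hgz z hz]; simp] at e2
    have e3 : ∫ z in C, χ z * max (v z - u z) 0 * grad γ φ z k =
        ∫ z in C, max (v z - u z) 0 * grad γ φ z k :=
      setIntegral_congr_fun hC.measurableSet fun z hz => by
        simp only [hχ z (hφ.supp hz), one_mul]
    rw [hrestr _ fun z hz => by rw [hφz z hz]; simp]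
    rw [e3, e1] at e2
    linarith
  have hloc : LocallyIntegrableOn (fun z => G z - W z) O := by
    refine (hG.locInt_grad.mono_set hOΩ).sub ?_
    exact (locallyIntegrableOn_iff hO.isLocallyClosed).2 fun C hCO hC =>
      hWint C hC (hCO.trans hOΩ)
  -- uniqueness of the weak gradient in `O`
  have hzero := hO.ae_eq_zero_of_integral_contDiff_smul_eq_zero hloc fun φ hφs hφc hφO => by
    have hφ : IsTest O φ := ⟨hφs, hφc, hφO⟩
    have hCΩ : tsupport φ ⊆ Ω := hφO.trans hOΩ
    have hGC : IntegrableOn G (tsupport φ) :=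
      hG.locInt_grad.integrableOn_compact_subset hCΩ hφc
    have hWC := hWint _ hφc hCΩ
    have hφz : ∀ z ∉ tsupport φ, φ z = 0 := fun z hz => image_eq_zero_of_notMem_tsupport hz
    have hi : Integrable fun z => φ z • (G z - W z) := by
      have : IntegrableOn (fun z => φ z • (G z - W z)) (tsupport φ) :=
        (hGC.sub hWC).continuousOn_smul hφs.continuous.continuousOn hφc
      refine (integrableOn_iff_integrable_of_support_subset fun z hz => ?_).1 this
      by_contra hne
      exact hz (by simp [hφz z hne])
    ext k
    change EuclideanSpace.proj (𝕜 := ℝ) k (∫ z, φ z • (G z - W z)) = 0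
    rw [← ContinuousLinearMap.integral_comp_comm _ hi]
    have hk : ∀ H : Space m n → GradSpace m n, IntegrableOn H (tsupport φ) →
        IntegrableOn (fun z => H z k * φ z) (tsupport φ) := fun H hH =>
      IntegrableOn.mul_continuousOn (g := fun z => H z k)
        ((EuclideanSpace.proj (𝕜 := ℝ) k).integrable_comp hH) hφs.continuous.continuousOn hφc
    have hrestr : ∀ F : Space m n → ℝ, (∀ z ∉ tsupport φ, F z = 0) →
        ∫ z in Ω, F z = ∫ z in tsupport φ, F z :=
      fun F hF => setIntegral_eq_of_subset_of_forall_sdiff_eq_zero hΩ.measurableSet hCΩ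
        fun z hz => hF z hz.2
    have hkey := key φ hφ k
    rw [hrestr _ fun z hz => by rw [hφz z hz, mul_zero],
      hrestr _ fun z hz => by rw [hφz z hz, mul_zero]] at hkey
    rw [← setIntegral_eq_integral_of_forall_compl_eq_zero (s := tsupport φ)
      fun z hz => by simp [hφz z hz]]
    have : ∀ z, EuclideanSpace.proj (𝕜 := ℝ) k (φ z • (G z - W z)) =
        G z k * φ z - W z k * φ z := fun z => by
      simp only [PiLp.proj_apply, PiLp.smul_apply, PiLp.sub_apply, smul_eq_mul]; ring
    simp only [this]
    rw [integral_sub (hk G hGC) (hk W hWC), hkey, sub_self]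
  filter_upwards [hzero] with z hz hzO using sub_eq_zero.1 (hz hzO)

end Boundary

/-! ### Test functions that reach the boundary -/

section BoundaryTest

variable {m n : ℕ} {γ p : ℝ} {Ω : Set (Space m n)}

lemma grad_eq_zero_of_eventually_eq_const {φ : Space m n → ℝ} {c : ℝ} {z : Space m n}
    (h : ∀ᶠ y in 𝓝 z, φ y = c) : grad γ φ z = 0 := by
  have : fderiv ℝ φ z = 0 := by
    rw [Filter.EventuallyEq.fderiv_eq (f := fun _ => c) h]; simp
  ext k
  rcases k with i | j <;> simp [grad, this]

lemma fderiv_eq_zero_of_nonneg_of_eq_zero {E : Type*} [NormedAddCommGroup E] [NormedSpace ℝ E]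
    {Φ : E → ℝ} (h0 : ∀ s, 0 ≤ Φ s) {s : E} (hs : Φ s = 0) : fderiv ℝ Φ s = 0 :=
  IsLocalMin.fderiv_eq_zero (Eventually.of_forall fun t => by rw [hs]; exact h0 t)

/-- A weak inequality in `Ω` may be tested with `ψ Φ(u, v)` although `ψ` need not vanish on the
boundary of `Ω`, provided that `v ≤ u` there and `Φ` vanishes where `v ≤ u`: approximate
`(v - u)^+` by test functions `φ_k` in `Ω` and use `ψ Φ(u, u + φ_k)`. -/
lemma integral_inner_chainGrad_le_of_leOnBoundary {q : ℝ} (hγ : 0 < γ)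
    (hpq : p.HolderConjugate q) (hpN : p < homDim m n γ) (hΩ : IsOpen Ω) {u v : Space m n → ℝ}
    {Du Dv : Space m n → GradSpace m n} (hu : MemD γ p Ω u Du) (hv : MemD γ p Ω v Dv)
    (hvu : LeOnBoundary γ p Ω v u) {Φ : ℝ × ℝ → ℝ} (hΦ : ContDiff ℝ ∞ Φ)
    {M : ℝ} (hM : ∀ s, |Φ s| ≤ M) (hM' : ∀ s, ‖fderiv ℝ Φ s‖ ≤ M) (hΦ0 : ∀ s, 0 ≤ Φ s)
    (hΦ1 : ∀ a b, b ≤ a → Φ (a, b) = 0)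
    {A : Space m n → GradSpace m n} {h : Space m n → ℝ}
    (hA : MemLp A (ENNReal.ofReal q) (volume.restrict Ω))
    (hh : ∀ C, IsCompact C → IntegrableOn h (Ω ∩ C))
    (hineq : ∀ φ, IsTest Ω φ → (∀ z, 0 ≤ φ z) →
      ∫ z in Ω, inner ℝ (A z) (grad γ φ z) ≤ ∫ z in Ω, h z * φ z)
    {ψ : Space m n → ℝ} (hψ : IsTest Set.univ ψ) (hψ0 : ∀ z, 0 ≤ ψ z) :
    ∫ z in Ω, inner ℝ (A z) (Φ (u z, v z) • grad γ ψ z + ψ z • chainGrad Φ u v Du Dv z) ≤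
      ∫ z in Ω, h z * (ψ z * Φ (u z, v z)) := by
  have hp : 1 < p := hpq.lt
  have hcrit : 0 < critExp m n γ p := by linarith [le_critExp hp hpN]
  obtain ⟨R, hR, hψR⟩ := exists_subset_homBall hγ hψ.compact
  have hR0 : 0 < R := by linarith
  set χ : Space m n → ℝ := cutoff γ R
  obtain ⟨G, hG, φ₀, hφ₀, hφ₀t, hgφ₀t⟩ := hvu χ (isTest_cutoff hγ hR0)
  set w : Space m n → ℝ := fun z => χ z * max (v z - u z) 0 with hw
  -- a subsequence converges almost everywhere
  obtain ⟨ns, hns, hae⟩ := (tendstoInMeasure_of_tendsto_eLpNorm (by simpa using hcrit)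
    (fun k => (hφ₀ k).smooth.continuous.aestronglyMeasurable) hG.memLp.1
    hφ₀t).exists_seq_tendsto_ae
  set φ : ℕ → Space m n → ℝ := fun k => φ₀ (ns k) with hφdef
  have hφ : ∀ k, IsTest Ω (φ k) := fun k => hφ₀ _
  have hgφt := hgφ₀t.comp hns.tendsto_atTop
  -- the linear change of variables `(a, b) ↦ (a, a + b)`, so that `Φ (L (u, (v - u)^+)) = Φ (u, v)`
  let L : ℝ × ℝ →L[ℝ] ℝ × ℝ := (ContinuousLinearMap.fst ℝ ℝ ℝ).prod
    (ContinuousLinearMap.fst ℝ ℝ ℝ + ContinuousLinearMap.snd ℝ ℝ ℝ)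
  have hL : ∀ a b, L (a, b) = (a, a + b) := fun a b => rfl
  set Φ' : ℝ × ℝ → ℝ := fun s => Φ (L s) with hΦ'def
  have hΦ' : ContDiff ℝ ∞ Φ' := hΦ.comp L.contDiff
  have hΦ'0 : ∀ s, 0 ≤ Φ' s := fun s => hΦ0 _
  have hfd : ∀ s, fderiv ℝ Φ' s = (fderiv ℝ Φ (L s)).comp L := fun s => by
    have := fderiv_comp s (hΦ.differentiable (by simp) (L s)) L.differentiableAt
    rw [L.fderiv] at this
    exact this
  set M₂ := max M (M * ‖L‖)
  have hb1 : ∀ s, |Φ' s| ≤ M₂ := fun s => (hM _).trans (le_max_left _ _)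
  have hb2 : ∀ s, ‖fderiv ℝ Φ' s‖ ≤ M₂ := fun s => by
    rw [hfd]
    exact (ContinuousLinearMap.opNorm_comp_le _ _).trans
      ((mul_le_mul_of_nonneg_right (hM' _) (norm_nonneg _)).trans (le_max_right _ _))
  have hΦ'z : ∀ a, Φ' (a, 0) = 0 := fun a => by
    simp only [hΦ'def, hL, add_zero]; exact hΦ1 a a le_rfl
  have hfd0 : ∀ a, fderiv ℝ Φ' (a, 0) = 0 := fun a =>
    fderiv_eq_zero_of_nonneg_of_eq_zero hΦ'0 (hΦ'z a)
  have hul := hu.locMemW hp hpN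
  obtain ⟨M₁, hM₁⟩ := hψ.compact.exists_bound_of_continuous hψ.smooth.continuous
  have step : ∀ k, ∫ z in Ω, inner ℝ (A z) (Φ' (u z, φ k z) • grad γ ψ z +
      ψ z • chainGrad Φ' u (φ k) Du (grad γ (φ k)) z) ≤
      ∫ z in Ω, h z * (ψ z * Φ' (u z, φ k z)) := by
    intro k
    -- `ψ` may be replaced by `ψ η`, where `η ∈ C_c^∞(Ω)` equals `1` on the support of `φ k`
    obtain ⟨η, hη, hη0, -, hη1⟩ := exists_isTest_eq_one hΩ (hφ k).compact (hφ k).supp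
    have hψη : IsTest Ω (ψ * η) := ⟨hψ.smooth.mul hη.smooth, hη.compact.mul_left,
      (closure_mono (Function.support_mul_subset_right ψ η)).trans hη.supp⟩
    have := integral_inner_chainGrad_le hγ hpq hΩ hul ((hφ k).locMemW hγ) hΦ' hb1 hb2 hΦ'0
      (fun C _ hC => hA.mono_measure (Measure.restrict_mono hC le_rfl))
      (fun C hC hCΩ => by simpa [Set.inter_eq_right.2 hCΩ] using hh C hC) hineq hψη
      (fun z => mul_nonneg (hψ0 z) (hη0 z))
    have hcases : ∀ z, (∀ᶠ y in 𝓝 z, η y = 1) ∨ (φ k z = 0 ∧ grad γ (φ k) z = 0) := fun z => by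
      by_cases hz : z ∈ tsupport (φ k)
      · exact Or.inl (hη1.filter_mono (nhds_le_nhdsSet hz))
      · exact Or.inr ⟨image_eq_zero_of_notMem_tsupport hz, grad_eq_zero_of_notMem_tsupport hz⟩
    have e1 : ∀ z, Φ' (u z, φ k z) • grad γ (ψ * η) z +
        (ψ * η) z • chainGrad Φ' u (φ k) Du (grad γ (φ k)) z =
        Φ' (u z, φ k z) • grad γ ψ z + ψ z • chainGrad Φ' u (φ k) Du (grad γ (φ k)) z := fun z => by
      rcases hcases z with hz | ⟨hz, -⟩
      · have e := grad_mul (γ := γ) (hψ.smooth.of_le (by simp)) (hη.smooth.of_le (by simp)) z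
        rw [show grad γ (ψ * η) z = _ from e,
          grad_eq_zero_of_eventually_eq_const hz, Pi.mul_apply, hz.self_of_nhds]
        simp
      · simp [chainGrad, hz, hΦ'z, hfd0]
    have e2 : ∀ z, (ψ * η) z * Φ' (u z, φ k z) = ψ z * Φ' (u z, φ k z) := fun z => by
      rcases hcases z with hz | ⟨hz, -⟩
      · rw [Pi.mul_apply, hz.self_of_nhds, mul_one]
      · simp [hz, hΦ'z]
    simpa only [e1, e2] using this
  have T1 := tendsto_integral_inner_chainGrad (μ := volume.restrict Ω) hpq (hΦ'.of_le (by simp))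
    hb1 hb2 hA ((hψ.memLp_grad (γ := γ) hγ).restrict Ω) hψ.smooth.continuous.aestronglyMeasurable
    (M₁ := M₁) hM₁ (us := fun _ => u) (Dus := fun _ => Du) (fun _ => hu.memLp.1)
    (fun k => (hφ k).smooth.continuous.aestronglyMeasurable)
    (ae_of_all _ fun _ => tendsto_const_nhds) hae hu.memLp_grad hG.memLp_grad
    (fun _ => hu.memLp_grad) (fun k => ((hφ k).memLp_grad hγ).restrict Ω) (by simp) hgφt
  have T2 : Tendsto (fun k => ∫ z in Ω, h z * (ψ z * Φ' (u z, φ k z))) atTop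
      (𝓝 (∫ z in Ω, h z * (ψ z * Φ' (u z, w z)))) := by
    have hi : Integrable (fun z => h z * ψ z) (volume.restrict Ω) := by
      have h1 : IntegrableOn (fun z => h z * ψ z) (Ω ∩ tsupport ψ) :=
        (hh _ hψ.compact).mul_bdd (c := M₁) hψ.smooth.continuous.aestronglyMeasurable
          (ae_of_all _ hM₁)
      exact IntegrableOn.of_forall_sdiff_eq_zero h1 hΩ.measurableSet fun z hz => by
        rw [image_eq_zero_of_notMem_tsupport fun hz' => hz.2 ⟨hz.1, hz'⟩, mul_zero]
    simp only [← mul_assoc]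
    refine tendsto_integral_of_dominated_convergence (fun z => ‖h z * ψ z‖ * M₂) (fun k => ?_)
      (hi.norm.mul_const _) (fun k => ae_of_all _ fun z => ?_) ?_
    · exact hi.1.mul (hΦ'.continuous.comp_aestronglyMeasurable
        (hu.memLp.1.prodMk (hφ k).smooth.continuous.aestronglyMeasurable))
    · rw [norm_mul]
      exact mul_le_mul_of_nonneg_left (hb1 _) (norm_nonneg _)
    · filter_upwards [hae] with z hz
      exact ((hΦ'.continuous.tendsto _).comp (tendsto_const_nhds.prodMk_nhds hz)).const_mul _
  have hle := le_of_tendsto_of_tendsto' T1 T2 step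
  have hval : ∀ z ∈ tsupport ψ, w z = max (v z - u z) 0 := fun z hz => by
    simp only [hw, χ]; rw [cutoff_eq_one hγ hR0 (hψR hz), one_mul]
  have hΦw : ∀ z, ψ z * Φ' (u z, w z) = ψ z * Φ (u z, v z) := fun z => by
    by_cases hz : z ∈ tsupport ψ
    · rw [hval z hz]
      rcases le_total (v z) (u z) with hvu | hvu
      · rw [max_eq_right (by linarith), hΦ'z, hΦ1 _ _ hvu]
      · rw [max_eq_left (by linarith)]
        simp [hΦ'def, hL]
    · simp [image_eq_zero_of_notMem_tsupport hz]
  have hGae := ae_eq_indicator_of_hasWeakGrad hγ hp hΩ hul (hv.locMemW hp hpN) hG.weakGrad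
    (O := homBall m n γ R ∩ Ω) ((isOpen_homBall hγ R).inter hΩ) Set.inter_subset_right
    (fun z hz => cutoff_eq_one hγ hR0 hz.1)
  refine (le_of_eq ?_).trans (hle.trans (le_of_eq ?_))
  · refine integral_congr_ae ?_
    filter_upwards [ae_restrict_of_ae hGae, ae_restrict_mem hΩ.measurableSet] with z hz hzΩ
    by_cases hzψ : z ∈ tsupport ψ
    · have hGz := hz ⟨hψR hzψ, hzΩ⟩
      congr 1
      simp only [chainGrad, hval z hzψ]
      rcases lt_or_ge (u z) (v z) with hvu | hvu
      · rw [max_eq_left (by linarith), hGz, Set.indicator_of_mem (by simpa using hvu), hfd]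
        have e1 : L (u z, v z - u z) = (u z, v z) := by rw [hL]; congr 1; ring
        have e2 : L (1, 0) = (1, 0) + (0, 1) := by rw [hL]; ext <;> simp
        have e3 : L (0, 1) = (0, 1) := by rw [hL]; ext <;> simp
        rw [ContinuousLinearMap.comp_apply, ContinuousLinearMap.comp_apply, e1, e2, e3, map_add]
        have e4 : Φ' (u z, v z - u z) = Φ (u z, v z) := by simp only [hΦ'def, e1]
        rw [e4]
        module
      · rw [max_eq_right (by linarith), hΦ'z, hΦ1 _ _ hvu, hfd0,
          fderiv_eq_zero_of_nonneg_of_eq_zero hΦ0 (hΦ1 _ _ hvu)]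
        simp
    · rw [image_eq_zero_of_notMem_tsupport hzψ, grad_eq_zero_of_notMem_tsupport hzψ]
      simp
  · simp only [hΦw]

end BoundaryTest

/-! ### The difference of the tested inequalities -/

section TestedInequality

variable {m n : ℕ} {γ p : ℝ} {Ω : Set (Space m n)}

/-- The truncated quotient `(v + ε) / (u + ε)` that enters the test functions. -/
noncomputable def quot (ε k : ℝ) (u v : Space m n → ℝ) (z : Space m n) : ℝ :=
  truncShift ε k (v z) / posShift ε (u z)

lemma memLp_rpow_smul {α V : Type*} [MeasurableSpace α] {μ : Measure α} [NormedAddCommGroup V]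
    [NormedSpace ℝ V] {q : ℝ} (hpq : p.HolderConjugate q) {G : α → V}
    (hG : MemLp G (ENNReal.ofReal p) μ) :
    MemLp (fun z => ‖G z‖ ^ (p - 2) • G z) (ENNReal.ofReal q) μ := by
  have hp := hpq.lt
  have h := hG.norm_rpow_div (ENNReal.ofReal (p - 1))
  rw [← ENNReal.ofReal_div_of_pos (by linarith), ENNReal.toReal_ofReal (by linarith),
    ← hpq.conjugate_eq] at h
  refine h.mono ((hG.1.norm.aemeasurable.pow_const _).aestronglyMeasurable.smul hG.1)
    (ae_of_all _ fun z => le_of_eq ?_)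
  rw [norm_smul, Real.norm_of_nonneg (by positivity), Real.norm_of_nonneg (by positivity),
    rpow_sub_two_mul_self hp (norm_nonneg _)]

lemma integrable_norm_rpow {α V : Type*} [MeasurableSpace α] {μ : Measure α}
    [NormedAddCommGroup V] (hp : 1 < p) {G : α → V}
    (hG : MemLp G (ENNReal.ofReal p) μ) : Integrable (fun z => ‖G z‖ ^ p) μ := by
  have := hG.integrable_norm_rpow (by simpa using by linarith) (by simp)
  rwa [ENNReal.toReal_ofReal (by linarith)] at this

/-- Hölder's inequality; `N_γ / p` and `p*_γ / p` are conjugate exponents. -/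
lemma integrable_mul_abs_rpow (hp : 1 < p) (hpN : p < homDim m n γ) {f v : Space m n → ℝ}
    (hf : MemLp f (ENNReal.ofReal (homDim m n γ / p)) (volume.restrict Ω))
    (hv : MemLp v (ENNReal.ofReal (critExp m n γ p)) (volume.restrict Ω)) :
    Integrable (fun z => f z * |v z| ^ p) (volume.restrict Ω) := by
  have h := hv.norm_rpow_div (ENNReal.ofReal p)
  rw [← ENNReal.ofReal_div_of_pos (by linarith), ENNReal.toReal_ofReal (by linarith)] at h
  have hN : 0 < homDim m n γ := by linarith
  have hc : (homDim m n γ / p).HolderConjugate (critExp m n γ p / p) := by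
    rw [Real.holderConjugate_iff]
    refine ⟨(one_lt_div (by linarith)).2 hpN, ?_⟩
    rw [critExp]
    have : homDim m n γ - p ≠ 0 := by linarith
    field_simp
    ring
  have := hc.ennrealOfReal
  exact hf.integrable_mul h

lemma integrableOn_inter_of_memLp {r : ℝ≥0∞} (hr : 1 ≤ r) {V : Type*} [NormedAddCommGroup V]
    {f : Space m n → V} (hf : MemLp f r (volume.restrict Ω)) {C : Set (Space m n)}
    (hC : volume C < ⊤) : IntegrableOn f (Ω ∩ C) := by
  have : IsFiniteMeasure (volume.restrict (Ω ∩ C)) :=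
    ⟨by simpa using (measure_mono Set.inter_subset_right).trans_lt hC⟩
  exact (hf.mono_measure (Measure.restrict_mono Set.inter_subset_left le_rfl)).integrable hr

lemma integrableOn_reaction (hp : 1 < p) (hpN : p < homDim m n γ) {f v : Space m n → ℝ}
    (hf : MemLp f (ENNReal.ofReal (homDim m n γ / p)) (volume.restrict Ω))
    (hv : MemLp v (ENNReal.ofReal (critExp m n γ p)) (volume.restrict Ω))
    {C : Set (Space m n)} (hC : volume C < ⊤) :
    IntegrableOn (fun z => f z * |v z| ^ (p - 2) * v z) (Ω ∩ C) := by
  have hfi : IntegrableOn f (Ω ∩ C) := integrableOn_inter_of_memLp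
    (by simpa using (one_le_div (by linarith)).2 hpN.le) hf hC
  have h2 : IntegrableOn (fun z => f z * |v z| ^ p) (Ω ∩ C) :=
    (integrable_mul_abs_rpow hp hpN hf hv).mono_measure
      (Measure.restrict_mono Set.inter_subset_left le_rfl)
  have hvm : AEStronglyMeasurable v (volume.restrict (Ω ∩ C)) :=
    hv.1.mono_measure (Measure.restrict_mono Set.inter_subset_left le_rfl)
  refine (hfi.norm.add h2.norm).mono' ((hfi.1.mul
    (hvm.norm.aemeasurable.pow_const _).aestronglyMeasurable).mul hvm) (ae_of_all _ fun z => ?_)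
  rw [Pi.add_apply, norm_mul, norm_mul, norm_mul, mul_assoc, Real.norm_eq_abs (v z),
    Real.norm_of_nonneg (by positivity : 0 ≤ |v z| ^ (p - 2)),
    Real.norm_of_nonneg (by positivity : 0 ≤ |v z| ^ p), rpow_sub_two_mul_self hp (abs_nonneg _),
    ← mul_one_add]
  refine mul_le_mul_of_nonneg_left ?_ (norm_nonneg _)
  rcases le_total |v z| 1 with h | h
  · have := Real.rpow_le_one (abs_nonneg (v z)) h (by linarith : 0 ≤ p - 1)
    have : 0 ≤ |v z| ^ p := by positivity
    linarith
  · have := Real.rpow_le_rpow_of_exponent_le h (by linarith : p - 1 ≤ p)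
    linarith

/-- The difference of the two weak inequalities, tested with `posShift ε u * E (quot ε k u v)`
localized by `ψ`; `E` is `profileSub` for the subsolution and `profileSuper p` for the
supersolution. -/
lemma integral_testedDiff_le (hγ : 0 < γ) (hp : 1 < p) (hpN : p < homDim m n γ) (hΩ : IsOpen Ω)
    {f g u v : Space m n → ℝ} {Du Dv : Space m n → GradSpace m n}
    (hf : MemLp f (ENNReal.ofReal (homDim m n γ / p)) (volume.restrict Ω))
    (hg : MemLp g (ENNReal.ofReal (homDim m n γ / p)) (volume.restrict Ω))
    (hv : MemD γ p Ω v Dv) (hu : MemD γ p Ω u Du)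
    (hu_pos : ∀ᵐ z ∂volume.restrict Ω, 0 < u z)
    (hv_sub : IsWeakSubsolution γ p Ω f v Dv) (hu_super : IsWeakSupersolution γ p Ω g u Du)
    (hvu : LeOnBoundary γ p Ω v u) {ε k : ℝ} (hε : 0 < ε) (hk : 0 < k)
    {ψ : Space m n → ℝ} (hψ : IsTest Set.univ ψ) (hψ0 : ∀ z, 0 ≤ ψ z) :
    Integrable (fun z => ψ z * testedDiff p (quot ε k u v z) (deriv (truncShift ε k) (v z))
      (Dv z) (Du z)) (volume.restrict Ω) ∧
    ∫ z in Ω, ψ z * testedDiff p (quot ε k u v z) (deriv (truncShift ε k) (v z)) (Dv z) (Du z) ≤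
      (∫ z in Ω, ψ z * (f z * |v z| ^ (p - 2) * v z * testFun profileSub ε k (u z, v z) -
        g z * |u z| ^ (p - 2) * u z * testFun (profileSuper p) ε k (u z, v z))) +
      |∫ z in Ω, testFun profileSub ε k (u z, v z) *
        (‖Dv z‖ ^ (p - 2) * inner ℝ (Dv z) (grad γ ψ z))| +
      |∫ z in Ω, testFun (profileSuper p) ε k (u z, v z) *
        (‖Du z‖ ^ (p - 2) * inner ℝ (Du z) (grad γ ψ z))| := by
  have hpq := Real.HolderConjugate.conjExponent hp
  have hAv := memLp_rpow_smul hpq hv.memLp_grad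
  have hAu := memLp_rpow_smul hpq hu.memLp_grad
  have hE1 := profileSub_contDiff
  have hE2 := profileSuper_contDiff p
  obtain ⟨M₁, hM₁, hM₁'⟩ := testFun_bounds hE1 (fun t ht => profileSub_of_le_one ht) hε hk
  obtain ⟨M₂, hM₂, hM₂'⟩ := testFun_bounds hE2 (fun t ht => profileSuper_of_le_one p ht) hε hk
  obtain ⟨B, hB⟩ := hψ.compact.exists_bound_of_continuous hψ.smooth.continuous
  have hψm : AEStronglyMeasurable ψ (volume.restrict Ω) :=
    hψ.smooth.continuous.aestronglyMeasurable
  have hgψ : MemLp (grad γ ψ) (ENNReal.ofReal p) (volume.restrict Ω) :=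
    (hψ.memLp_grad (γ := γ) hγ).restrict Ω
  have I1 := integral_inner_chainGrad_le_of_leOnBoundary hγ hpq hpN hΩ hu hv hvu
    (testFun_contDiff (k := k) hE1 hε) hM₁ hM₁' (testFun_nonneg profileSub_nonneg hε)
    (fun a b h => testFun_of_le (fun t ht => profileSub_of_le_one ht) hε hk h) hAv
    (fun C hC => integrableOn_reaction hp hpN hf hv.memLp hC.measure_lt_top)
    (fun φ hφ hφ0 => by simpa only [real_inner_smul_left] using hv_sub φ hφ hφ0) hψ hψ0
  have I2 := integral_inner_chainGrad_le_of_leOnBoundary hγ hpq hpN hΩ hu hv hvu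
    (testFun_contDiff (k := k) hE2 hε) hM₂ hM₂' (testFun_nonneg (profileSuper_nonneg p) hε)
    (fun a b h => testFun_of_le (fun t ht => profileSuper_of_le_one p ht) hε hk h) hAu.neg
    (fun C hC => (integrableOn_reaction hp hpN hg hu.memLp hC.measure_lt_top).neg)
    (fun φ hφ hφ0 => by
      simpa only [Pi.neg_apply, inner_neg_left, real_inner_smul_left, neg_mul, integral_neg,
        neg_le_neg_iff] using hu_super φ hφ hφ0) hψ hψ0
  simp only [Pi.neg_apply, inner_neg_left, neg_mul, integral_neg, neg_le_neg_iff] at I2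
  -- both parts of the tested inequalities, with `ψ ∇Φ(u, v)` and with `Φ(u, v) ∇ψ`, are integrable
  have split : ∀ (Φ : ℝ × ℝ → ℝ) (M : ℝ), ContDiff ℝ ∞ Φ → (∀ s, |Φ s| ≤ M) →
      (∀ s, ‖fderiv ℝ Φ s‖ ≤ M) → ∀ G : Space m n → GradSpace m n,
      MemLp G (ENNReal.ofReal p) (volume.restrict Ω) →
      Integrable (fun z => ψ z * (‖G z‖ ^ (p - 2) * inner ℝ (G z) (chainGrad Φ u v Du Dv z)))
        (volume.restrict Ω) ∧
      Integrable (fun z => Φ (u z, v z) * (‖G z‖ ^ (p - 2) * inner ℝ (G z) (grad γ ψ z)))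
        (volume.restrict Ω) := by
    intro Φ M hΦ hM hM' G hG
    have huv := hu.memLp.1.prodMk hv.memLp.1
    have hA := memLp_rpow_smul hpq hG
    have hcD : ∀ e : ℝ × ℝ, AEStronglyMeasurable (fun z => fderiv ℝ Φ (u z, v z) e)
        (volume.restrict Ω) := fun e =>
      ((hΦ.continuous_fderiv (by simp)).clm_apply continuous_const).comp_aestronglyMeasurable huv
    have hbD : ∀ (e : ℝ × ℝ), ‖e‖ ≤ 1 → ∀ z, ‖fderiv ℝ Φ (u z, v z) e‖ ≤ M := fun e he z =>
      ((fderiv ℝ Φ (u z, v z)).le_opNorm e).trans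
        ((mul_le_of_le_one_right (norm_nonneg _) he).trans (hM' _))
    have hc : MemLp (chainGrad Φ u v Du Dv) (ENNReal.ofReal p) (volume.restrict Ω) := by
      refine MemLp.add ?_ ?_
      · exact hu.memLp_grad.of_le_mul (c := M) ((hcD _).smul hu.memLp_grad.1)
          (ae_of_all _ fun z => by
            rw [norm_smul]
            exact mul_le_mul_of_nonneg_right (hbD _ (by simp) z) (norm_nonneg _))
      · exact hv.memLp_grad.of_le_mul (c := M) ((hcD _).smul hv.memLp_grad.1)
          (ae_of_all _ fun z => by
            rw [norm_smul]
            exact mul_le_mul_of_nonneg_right (hbD _ (by simp) z) (norm_nonneg _))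
    have h1 := (integrable_inner_of_memLp hpq hA hc).bdd_mul hψm (ae_of_all _ hB)
    have h2 := (integrable_inner_of_memLp hpq hA hgψ).bdd_mul
      (hΦ.continuous.comp_aestronglyMeasurable huv) (ae_of_all _ fun z => hM (u z, v z))
    simp only [real_inner_smul_left] at h1 h2
    exact ⟨h1, h2⟩
  obtain ⟨i1, i2⟩ := split _ _ (testFun_contDiff (k := k) hE1 hε) hM₁ hM₁' Dv hv.memLp_grad
  obtain ⟨i3, i4⟩ := split _ _ (testFun_contDiff (k := k) hE2 hε) hM₂ hM₂' Du hu.memLp_grad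
  have r : ∀ (h w : Space m n → ℝ), MemLp h (ENNReal.ofReal (homDim m n γ / p))
      (volume.restrict Ω) → MemLp w (ENNReal.ofReal (critExp m n γ p)) (volume.restrict Ω) →
      ∀ (Φ : ℝ × ℝ → ℝ) (M : ℝ), ContDiff ℝ ∞ Φ → (∀ s, |Φ s| ≤ M) →
      Integrable (fun z => h z * |w z| ^ (p - 2) * w z * (ψ z * Φ (u z, v z)))
        (volume.restrict Ω) := by
    intro h w hh hw Φ M hΦ hM
    have h1 := integrableOn_reaction (C := tsupport ψ) hp hpN hh hw hψ.compact.measure_lt_top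
    have h2 : Integrable (fun z => h z * |w z| ^ (p - 2) * w z * ψ z) (volume.restrict Ω) :=
      IntegrableOn.of_forall_sdiff_eq_zero
        (h1.mul_bdd (c := B) hψ.smooth.continuous.aestronglyMeasurable (ae_of_all _ hB))
        hΩ.measurableSet fun z hz => by
        rw [image_eq_zero_of_notMem_tsupport fun hz' => hz.2 ⟨hz.1, hz'⟩, mul_zero]
    have h3 := h2.mul_bdd (c := M) (hΦ.continuous.comp_aestronglyMeasurable
      (hu.memLp.1.prodMk hv.memLp.1)) (ae_of_all _ fun z => hM (u z, v z))
    exact h3.congr (ae_of_all _ fun z => mul_assoc _ _ _)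
  have r1 := r f v hf hv.memLp _ _ (testFun_contDiff (k := k) hE1 hε) hM₁
  have r2 := r g u hg hu.memLp _ _ (testFun_contDiff (k := k) hE2 hε) hM₂
  have e0 : (fun z => ψ z * testedDiff p (quot ε k u v z) (deriv (truncShift ε k) (v z))
      (Dv z) (Du z)) =ᵐ[volume.restrict Ω] fun z =>
      ψ z * (‖Dv z‖ ^ (p - 2) * inner ℝ (Dv z)
        (chainGrad (testFun profileSub ε k) u v Du Dv z)) -
      ψ z * (‖Du z‖ ^ (p - 2) * inner ℝ (Du z)
        (chainGrad (testFun (profileSuper p) ε k) u v Du Dv z)) := by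
    filter_upwards [hu_pos] with z hz
    simp only [chainGrad, fderiv_testFun_fst hE1 hε, fderiv_testFun_fst hE2 hε,
      fderiv_testFun_snd hE1 hε, fderiv_testFun_snd hE2 hε, deriv_posShift_of_nonneg hε hz.le,
      one_mul, ← mul_sub]
    rfl
  refine ⟨(i1.sub i3).congr e0.symm, ?_⟩
  rw [integral_congr_ae e0, integral_sub i1 i3]
  have s1 : ∀ (Φ : ℝ × ℝ → ℝ) (G : Space m n → GradSpace m n) z,
      inner ℝ (‖G z‖ ^ (p - 2) • G z) (Φ (u z, v z) • grad γ ψ z + ψ z •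
        chainGrad Φ u v Du Dv z) =
      Φ (u z, v z) * (‖G z‖ ^ (p - 2) * inner ℝ (G z) (grad γ ψ z)) +
      ψ z * (‖G z‖ ^ (p - 2) * inner ℝ (G z) (chainGrad Φ u v Du Dv z)) := fun Φ G z => by
    rw [inner_add_right, real_inner_smul_left, real_inner_smul_left, real_inner_smul_right,
      real_inner_smul_right]; ring
  simp only [s1] at I1 I2
  rw [integral_add i2 i1] at I1
  rw [integral_add i4 i3] at I2
  have e3 : ∫ z in Ω, ψ z * (f z * |v z| ^ (p - 2) * v z * testFun profileSub ε k (u z, v z) -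
        g z * |u z| ^ (p - 2) * u z * testFun (profileSuper p) ε k (u z, v z)) =
      (∫ z in Ω, f z * |v z| ^ (p - 2) * v z * (ψ z * testFun profileSub ε k (u z, v z))) -
      ∫ z in Ω, g z * |u z| ^ (p - 2) * u z * (ψ z * testFun (profileSuper p) ε k (u z, v z)) := by
    rw [← integral_sub r1 r2]
    congr 1; ext z; ring
  rw [e3]
  have a1 := neg_abs_le (∫ z in Ω, testFun profileSub ε k (u z, v z) *
        (‖Dv z‖ ^ (p - 2) * inner ℝ (Dv z) (grad γ ψ z)))
  have a2 := le_abs_self (∫ z in Ω, testFun (profileSuper p) ε k (u z, v z) *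
        (‖Du z‖ ^ (p - 2) * inner ℝ (Du z) (grad γ ψ z)))
  linarith

end TestedInequality

/-! ### Removing the regularization -/

section Fatou

variable {m n : ℕ} {γ p : ℝ} {Ω : Set (Space m n)}

lemma eventually_shift_le (b : ℝ) : ∀ᶠ j : ℕ in atTop, b + 1 / ((j : ℝ) + 1) ≤ j + 1 := by
  filter_upwards [eventually_ge_atTop ⌈b⌉₊] with j hj
  have h1 : b ≤ j := Nat.ceil_le.1 hj
  have h2 : 1 / ((j : ℝ) + 1) ≤ 1 := by
    rw [div_le_one (by positivity)]; linarith [Nat.cast_nonneg (α := ℝ) j]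
  linarith

lemma tendsto_quot {u v : Space m n → ℝ} {z : Space m n} (hz : 0 < u z) :
    Tendsto (fun j : ℕ => quot (1 / ((j : ℝ) + 1)) (j + 1) u v z) atTop (𝓝 (v z / u z)) := by
  have h0 := tendsto_one_div_add_atTop_nhds_zero_nat (𝕜 := ℝ)
  have h : Tendsto (fun j : ℕ => (v z + 1 / ((j : ℝ) + 1)) / (u z + 1 / ((j : ℝ) + 1))) atTop
      (𝓝 ((v z + 0) / (u z + 0))) :=
    (h0.const_add _).div (h0.const_add _) (by simpa using hz.ne')
  rw [add_zero, add_zero] at h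
  refine h.congr' ?_
  filter_upwards [eventually_shift_le (v z)] with j hj
  rw [quot, truncShift_eq (by positivity) hj, posShift_of_nonneg (by positivity) hz.le]

lemma continuousAt_picone_smul {V : Type*} [NormedAddCommGroup V] [InnerProductSpace ℝ V]
    (hp : 1 < p) (a b : V) {t : ℝ} (ht : 0 < t) :
    ContinuousAt (fun t : ℝ => picone p a (t • b)) t := by
  have h : (fun t : ℝ => ‖a‖ ^ p - p * (t ^ (p - 1) * (‖b‖ ^ (p - 2) * inner ℝ b a)) +
      (p - 1) * (t ^ p * ‖b‖ ^ p)) =ᶠ[𝓝 t] fun t => picone p a (t • b) := by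
    filter_upwards [lt_mem_nhds ht] with s hs
    rw [picone, norm_smul, Real.norm_of_nonneg hs.le, Real.mul_rpow hs.le (norm_nonneg _),
      Real.mul_rpow hs.le (norm_nonneg _), real_inner_smul_left, ← rpow_sub_two_mul_self hp hs.le]
    ring
  refine ContinuousAt.congr ?_ h
  have h1 : ContinuousAt (fun t : ℝ => t ^ (p - 1)) t :=
    Real.continuousAt_rpow_const _ _ (Or.inl ht.ne')
  have h2 : ContinuousAt (fun t : ℝ => t ^ p) t := Real.continuousAt_rpow_const _ _ (Or.inl ht.ne')
  fun_prop

lemma mul_div_rpow_eq (hp : 1 < p) {x q : ℝ} (hx : 0 ≤ x) (hq : 0 < q) :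
    q * (x / q) ^ p = x ^ p / q ^ (p - 1) := by
  rw [Real.div_rpow hx hq.le, ← rpow_sub_one_mul_self hp hq.le]
  have := Real.rpow_pos_of_pos hq (p - 1)
  field_simp

lemma testFun_profileSub_le {ε k a b : ℝ} (hε : 0 < ε) (hk : 0 < k) (ha : 0 < a) :
    testFun profileSub ε k (a, b) ≤ max b 0 + ε := by
  rcases le_or_gt b a with h | h
  · rw [testFun_of_le (fun t ht => profileSub_of_le_one ht) hε hk h]
    have := le_max_right b 0; linarith
  · have hq := posShift_pos hε a
    have hT := truncShift_nonneg (ε := ε) (b := b) hk (by linarith)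
    simp only [testFun, profileSub]
    rw [← mul_assoc, mul_div_cancel₀ _ hq.ne']
    calc _ ≤ truncShift ε k b := mul_le_of_le_one_right hT (stepF_le_one _)
      _ ≤ b + ε := truncShift_le hk b
      _ ≤ _ := by have := le_max_left b 0; linarith

lemma testFun_profileSuper_le (hp : 1 < p) {ε k a b : ℝ} (hε : 0 < ε) (hk : 0 < k) (ha : 0 < a)
    (hab : a < b) : testFun (profileSuper p) ε k (a, b) ≤ (b + ε) ^ p / (a + ε) ^ (p - 1) := by
  have hq : posShift ε a = a + ε := posShift_of_nonneg hε ha.le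
  have hq0 : 0 < a + ε := by linarith
  have hT := truncShift_nonneg (ε := ε) (b := b) hk (by linarith)
  simp only [testFun, profileSuper]
  rw [hq, ← mul_assoc, mul_div_rpow_eq hp hT hq0]
  calc _ ≤ truncShift ε k b ^ p / (a + ε) ^ (p - 1) :=
        mul_le_of_le_one_right (by positivity) (stepF_le_one _)
    _ ≤ _ := by
        gcongr
        exact truncShift_le hk b

lemma testFun_profileSuper_le' (hp : 1 < p) {ε k a b : ℝ} (hε : 0 < ε) (hk : 0 < k) (ha : 0 < a) :
    testFun (profileSuper p) ε k (a, b) ≤ 2 ^ p * (max b 0 ^ p / a ^ (p - 1) + ε) := by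
  have hp1 : 0 ≤ p - 1 := by linarith
  rcases le_or_gt b a with h | h
  · rw [testFun_of_le (fun t ht => profileSuper_of_le_one p ht) hε hk h]
    have := le_max_right b 0; positivity
  have hb : 0 < b := ha.trans h
  rw [max_eq_left hb.le]
  refine (testFun_profileSuper_le hp hε hk ha h).trans ?_
  rcases le_total ε b with hεb | hεb
  · calc (b + ε) ^ p / (a + ε) ^ (p - 1) ≤ (2 * b) ^ p / a ^ (p - 1) := by
          gcongr <;> linarith
      _ = 2 ^ p * (b ^ p / a ^ (p - 1)) := by
          rw [Real.mul_rpow (by norm_num) hb.le, mul_div_assoc]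
      _ ≤ _ := by gcongr; linarith
  · calc (b + ε) ^ p / (a + ε) ^ (p - 1) ≤ (2 * ε) ^ p / ε ^ (p - 1) := by
          gcongr <;> linarith
      _ = 2 ^ p * ε := by
          rw [Real.mul_rpow (by norm_num) hε.le, ← rpow_sub_one_mul_self hp hε.le]
          have := Real.rpow_pos_of_pos hε (p - 1)
          field_simp
      _ ≤ _ := by gcongr; have : 0 ≤ b ^ p / a ^ (p - 1) := by positivity
                  linarith

lemma add_one_rpow_le (hp : 1 < p) {x : ℝ} (hx : 0 ≤ x) : (x + 1) ^ p ≤ 2 ^ p * (x ^ p + 1) := by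
  have hxp : 0 ≤ x ^ p := by positivity
  rcases le_total x 1 with h | h
  · calc (x + 1) ^ p ≤ 2 ^ p := by gcongr; linarith
      _ ≤ _ := le_mul_of_one_le_right (by positivity) (by linarith)
  · calc (x + 1) ^ p ≤ (2 * x) ^ p := by gcongr; linarith
      _ = 2 ^ p * x ^ p := Real.mul_rpow (by norm_num) hx
      _ ≤ _ := by gcongr; linarith

/-- In the limit the zeroth order terms of the tested inequalities contribute
`∫ ψ F(v / u) (f - g) v ^ p`, which is nonpositive. -/
lemma exists_tendsto_integral_reaction (hp : 1 < p) (hpN : p < homDim m n γ)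
    (hΩ : IsOpen Ω) {f g u v : Space m n → ℝ}
    (hf : MemLp f (ENNReal.ofReal (homDim m n γ / p)) (volume.restrict Ω))
    (hg : MemLp g (ENNReal.ofReal (homDim m n γ / p)) (volume.restrict Ω))
    (hfg : ∀ᵐ z ∂volume.restrict Ω, f z ≤ g z)
    (hu : AEStronglyMeasurable u (volume.restrict Ω))
    (hv : MemLp v (ENNReal.ofReal (critExp m n γ p)) (volume.restrict Ω))
    (hu_pos : ∀ᵐ z ∂volume.restrict Ω, 0 < u z)
    {ψ : Space m n → ℝ} (hψ : IsTest Set.univ ψ) (hψ0 : ∀ z, 0 ≤ ψ z) :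
    ∃ r ≤ 0, Tendsto (fun j : ℕ => ∫ z in Ω, ψ z *
      (f z * |v z| ^ (p - 2) * v z * testFun profileSub (1 / ((j : ℝ) + 1)) (j + 1) (u z, v z) -
        g z * |u z| ^ (p - 2) * u z *
          testFun (profileSuper p) (1 / ((j : ℝ) + 1)) (j + 1) (u z, v z))) atTop (𝓝 r) := by
  obtain ⟨B, hB⟩ := hψ.compact.exists_bound_of_continuous hψ.smooth.continuous
  have hε : ∀ j : ℕ, 0 < 1 / ((j : ℝ) + 1) := fun j => by positivity
  have hε1 : ∀ j : ℕ, 1 / ((j : ℝ) + 1) ≤ 1 := fun j => by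
    rw [div_le_one (by positivity)]; linarith [Nat.cast_nonneg (α := ℝ) j]
  have hk : ∀ j : ℕ, (0 : ℝ) < j + 1 := fun j => by positivity
  -- the pointwise limit of the integrand
  set r : Space m n → ℝ := fun z =>
    if u z < v z then ψ z * (stepF (v z / u z) * ((f z - g z) * v z ^ p)) else 0 with hr
  refine ⟨∫ z in Ω, r z, integral_nonpos_of_ae ?_, ?_⟩
  · filter_upwards [hu_pos, hfg] with z hz hz'
    simp only [hr, Pi.zero_apply]
    split_ifs with h
    · refine mul_nonpos_of_nonneg_of_nonpos (hψ0 z) (mul_nonpos_of_nonneg_of_nonpos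
        (stepF_nonneg _) (mul_nonpos_of_nonpos_of_nonneg (by linarith)
          (Real.rpow_nonneg (hz.trans h).le _)))
    · exact le_rfl
  have hvp := integrable_mul_abs_rpow hp hpN hf hv
  have hgp := integrable_mul_abs_rpow hp hpN hg hv
  have hN1 : (1 : ℝ≥0∞) ≤ ENNReal.ofReal (homDim m n γ / p) := by
    simpa using (one_le_div (by linarith)).2 hpN.le
  have hbound : Integrable (fun z => ψ z * ((|f z| + |g z|) * (2 ^ p * (|v z| ^ p + 1))))
      (volume.restrict Ω) := by
    have h0 : IntegrableOn (fun z => (|f z| + |g z|) * (2 ^ p * (|v z| ^ p + 1)))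
        (Ω ∩ tsupport ψ) := by
      have a1 := integrableOn_inter_of_memLp hN1 hf (C := tsupport ψ) hψ.compact.measure_lt_top
      have a2 := integrableOn_inter_of_memLp hN1 hg (C := tsupport ψ) hψ.compact.measure_lt_top
      have hm := Measure.restrict_mono (μ := (volume : Measure (Space m n)))
        (Set.inter_subset_left : Ω ∩ tsupport ψ ⊆ Ω) le_rfl
      have a3 := ((((hvp.mono_measure hm).norm.add (hgp.mono_measure hm).norm).add a1.abs).add
        a2.abs).const_mul (2 ^ p)
      refine a3.congr (ae_of_all _ fun z => ?_)
      have : 0 ≤ |v z| ^ p := by positivity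
      simp only [Pi.add_apply, Real.norm_eq_abs, abs_mul, abs_of_nonneg this]
      ring
    exact IntegrableOn.of_forall_sdiff_eq_zero
      (h0.bdd_mul (c := B) hψ.smooth.continuous.aestronglyMeasurable (ae_of_all _ hB))
      hΩ.measurableSet fun z hz => by
        rw [image_eq_zero_of_notMem_tsupport fun hz' => hz.2 ⟨hz.1, hz'⟩, zero_mul]
  refine tendsto_integral_of_dominated_convergence _ (fun j => ?_) hbound (fun j => ?_) ?_
  · have huv := hu.prodMk hv.1
    have h1 := (testFun_contDiff (k := (j : ℝ) + 1) profileSub_contDiff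
      (hε j)).continuous.comp_aestronglyMeasurable huv
    have h2 := (testFun_contDiff (k := (j : ℝ) + 1) (profileSuper_contDiff p)
      (hε j)).continuous.comp_aestronglyMeasurable huv
    exact hψ.smooth.continuous.aestronglyMeasurable.mul
      ((((hf.1.mul (hv.1.norm.aemeasurable.pow_const _).aestronglyMeasurable).mul hv.1).mul h1).sub
      (((hg.1.mul (hu.norm.aemeasurable.pow_const _).aestronglyMeasurable).mul hu).mul h2))
  · filter_upwards [hu_pos] with z hz
    rw [norm_mul, Real.norm_of_nonneg (hψ0 z)]
    refine mul_le_mul_of_nonneg_left ?_ (hψ0 z)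
    rcases le_or_gt (v z) (u z) with h | h
    · rw [testFun_of_le (fun t ht => profileSub_of_le_one ht) (hε j) (hk j) h,
        testFun_of_le (fun t ht => profileSuper_of_le_one p ht) (hε j) (hk j) h]
      simp only [mul_zero, sub_zero, norm_zero]
      positivity
    have hv0 := hz.trans h
    have e1 : ∀ x : ℝ, 0 < x → |x| ^ (p - 2) * x = x ^ (p - 1) := fun x hx => by
      rw [abs_of_pos hx, rpow_sub_two_mul_self hp hx.le]
    have b0 := (add_one_rpow_le hp hv0.le)
    -- Both zeroth order terms are dominated by `(v + 1)^p`, uniformly in the regularization. In the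
    -- second one, `u^(p - 1)` cancels the denominator of the test function.
    have b1 : v z ^ (p - 1) * testFun profileSub (1 / ((j : ℝ) + 1)) (j + 1) (u z, v z) ≤
        2 ^ p * (|v z| ^ p + 1) := by
      rw [abs_of_pos hv0]
      refine le_trans ?_ b0
      rw [← rpow_sub_one_mul_self hp (by linarith : 0 ≤ v z + 1)]
      have h3 := testFun_profileSub_le (b := v z) (hε j) (hk j) hz
      rw [max_eq_left hv0.le] at h3
      have h4 := testFun_nonneg (E := profileSub) (k := (j : ℝ) + 1) profileSub_nonneg (hε j)
        (u z, v z)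
      have h5 : v z ^ (p - 1) ≤ (v z + 1) ^ (p - 1) :=
        Real.rpow_le_rpow hv0.le (by linarith) (by linarith)
      exact mul_le_mul h5 (h3.trans (by linarith [hε1 j])) h4 (by positivity)
    have b2 : u z ^ (p - 1) * testFun (profileSuper p) (1 / ((j : ℝ) + 1)) (j + 1) (u z, v z) ≤
        2 ^ p * (|v z| ^ p + 1) := by
      rw [abs_of_pos hv0]
      refine le_trans ?_ b0
      have h3 := testFun_profileSuper_le hp (hε j) (hk j) hz h
      have hq : 0 < (u z + 1 / ((j : ℝ) + 1)) ^ (p - 1) :=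
        Real.rpow_pos_of_pos (by linarith [hε j]) _
      have h4 : u z ^ (p - 1) ≤ (u z + 1 / ((j : ℝ) + 1)) ^ (p - 1) :=
        Real.rpow_le_rpow hz.le (by linarith [hε j]) (by linarith)
      calc _ ≤ u z ^ (p - 1) * _ := mul_le_mul_of_nonneg_left h3 (by positivity)
        _ ≤ (u z + 1 / ((j : ℝ) + 1)) ^ (p - 1) * _ := mul_le_mul_of_nonneg_right h4
            (by have := hε j; positivity)
        _ = (v z + 1 / ((j : ℝ) + 1)) ^ p := by rw [mul_div_cancel₀ _ hq.ne']
        _ ≤ _ := Real.rpow_le_rpow (by linarith [hε j]) (by linarith [hε1 j]) (by linarith)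
    have n1 := testFun_nonneg (E := profileSub) (k := (j : ℝ) + 1) profileSub_nonneg (hε j)
        (u z, v z)
    have n2 := testFun_nonneg (k := (j : ℝ) + 1) (profileSuper_nonneg p) (hε j) (u z, v z)
    have n3 : 0 ≤ v z ^ (p - 1) := by positivity
    have n4 : 0 ≤ u z ^ (p - 1) := by positivity
    rw [mul_assoc (f z), mul_assoc (g z), e1 _ hv0, e1 _ hz, mul_assoc, mul_assoc, add_mul]
    refine (norm_sub_le _ _).trans (add_le_add ?_ ?_)
    · rw [norm_mul, Real.norm_of_nonneg (mul_nonneg n3 n1)]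
      exact mul_le_mul_of_nonneg_left b1 (norm_nonneg _)
    · rw [norm_mul, Real.norm_of_nonneg (mul_nonneg n4 n2)]
      exact mul_le_mul_of_nonneg_left b2 (norm_nonneg _)
  · filter_upwards [hu_pos] with z hz
    simp only [hr]
    split_ifs with h
    · have hv0 := hz.trans h
      refine Tendsto.const_mul _ ?_
      have h0 := tendsto_one_div_add_atTop_nhds_zero_nat (𝕜 := ℝ)
      have hF : Tendsto (fun j : ℕ => stepF (quot (1 / ((j : ℝ) + 1)) (j + 1) u v z)) atTop
          (𝓝 (stepF (v z / u z))) :=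
        (stepF_contDiff.continuous.tendsto _).comp (tendsto_quot hz)
      have l1 : Tendsto (fun j : ℕ => testFun profileSub (1 / ((j : ℝ) + 1)) (j + 1) (u z, v z))
          atTop (𝓝 (u z * (v z / u z * stepF (v z / u z)))) := by
        have h1 : Tendsto (fun j : ℕ => u z + 1 / ((j : ℝ) + 1)) atTop (𝓝 (u z)) := by
          simpa using h0.const_add (u z)
        refine (h1.mul ((tendsto_quot (v := v) hz).mul hF)).congr fun j => ?_
        rw [testFun, posShift_of_nonneg (hε j) hz.le, profileSub]
        simp only [quot, posShift_of_nonneg (hε j) hz.le]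
      have l2 : Tendsto (fun j : ℕ => testFun (profileSuper p) (1 / ((j : ℝ) + 1)) (j + 1)
          (u z, v z)) atTop (𝓝 (u z * ((v z / u z) ^ p * stepF (v z / u z)))) := by
        have h1 : Tendsto (fun j : ℕ => u z + 1 / ((j : ℝ) + 1)) atTop (𝓝 (u z)) := by
          simpa using h0.const_add (u z)
        have h2 := (tendsto_quot (v := v) hz).rpow_const (p := p)
          (Or.inl (div_pos hv0 hz).ne')
        refine (h1.mul (h2.mul hF)).congr fun j => ?_
        rw [testFun, posShift_of_nonneg (hε j) hz.le, profileSuper]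
        simp only [quot, posShift_of_nonneg (hε j) hz.le]
      have l3 := (l1.const_mul (f z * |v z| ^ (p - 2) * v z)).sub
        (l2.const_mul (g z * |u z| ^ (p - 2) * u z))
      convert l3 using 2
      rw [← mul_assoc (u z) ((v z / u z) ^ p), mul_div_rpow_eq hp hv0.le hz,
        ← mul_assoc (u z) (v z / u z), mul_div_cancel₀ _ hz.ne', mul_assoc (f z), mul_assoc (g z),
        abs_of_pos hv0, abs_of_pos hz, rpow_sub_two_mul_self hp hv0.le,
        rpow_sub_two_mul_self hp hz.le, ← rpow_sub_one_mul_self hp hv0.le]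
      have := Real.rpow_pos_of_pos hz (p - 1)
      field_simp
    · refine tendsto_const_nhds.congr fun j => ?_
      have h' := not_lt.1 h
      rw [testFun_of_le (fun t ht => profileSub_of_le_one ht) (hε j) (hk j) h',
        testFun_of_le (fun t ht => profileSuper_of_le_one p ht) (hε j) (hk j) h']
      simp

end Fatou

/-! ### The localized Picone estimate -/

section Localized

variable {m n : ℕ} {γ p : ℝ} {Ω : Set (Space m n)}

lemma lintegral_rpow_mul_grad_lt_top (hγ : 0 < γ) (hp : 1 < p) {G : Space m n → GradSpace m n}
    (hG : MemLp G (ENNReal.ofReal p) (volume.restrict Ω)) {ψ : Space m n → ℝ}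
    (hψ : IsTest Set.univ ψ) :
    ∫⁻ z in Ω, ENNReal.ofReal (‖G z‖ ^ (p - 1) * ‖grad γ ψ z‖) < ⊤ := by
  have h1 := integrable_norm_rpow hp hG
  have h2 := integrable_norm_rpow hp ((hψ.memLp_grad (γ := γ) (r := ENNReal.ofReal p) hγ).restrict Ω)
  refine lt_of_le_of_lt (lintegral_mono fun z => ENNReal.ofReal_le_ofReal
    (rpow_sub_one_mul_le hp (norm_nonneg _) (norm_nonneg _))) ?_
  exact (h1.add h2).lintegral_lt_top

lemma ofReal_abs_integral_le {a b : Space m n → ℝ} {c : Space m n → GradSpace m n} (hp : 1 < p)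
    {G : Space m n → GradSpace m n} (ha : ∀ᵐ z ∂volume.restrict Ω, 0 ≤ a z ∧ a z ≤ b z) :
    ENNReal.ofReal |∫ z in Ω, a z * (‖G z‖ ^ (p - 2) * inner ℝ (G z) (c z))| ≤
      ∫⁻ z in Ω, ENNReal.ofReal (b z * (‖G z‖ ^ (p - 1) * ‖c z‖)) := by
  rw [← Real.enorm_eq_ofReal_abs]
  refine (enorm_integral_le_lintegral_enorm _).trans (lintegral_mono_ae ?_)
  filter_upwards [ha] with z hz
  rw [Real.enorm_eq_ofReal_abs, abs_mul, abs_of_nonneg hz.1]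
  exact ENNReal.ofReal_le_ofReal (mul_le_mul hz.2 (abs_rpow_mul_inner_le hp _ _) (abs_nonneg _)
    (hz.1.trans hz.2))

/-- The localized estimate: only the terms containing the gradient of the cutoff function `ψ`
remain on the right-hand side. -/
lemma lintegral_picone_le (hγ : 0 < γ) (hp : 1 < p) (hpN : p < homDim m n γ) (hΩ : IsOpen Ω)
    {f g u v : Space m n → ℝ} {Du Dv : Space m n → GradSpace m n}
    (hf : MemLp f (ENNReal.ofReal (homDim m n γ / p)) (volume.restrict Ω))
    (hg : MemLp g (ENNReal.ofReal (homDim m n γ / p)) (volume.restrict Ω))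
    (hfg : ∀ᵐ z ∂volume.restrict Ω, f z ≤ g z)
    (hv : MemD γ p Ω v Dv) (hu : MemD γ p Ω u Du)
    (hu_pos : ∀ᵐ z ∂volume.restrict Ω, 0 < u z)
    (hv_sub : IsWeakSubsolution γ p Ω f v Dv) (hu_super : IsWeakSupersolution γ p Ω g u Du)
    (hvu : LeOnBoundary γ p Ω v u)
    {ψ : Space m n → ℝ} (hψ : IsTest Set.univ ψ) (hψ0 : ∀ z, 0 ≤ ψ z) :
    ∫⁻ z in Ω, ENNReal.ofReal
        (ψ z * (stepF (v z / u z) * picone p (Dv z) ((v z / u z) • Du z))) ≤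
      (∫⁻ z in Ω, ENNReal.ofReal (max (v z) 0 * (‖Dv z‖ ^ (p - 1) * ‖grad γ ψ z‖))) +
      ∫⁻ z in Ω, ENNReal.ofReal (2 ^ p * (max (v z) 0 ^ p / u z ^ (p - 1)) *
        (‖Du z‖ ^ (p - 1) * ‖grad γ ψ z‖)) := by
  obtain ⟨D, hD1, hD⟩ := exists_bound_deriv_truncShift
  obtain ⟨C, hC0, hC⟩ := exists_neg_le_testedDiff (V := GradSpace m n) hp
    (by linarith : (0 : ℝ) ≤ D)
  obtain ⟨B, hB⟩ := hψ.compact.exists_bound_of_continuous hψ.smooth.continuous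
  have hε : ∀ j : ℕ, 0 < 1 / ((j : ℝ) + 1) := fun j => by positivity
  have hk : ∀ j : ℕ, (0 : ℝ) < j + 1 := fun j => by positivity
  have h0 := tendsto_one_div_add_atTop_nhds_zero_nat (𝕜 := ℝ)
  have hψm : AEStronglyMeasurable ψ (volume.restrict Ω) :=
    hψ.smooth.continuous.aestronglyMeasurable
  obtain ⟨r, hr0, hr⟩ := exists_tendsto_integral_reaction hp hpN hΩ hf hg hfg hu.memLp.1 hv.memLp
    hu_pos hψ hψ0
  set E : Space m n → ℝ := fun z => ψ z * (C * (‖Dv z‖ ^ p + ‖Du z‖ ^ p)) with hE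
  have hE0 : ∀ z, 0 ≤ E z := fun z => by have := hψ0 z; positivity
  have hEi : Integrable E (volume.restrict Ω) :=
    (((integrable_norm_rpow hp hv.memLp_grad).add (integrable_norm_rpow hp
      hu.memLp_grad)).const_mul C).bdd_mul hψm (ae_of_all _ hB)
  -- On the set `S j` where the truncation is active Picone's inequality may fail, but the error is
  -- at most `E`, and `S j` shrinks to the empty set.
  let S : ℕ → Set (Space m n) := fun j => {z | (j : ℝ) + 1 < v z + 1 / ((j : ℝ) + 1)}
  have hS : ∀ j, NullMeasurableSet (S j) (volume.restrict Ω) := fun j =>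
    nullMeasurableSet_lt aemeasurable_const (hv.memLp.1.aemeasurable.add_const _)
  have hSi : ∀ j, Integrable ((S j).indicator E) (volume.restrict Ω) := fun j =>
    hEi.indicator₀ (hS j)
  have hbad : Tendsto (fun j => ∫ z in Ω, (S j).indicator E z) atTop (𝓝 0) := by
    have := tendsto_integral_of_dominated_convergence (μ := volume.restrict Ω) (f := fun _ => 0)
      (F := fun j => (S j).indicator E) E (fun j => (hSi j).1) hEi
      (fun j => ae_of_all _ fun z => by
        rw [Real.norm_of_nonneg (Set.indicator_nonneg (fun z _ => hE0 z) z)]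
        exact Set.indicator_le_self' (fun z _ => hE0 z) z)
      (ae_of_all _ fun z => by
        refine tendsto_const_nhds.congr' ?_
        filter_upwards [eventually_shift_le (v z)] with j hj
        rw [Set.indicator_of_notMem]
        exact not_lt.2 hj)
    simpa using this
  let J : ℕ → Space m n → ℝ := fun j z => ψ z * testedDiff p
    (quot (1 / ((j : ℝ) + 1)) (j + 1) u v z) (deriv (truncShift (1 / ((j : ℝ) + 1)) (j + 1)) (v z))
    (Dv z) (Du z)
  -- the corrected integrand is nonnegative, so that Fatou's lemma applies to it
  let X : ℕ → Space m n → ℝ := fun j z => J j z + (S j).indicator E z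
  have hJ := fun j : ℕ => integral_testedDiff_le hγ hp hpN hΩ hf hg hv hu hu_pos hv_sub hu_super
    hvu (hε j) (hk j) hψ hψ0
  have hXi : ∀ j, Integrable (X j) (volume.restrict Ω) := fun j => (hJ j).1.add (hSi j)
  have hXle : ∀ (j : ℕ) z, ψ z * (stepF (quot (1 / ((j : ℝ) + 1)) (j + 1) u v z) *
      picone p (Dv z) (quot (1 / ((j : ℝ) + 1)) (j + 1) u v z • Du z)) ≤ X j z ∨ z ∈ S j := by
    intro j z
    by_cases hz : z ∈ S j
    · exact Or.inr hz
    · left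
      have hz' : v z + 1 / ((j : ℝ) + 1) ≤ j + 1 := not_lt.1 hz
      simp only [X, J, Set.indicator_of_notMem hz, add_zero]
      rw [deriv_truncShift (hk j), deriv_smoothTrunc_of_le_one ((div_le_one (hk j)).2 hz')]
      exact mul_le_mul_of_nonneg_left (picone_le_testedDiff hp _ _ _) (hψ0 z)
  have hX0 : ∀ j z, 0 ≤ X j z := fun j z => by
    by_cases hz : z ∈ S j
    · simp only [X, J, Set.indicator_of_mem hz, hE, ← mul_add]
      refine mul_nonneg (hψ0 z) ?_
      have := hC (quot (1 / ((j : ℝ) + 1)) (j + 1) u v z)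
        (deriv (truncShift (1 / ((j : ℝ) + 1)) (j + 1)) (v z)) (Dv z) (Du z) (hD _ _ (hk j) _)
      linarith
    · exact (mul_nonneg (hψ0 z) (mul_nonneg (stepF_nonneg _) (picone_nonneg hp _ _))).trans
        ((hXle j z).resolve_right hz)
  set V : ℝ≥0∞ := ∫⁻ z in Ω, ENNReal.ofReal (max (v z) 0 * (‖Dv z‖ ^ (p - 1) * ‖grad γ ψ z‖))
  set U : ℝ≥0∞ := ∫⁻ z in Ω, ENNReal.ofReal (2 ^ p * (max (v z) 0 ^ p / u z ^ (p - 1)) *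
    (‖Du z‖ ^ (p - 1) * ‖grad γ ψ z‖))
  set V' : ℝ≥0∞ := ∫⁻ z in Ω, ENNReal.ofReal (‖Dv z‖ ^ (p - 1) * ‖grad γ ψ z‖)
  set U' : ℝ≥0∞ := ∫⁻ z in Ω, ENNReal.ofReal (‖Du z‖ ^ (p - 1) * ‖grad γ ψ z‖)
  have hV' : V' ≠ ⊤ := (lintegral_rpow_mul_grad_lt_top hγ hp hv.memLp_grad hψ).ne
  have hU' : U' ≠ ⊤ := (lintegral_rpow_mul_grad_lt_top hγ hp hu.memLp_grad hψ).ne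
  have hgm : AEMeasurable (fun z => ‖grad γ ψ z‖) (volume.restrict Ω) :=
    (continuous_grad hγ (hψ.smooth.of_le (by simp))).norm.aemeasurable
  -- the constant in the bound for the test function contributes a term that vanishes with `ε`
  have hsplit : ∀ (b : Space m n → ℝ) (G : Space m n → GradSpace m n) (c : ℝ), 0 ≤ c →
      (∀ᵐ z ∂volume.restrict Ω, 0 ≤ b z) → AEStronglyMeasurable G (volume.restrict Ω) →
      ∫⁻ z in Ω, ENNReal.ofReal ((b z + c) * (‖G z‖ ^ (p - 1) * ‖grad γ ψ z‖)) =
      (∫⁻ z in Ω, ENNReal.ofReal (b z * (‖G z‖ ^ (p - 1) * ‖grad γ ψ z‖))) +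
        ENNReal.ofReal c * ∫⁻ z in Ω, ENNReal.ofReal (‖G z‖ ^ (p - 1) * ‖grad γ ψ z‖) := by
    intro b G c hc hb hG
    have hm : AEMeasurable (fun z => ENNReal.ofReal (‖G z‖ ^ (p - 1) * ‖grad γ ψ z‖))
      (volume.restrict Ω) := ((hG.norm.aemeasurable.pow_const _).mul hgm).ennreal_ofReal
    rw [← lintegral_const_mul'' _ hm, ← lintegral_add_right' _ (hm.const_mul _)]
    refine lintegral_congr_ae ?_
    filter_upwards [hb] with z hz
    rw [← ENNReal.ofReal_mul hc, ← ENNReal.ofReal_add (by positivity) (by positivity), add_mul]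
  have hle : ∀ j, ∫⁻ z in Ω, ENNReal.ofReal (X j z) ≤
      ENNReal.ofReal (∫ z in Ω, ψ z *
      (f z * |v z| ^ (p - 2) * v z * testFun profileSub (1 / ((j : ℝ) + 1)) (j + 1) (u z, v z) -
        g z * |u z| ^ (p - 2) * u z *
          testFun (profileSuper p) (1 / ((j : ℝ) + 1)) (j + 1) (u z, v z))) +
      (V + ENNReal.ofReal (1 / ((j : ℝ) + 1)) * V') +
      (U + ENNReal.ofReal (2 ^ p * (1 / ((j : ℝ) + 1))) * U') +
      ENNReal.ofReal (∫ z in Ω, (S j).indicator E z) := by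
    intro j
    have hv0 : ∀ᵐ z ∂volume.restrict Ω, 0 ≤ max (v z) 0 := ae_of_all _ fun z => le_max_right _ _
    have hu0 : ∀ᵐ z ∂volume.restrict Ω, 0 ≤ 2 ^ p * (max (v z) 0 ^ p / u z ^ (p - 1)) := by
      filter_upwards [hu_pos] with z hz
      have := le_max_right (v z) 0
      positivity
    rw [← ofReal_integral_eq_lintegral_ofReal (hXi j) (ae_of_all _ (hX0 j))]
    rw [← hsplit _ _ _ (hε j).le hv0 hv.memLp_grad.1,
      ← hsplit _ _ _ (by have := hε j; positivity) hu0 hu.memLp_grad.1]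
    have e1 : ∫ z in Ω, X j z = (∫ z in Ω, J j z) + ∫ z in Ω, (S j).indicator E z :=
      integral_add (hJ j).1 (hSi j)
    rw [e1]
    refine ENNReal.ofReal_add_le.trans (add_le_add ?_ le_rfl)
    refine (ENNReal.ofReal_le_ofReal (hJ j).2).trans (ENNReal.ofReal_add_le.trans
      (add_le_add (ENNReal.ofReal_add_le.trans (add_le_add le_rfl ?_)) ?_))
    · refine ofReal_abs_integral_le hp ?_
      filter_upwards [hu_pos] with z hz
      exact ⟨testFun_nonneg profileSub_nonneg (hε j) _, testFun_profileSub_le (hε j) (hk j) hz⟩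
    · refine ofReal_abs_integral_le hp ?_
      filter_upwards [hu_pos] with z hz
      refine ⟨testFun_nonneg (profileSuper_nonneg p) (hε j) _, ?_⟩
      rw [← mul_add]
      exact testFun_profileSuper_le' hp (hε j) (hk j) hz
  have hlim : Tendsto (fun j : ℕ => ENNReal.ofReal (∫ z in Ω, ψ z *
      (f z * |v z| ^ (p - 2) * v z * testFun profileSub (1 / ((j : ℝ) + 1)) (j + 1) (u z, v z) -
        g z * |u z| ^ (p - 2) * u z *
          testFun (profileSuper p) (1 / ((j : ℝ) + 1)) (j + 1) (u z, v z))) +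
      (V + ENNReal.ofReal (1 / ((j : ℝ) + 1)) * V') +
      (U + ENNReal.ofReal (2 ^ p * (1 / ((j : ℝ) + 1))) * U') +
      ENNReal.ofReal (∫ z in Ω, (S j).indicator E z)) atTop (𝓝 (V + U)) := by
    have l1 := ENNReal.tendsto_ofReal hr
    have l2 := ENNReal.Tendsto.mul_const (b := V') (ENNReal.tendsto_ofReal h0) (Or.inr hV')
    have l3 := ENNReal.Tendsto.mul_const (b := U') (ENNReal.tendsto_ofReal (h0.const_mul (2 ^ p)))
      (Or.inr hU')
    have l4 := ENNReal.tendsto_ofReal hbad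
    rw [ENNReal.ofReal_of_nonpos hr0] at l1
    rw [ENNReal.ofReal_zero, zero_mul] at l2
    rw [mul_zero, ENNReal.ofReal_zero, zero_mul] at l3
    rw [ENNReal.ofReal_zero] at l4
    simpa using ((l1.add (l2.const_add V)).add (l3.const_add U)).add l4
  calc _ ≤ ∫⁻ z in Ω, liminf (fun j => ENNReal.ofReal (X j z)) atTop := by
        refine lintegral_mono_ae ?_
        filter_upwards [hu_pos] with z hz
        rcases le_or_gt (v z) (u z) with h | h
        · rw [stepF_of_le_one ((div_le_one hz).2 h)]
          simp
        · have hq := tendsto_quot (v := v) hz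
          have hc : ContinuousAt (fun t => ψ z * (stepF t * picone p (Dv z) (t • Du z)))
              (v z / u z) := continuousAt_const.mul (stepF_contDiff.continuous.continuousAt.mul
            (continuousAt_picone_smul hp _ _ (div_pos (hz.trans h) hz)))
          have := ENNReal.tendsto_ofReal (hc.tendsto.comp hq)
          rw [← this.liminf_eq]
          refine liminf_le_liminf ?_
          filter_upwards [eventually_shift_le (v z)] with j hj
          exact ENNReal.ofReal_le_ofReal ((hXle j z).resolve_right (not_lt.2 hj))
    _ ≤ liminf (fun j => ∫⁻ z in Ω, ENNReal.ofReal (X j z)) atTop :=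
        lintegral_liminf_le' fun j => (hXi j).1.aemeasurable.ennreal_ofReal
    _ ≤ _ := by
        rw [← hlim.liminf_eq]
        exact liminf_le_liminf (Eventually.of_forall hle)

end Localized

/-! ### Exhaustion of the domain -/

section Exhaustion

variable {m n : ℕ} {γ p : ℝ} {Ω : Set (Space m n)}

lemma measurableSet_homBall (hγ : 0 < γ) (R : ℝ) : MeasurableSet (homBall m n γ R) :=
  (isOpen_homBall hγ R).measurableSet

lemma tendsto_eLpNorm_sdiff_homBall (hγ : 0 < γ) (hΩ : IsOpen Ω) {r : ℝ} (hr : 0 < r)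
    {v : Space m n → ℝ} (hv : MemLp v (ENNReal.ofReal r) (volume.restrict Ω)) :
    Tendsto (fun i : ℕ => eLpNorm v (ENNReal.ofReal r)
      (volume.restrict (Ω \ homBall m n γ (i + 1)))) atTop (𝓝 0) := by
  have hr0 : ENNReal.ofReal r ≠ 0 := by simpa using hr
  have hi := hv.integrable_norm_rpow hr0 (by simp)
  have h1 := tendsto_setIntegral_of_antitone (μ := (volume : Measure (Space m n)))
    (s := fun i : ℕ => Ω \ homBall m n γ (i + 1))
    (f := fun z => ‖v z‖ ^ (ENNReal.ofReal r).toReal)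
    (fun i => hΩ.measurableSet.diff (measurableSet_homBall hγ _))
    (fun i j hij => Set.sdiff_subset_sdiff_right (homBall_mono (by
      have : (i : ℝ) ≤ j := by exact_mod_cast hij
      linarith)))
    ⟨0, hi.mono_measure (Measure.restrict_mono Set.sdiff_subset le_rfl)⟩
  have h2 : (⋂ i : ℕ, Ω \ homBall m n γ (i + 1)) = ∅ := by
    refine Set.eq_empty_of_forall_notMem fun z hz => ?_
    obtain ⟨i, hi⟩ := exists_nat_gt (homNorm γ z)
    have := (Set.mem_iInter.1 hz i).2
    exact this (show homNorm γ z < i + 1 by linarith)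
  rw [h2, setIntegral_empty] at h1
  have h3 := ENNReal.tendsto_ofReal (h1.rpow_const (p := (ENNReal.ofReal r).toReal⁻¹)
    (Or.inr (by positivity)))
  rw [Real.zero_rpow (by rw [ENNReal.toReal_ofReal hr.le]; positivity), ENNReal.ofReal_zero] at h3
  refine h3.congr fun i => ?_
  rw [(hv.mono_measure (Measure.restrict_mono Set.sdiff_subset
    le_rfl)).eLpNorm_eq_integral_rpow_norm hr0 (by simp)]

/-- By Hölder's inequality on the annulus, with `|∇χ_R| ≤ c / R` and `|B_2R|^(1/N_γ) ≤ c R`, this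
integral is at most a constant times the `L^{p*_γ}` norm of `v` outside `B_R`. -/
lemma tendsto_lintegral_mul_grad_cutoff (hγ : 0 < γ) (hp : 1 < p) (hpN : p < homDim m n γ)
    (hΩ : IsOpen Ω) {v : Space m n → ℝ} {Dv : Space m n → GradSpace m n}
    (hv : MemD γ p Ω v Dv) :
    Tendsto (fun i : ℕ => ∫⁻ z in Ω, ENNReal.ofReal (max (v z) 0 *
      (‖Dv z‖ ^ (p - 1) * ‖grad γ (cutoff γ ((i : ℝ) + 1)) z‖))) atTop (𝓝 0) := by
  have hpq := Real.HolderConjugate.conjExponent hp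
  obtain ⟨c, hc0, hc⟩ := exists_norm_grad_cutoff_le (m := m) (n := n) hγ
  obtain ⟨c₁, hc₁, hvol⟩ := exists_volume_homBall_le (m := m) (n := n) hγ
  have hN : 0 < homDim m n γ := by linarith
  have hcrit : 0 < critExp m n γ p := by linarith [le_critExp hp hpN]
  set A : Space m n → GradSpace m n := fun z => ‖Dv z‖ ^ (p - 2) • Dv z with hAdef
  have hA : MemLp A (ENNReal.ofReal p.conjExponent) (volume.restrict Ω) :=
    memLp_rpow_smul hpq hv.memLp_grad
  set K := eLpNorm A (ENNReal.ofReal p.conjExponent) (volume.restrict Ω)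
  have hK : K ≠ ⊤ := hA.2.ne
  have hAn : ∀ z, ‖A z‖ = ‖Dv z‖ ^ (p - 1) := fun z => by
    rw [hAdef, norm_smul, Real.norm_of_nonneg (by positivity),
      rpow_sub_two_mul_self hp (norm_nonneg _)]
  have hexp : 1 / (ENNReal.ofReal p).toReal - 1 / (ENNReal.ofReal (critExp m n γ p)).toReal =
      1 / homDim m n γ := by
    rw [ENNReal.toReal_ofReal (by linarith), ENNReal.toReal_ofReal hcrit.le, critExp]
    have : homDim m n γ - p ≠ 0 := by linarith
    field_simp
    ring
  have hbound : ∀ i : ℕ, ∫⁻ z in Ω, ENNReal.ofReal (max (v z) 0 *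
      (‖Dv z‖ ^ (p - 1) * ‖grad γ (cutoff γ ((i : ℝ) + 1)) z‖)) ≤
      ENNReal.ofReal (2 * c) * c₁ ^ (1 / homDim m n γ) * K *
        eLpNorm v (ENNReal.ofReal (critExp m n γ p))
          (volume.restrict (Ω \ homBall m n γ (i + 1))) := by
    intro i
    set R : ℝ := (i : ℝ) + 1 with hRdef
    have hR : 0 < R := by positivity
    set S := Ω ∩ (homBall m n γ (2 * R) \ homBall m n γ R) with hS
    have hSm : MeasurableSet (homBall m n γ (2 * R) \ homBall m n γ R) :=
      (measurableSet_homBall hγ _).diff (measurableSet_homBall hγ _)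
    have hSΩ : S ⊆ Ω := Set.inter_subset_left
    have hS' : S ⊆ Ω \ homBall m n γ R := fun z hz => ⟨hz.1, hz.2.2⟩
    have := hpq.ennrealOfReal
    have s1 : ∫⁻ z in Ω, ENNReal.ofReal (max (v z) 0 *
        (‖Dv z‖ ^ (p - 1) * ‖grad γ (cutoff γ R) z‖)) ≤
        ENNReal.ofReal (c / R) * ∫⁻ z in S, ‖v z • A z‖ₑ := by
      rw [← lintegral_const_mul' _ _ ENNReal.ofReal_ne_top, hS, Set.inter_comm,
        ← Measure.restrict_restrict hSm, ← lintegral_indicator hSm]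
      refine lintegral_mono fun z => ?_
      by_cases hz : z ∈ homBall m n γ (2 * R) \ homBall m n γ R
      · rw [Set.indicator_of_mem hz, ← ofReal_norm, ← ENNReal.ofReal_mul (by positivity), norm_smul,
          hAn]
        refine ENNReal.ofReal_le_ofReal ?_
        have h1 : max (v z) 0 ≤ ‖v z‖ := max_le (le_abs_self _) (abs_nonneg _)
        calc _ ≤ ‖v z‖ * (‖Dv z‖ ^ (p - 1) * (c / R)) := by
              gcongr
              exact hc R hR z
          _ = _ := by ring
      · rw [grad_cutoff_eq_zero hγ hR hz]; simp
    have s2 : ∫⁻ z in S, ‖v z • A z‖ₑ ≤ eLpNorm v (ENNReal.ofReal p) (volume.restrict S) * K := by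
      rw [← eLpNorm_one_eq_lintegral_enorm]
      have h1 := eLpNorm_smul_le_mul_eLpNorm (p := ENNReal.ofReal p)
        (q := ENNReal.ofReal p.conjExponent) (r := 1)
        (hA.1.mono_measure (Measure.restrict_mono hSΩ le_rfl))
        (hv.memLp.1.mono_measure (Measure.restrict_mono hSΩ le_rfl))
      exact h1.trans (mul_le_mul_right (eLpNorm_mono_measure _ (Measure.restrict_mono hSΩ le_rfl)) _)
    have s3 : eLpNorm v (ENNReal.ofReal p) (volume.restrict S) ≤
        eLpNorm v (ENNReal.ofReal (critExp m n γ p)) (volume.restrict (Ω \ homBall m n γ R)) *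
          (c₁ ^ (1 / homDim m n γ) * ENNReal.ofReal (2 * R)) := by
      have h1 := eLpNorm_le_eLpNorm_mul_rpow_measure_univ
        (ENNReal.ofReal_le_ofReal (le_critExp hp hpN))
        (hv.memLp.1.mono_measure (Measure.restrict_mono hSΩ le_rfl))
      rw [hexp, Measure.restrict_apply_univ] at h1
      refine h1.trans (mul_le_mul' (eLpNorm_mono_measure _ (Measure.restrict_mono hS' le_rfl)) ?_)
      have h2 : volume S ≤ c₁ * ENNReal.ofReal ((2 * R) ^ homDim m n γ) :=
        (measure_mono fun z hz => hz.2.1).trans (hvol (2 * R) (by positivity))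
      refine (ENNReal.rpow_le_rpow h2 (by positivity)).trans (le_of_eq ?_)
      rw [ENNReal.mul_rpow_of_nonneg _ _ (by positivity), ENNReal.ofReal_rpow_of_nonneg
        (by positivity) (by positivity), ← Real.rpow_mul (by positivity),
        mul_one_div_cancel hN.ne', Real.rpow_one]
    refine (s1.trans (mul_le_mul_right (s2.trans (mul_le_mul_left s3 _)) _)).trans (le_of_eq ?_)
    have h4 : ENNReal.ofReal (2 * c) = ENNReal.ofReal (c / R) * ENNReal.ofReal (2 * R) := by
      rw [← ENNReal.ofReal_mul (by positivity)]
      congr 1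
      field_simp
    rw [h4]
    ring
  have ht := ENNReal.Tendsto.const_mul (a := ENNReal.ofReal (2 * c) * c₁ ^ (1 / homDim m n γ) * K)
    (tendsto_eLpNorm_sdiff_homBall hγ hΩ hcrit hv.memLp) (Or.inr (ENNReal.mul_ne_top
      (ENNReal.mul_ne_top ENNReal.ofReal_ne_top (ENNReal.rpow_ne_top_of_nonneg (by positivity) hc₁))
      hK))
  rw [mul_zero] at ht
  exact tendsto_of_tendsto_of_tendsto_of_le_of_le tendsto_const_nhds ht (fun _ => zero_le) hbound

/-- The growth condition controls the cutoff term of the supersolution. -/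
lemma tendsto_lintegral_growth (hγ : 0 < γ)
    {u v : Space m n → ℝ} {Du : Space m n → GradSpace m n}
    (hu_pos : ∀ᵐ z ∂volume.restrict Ω, 0 < u z)
    (h_growth : limsup (fun R : ℝ => ENNReal.ofReal (1 / R) *
      ∫⁻ z in homBall m n γ (2 * R) \ homBall m n γ R,
        ENNReal.ofReal (max (v z) 0 ^ p * (‖Du z‖ / u z) ^ (p - 1))) atTop = 0) :
    Tendsto (fun i : ℕ => ∫⁻ z in Ω, ENNReal.ofReal (2 ^ p * (max (v z) 0 ^ p / u z ^ (p - 1)) *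
      (‖Du z‖ ^ (p - 1) * ‖grad γ (cutoff γ ((i : ℝ) + 1)) z‖))) atTop (𝓝 0) := by
  obtain ⟨c, hc0, hc⟩ := exists_norm_grad_cutoff_le (m := m) (n := n) hγ
  have h1 := tendsto_of_le_liminf_of_limsup_le (zero_le (a := liminf _ _)) h_growth.le
  have h2 : Tendsto (fun i : ℕ => (i : ℝ) + 1) atTop atTop :=
    tendsto_atTop_add_const_right _ _ tendsto_natCast_atTop_atTop
  have h3 := ENNReal.Tendsto.const_mul (a := ENNReal.ofReal (2 ^ p * c)) (h1.comp h2)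
    (Or.inr ENNReal.ofReal_ne_top)
  rw [mul_zero] at h3
  refine tendsto_of_tendsto_of_tendsto_of_le_of_le tendsto_const_nhds h3 (fun _ => zero_le)
    fun i => ?_
  simp only [Function.comp_def]
  set R : ℝ := (i : ℝ) + 1 with hRdef
  have hR : 0 < R := by positivity
  have hSm : MeasurableSet (homBall m n γ (2 * R) \ homBall m n γ R) :=
    (measurableSet_homBall hγ _).diff (measurableSet_homBall hγ _)
  rw [← mul_assoc, ← ENNReal.ofReal_mul (by positivity),
    ← lintegral_const_mul' _ _ ENNReal.ofReal_ne_top, ← lintegral_indicator hSm]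
  refine le_trans (lintegral_mono_ae ?_) (lintegral_mono' Measure.restrict_le_self le_rfl)
  filter_upwards [hu_pos] with z hz
  by_cases hzS : z ∈ homBall m n γ (2 * R) \ homBall m n γ R
  · rw [Set.indicator_of_mem hzS, ← ENNReal.ofReal_mul (by positivity)]
    refine ENNReal.ofReal_le_ofReal ?_
    rw [Real.div_rpow (norm_nonneg _) hz.le]
    have := le_max_right (v z) 0
    calc _ ≤ 2 ^ p * (max (v z) 0 ^ p / u z ^ (p - 1)) * (‖Du z‖ ^ (p - 1) * (c / R)) := by
          gcongr
          exact hc R hR z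
      _ = _ := by ring
  · rw [grad_cutoff_eq_zero hγ hR hzS]; simp

/-- Where `v > u`, the gradients satisfy the equality case of Picone's inequality. -/
lemma grad_eq_smul_of_lt (hγ : 0 < γ) (hp : 1 < p) (hpN : p < homDim m n γ) (hΩ : IsOpen Ω)
    {f g u v : Space m n → ℝ} {Du Dv : Space m n → GradSpace m n}
    (hf : MemLp f (ENNReal.ofReal (homDim m n γ / p)) (volume.restrict Ω))
    (hg : MemLp g (ENNReal.ofReal (homDim m n γ / p)) (volume.restrict Ω))
    (hfg : ∀ᵐ z ∂volume.restrict Ω, f z ≤ g z)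
    (hv : MemD γ p Ω v Dv) (hu : MemD γ p Ω u Du)
    (hu_pos : ∀ᵐ z ∂volume.restrict Ω, 0 < u z)
    (hv_sub : IsWeakSubsolution γ p Ω f v Dv) (hu_super : IsWeakSupersolution γ p Ω g u Du)
    (h_growth : limsup (fun R : ℝ => ENNReal.ofReal (1 / R) *
      ∫⁻ z in homBall m n γ (2 * R) \ homBall m n γ R,
        ENNReal.ofReal (max (v z) 0 ^ p * (‖Du z‖ / u z) ^ (p - 1))) atTop = 0)
    (hvu : LeOnBoundary γ p Ω v u) :
    ∀ᵐ z ∂volume.restrict Ω, u z < v z → Dv z = (v z / u z) • Du z := by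
  set Y : Space m n → ℝ := fun z => stepF (v z / u z) * picone p (Dv z) ((v z / u z) • Du z)
  have hY0 : ∀ z, 0 ≤ Y z := fun z => mul_nonneg (stepF_nonneg _) (picone_nonneg hp _ _)
  have hYm : AEMeasurable Y (volume.restrict Ω) := by
    have ht := hv.memLp.1.aemeasurable.div hu.memLp.1.aemeasurable
    have hc := ht.aestronglyMeasurable.smul hu.memLp_grad.1
    have ha := hv.memLp_grad.1
    exact (stepF_contDiff.continuous.measurable.comp_aemeasurable ht).mul
      (((ha.norm.aemeasurable.pow_const p).sub (((hc.norm.aemeasurable.pow_const (p - 2)).mul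
        (hc.inner ha).aemeasurable).const_mul p)).add
        ((hc.norm.aemeasurable.pow_const p).const_mul (p - 1)))
  have hR : ∀ i : ℕ, (0 : ℝ) < (i : ℝ) + 1 := fun i => by positivity
  have hlim : Tendsto (fun i : ℕ => ∫⁻ z in Ω, ENNReal.ofReal (cutoff γ ((i : ℝ) + 1) z * Y z))
      atTop (𝓝 0) := by
    have h1 := (tendsto_lintegral_mul_grad_cutoff hγ hp hpN hΩ hv).add
      (tendsto_lintegral_growth (Ω := Ω) hγ hu_pos h_growth)
    rw [add_zero] at h1
    exact tendsto_of_tendsto_of_tendsto_of_le_of_le tendsto_const_nhds h1 (fun _ => zero_le)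
      fun i => lintegral_picone_le hγ hp hpN hΩ hf hg hfg hv hu hu_pos hv_sub hu_super hvu
        (isTest_cutoff hγ (hR i)) (cutoff_nonneg _)
  have hzero : ∫⁻ z in Ω, ENNReal.ofReal (Y z) ≤ 0 := by
    rw [← hlim.liminf_eq]
    refine le_trans (lintegral_mono fun z => ?_) (lintegral_liminf_le' fun i =>
      ((cutoff_contDiff _).continuous.aemeasurable.mul hYm).ennreal_ofReal)
    have : Tendsto (fun i : ℕ => ENNReal.ofReal (cutoff γ ((i : ℝ) + 1) z * Y z)) atTop
        (𝓝 (ENNReal.ofReal (Y z))) := by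
      refine tendsto_const_nhds.congr' ?_
      filter_upwards [eventually_ge_atTop ⌈homNorm γ z⌉₊] with i hi
      have hi' : homNorm γ z ≤ i := Nat.ceil_le.1 hi
      rw [cutoff_eq_one hγ (hR i) (show homNorm γ z < i + 1 by linarith), one_mul]
    exact this.liminf_eq.ge
  have hae := (lintegral_eq_zero_iff' hYm.ennreal_ofReal).1 (le_antisymm hzero bot_le)
  filter_upwards [hae, hu_pos] with z hz hzu hlt
  have hYz : Y z = 0 := le_antisymm (ENNReal.ofReal_eq_zero.1 hz) (hY0 z)
  exact eq_of_picone_eq_zero hp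
    ((mul_eq_zero.1 hYz).resolve_left (stepF_pos ((one_lt_div hzu).2 hlt)).ne')

end Exhaustion

/-! ### The logarithmic Caccioppoli estimate -/

section Caccioppoli

variable {m n : ℕ} {γ p : ℝ} {Ω : Set (Space m n)}

lemma fderiv_comp_fst {κ : ℝ → ℝ} (hκ : Differentiable ℝ κ) (s e : ℝ × ℝ) :
    fderiv ℝ (fun s : ℝ × ℝ => κ s.1) s e = deriv κ s.1 * e.1 := by
  have h := (hκ s.1).hasDerivAt.comp_hasFDerivAt s (hasFDerivAt_fst (𝕜 := ℝ) (p := s))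
  rw [show (fun s : ℝ × ℝ => κ s.1) = κ ∘ Prod.fst from rfl, h.fderiv]
  simp

lemma norm_grad_pow_le (hp : 1 < p) {η : Space m n → ℝ} (hη : ContDiff ℝ ∞ η) (h0 : ∀ z, 0 ≤ η z)
    (h1 : ∀ z, η z ≤ 1) {s : ℕ} (hs : p ≤ s) (z : Space m n) :
    ‖grad γ (fun z => η z ^ s) z‖ ≤ (η z ^ s) ^ ((p - 1) / p) * (s * ‖grad γ η z‖) := by
  have hs1 : 1 ≤ s := by
    have : (1 : ℝ) ≤ s := by linarith
    exact_mod_cast this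
  have e : grad γ (fun z => η z ^ s) z = (s * η z ^ (s - 1)) • grad γ η z := by
    have hf : fderiv ℝ (fun z => η z ^ s) z = (s * η z ^ (s - 1)) • fderiv ℝ η z := by
      have := ((hη.differentiable (by simp) z).hasFDerivAt.pow s).fderiv
      simpa using this
    ext k
    rcases k with i | j
    · simp [grad, hf]
    · simp [grad, hf]; ring
  rw [e, norm_smul, norm_mul, Real.norm_of_nonneg (pow_nonneg (h0 z) _), Real.norm_natCast]
  have : η z ^ (s - 1) ≤ (η z ^ s) ^ ((p - 1) / p) := by
    rw [← Real.rpow_natCast, ← Real.rpow_natCast, ← Real.rpow_mul (h0 z)]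
    refine Real.rpow_le_rpow_of_exponent_ge' (h0 z) (h1 z) ?_ ?_
    · have : 0 ≤ p - 1 := by linarith
      positivity
    · rw [Nat.cast_sub hs1, Nat.cast_one, mul_div_assoc', div_le_iff₀ (by linarith)]
      nlinarith
  calc _ = η z ^ (s - 1) * (s * ‖grad γ η z‖) := by ring
    _ ≤ _ := mul_le_mul_of_nonneg_right this (by positivity)

/-- The logarithmic Caccioppoli estimate: `∇ log u ∈ L^p_loc` for positive supersolutions. -/
lemma lintegral_log_grad_lt_top (hγ : 0 < γ) (hp : 1 < p) (hpN : p < homDim m n γ)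
    (hΩ : IsOpen Ω) {g u : Space m n → ℝ} {Du : Space m n → GradSpace m n}
    (hg : MemLp g (ENNReal.ofReal (homDim m n γ / p)) (volume.restrict Ω))
    (hu : MemD γ p Ω u Du) (hu_pos : ∀ᵐ z ∂volume.restrict Ω, 0 < u z)
    (hu_super : IsWeakSupersolution γ p Ω g u Du) {C : Set (Space m n)} (hC : IsCompact C)
    (hCΩ : C ⊆ Ω) :
    ∫⁻ z in C, ENNReal.ofReal ((‖Du z‖ / u z) ^ p) < ⊤ := by
  have hpq := Real.HolderConjugate.conjExponent hp
  have hp0 : 0 < p := by linarith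
  have hAu := memLp_rpow_smul hpq hu.memLp_grad
  obtain ⟨η, hη, hη0, hη1, hηC⟩ := exists_isTest_eq_one hΩ hC hCΩ
  -- the power `s ≥ p` keeps `η ^ s` smooth and gives `|∇ψ| ≤ ψ ^ ((p - 1) / p) * s |∇η|`
  set s := ⌈p⌉₊ with hsdef
  have hs : p ≤ s := Nat.le_ceil p
  have hs0 : s ≠ 0 := by
    have : (0 : ℝ) < s := by linarith
    exact_mod_cast this.ne'
  set ψ : Space m n → ℝ := fun z => η z ^ s with hψdef
  have hψ : IsTest Ω ψ := by
    have hsub : tsupport ψ ⊆ tsupport η :=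
      closure_mono fun z hz h => hz (by simp only [hψdef]; rw [h, zero_pow hs0])
    exact ⟨hη.smooth.pow s, hη.compact.of_isClosed_subset (isClosed_tsupport _) hsub,
      hsub.trans hη.supp⟩
  have hψ0 : ∀ z, 0 ≤ ψ z := fun z => pow_nonneg (hη0 z) s
  have hψ1 : ∀ z, ψ z ≤ 1 := fun z => pow_le_one₀ (hη0 z) (hη1 z)
  have hψC : ∀ z ∈ C, ψ z = 1 := fun z hz => by
    simp only [hψdef]
    rw [(hηC.filter_mono (nhds_le_nhdsSet hz)).self_of_nhds, one_pow]
  have hψm : AEStronglyMeasurable ψ (volume.restrict Ω) :=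
    hψ.smooth.continuous.aestronglyMeasurable
  obtain ⟨P, hP⟩ := exists_bound_deriv_posShift
  have hP0 : 0 ≤ P := (abs_nonneg _).trans (hP 1 one_pos 0)
  have hgi : Integrable (fun z => |g z| * ψ z) (volume.restrict Ω) := by
    have h1 := integrableOn_inter_of_memLp (by simpa using (one_le_div hp0).2 hpN.le) hg
      (C := tsupport ψ) hψ.compact.measure_lt_top
    refine IntegrableOn.of_forall_sdiff_eq_zero (h1.abs.mul_bdd (c := 1)
      hψ.smooth.continuous.aestronglyMeasurable (ae_of_all _ fun z => by
        rw [Real.norm_of_nonneg (hψ0 z)]; exact hψ1 z)) hΩ.measurableSet fun z hz => ?_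
    rw [image_eq_zero_of_notMem_tsupport fun hz' => hz.2 ⟨hz.1, hz'⟩, mul_zero]
  have hyi : Integrable (fun z => ((s : ℝ) * ‖grad γ η z‖) ^ p) (volume.restrict Ω) := by
    have := (integrable_norm_rpow hp
      ((hη.memLp_grad (γ := γ) (r := ENNReal.ofReal p) hγ).restrict Ω)).const_mul ((s : ℝ) ^ p)
    refine this.congr (ae_of_all _ fun z => ?_)
    simp only
    rw [Real.mul_rpow (by positivity) (norm_nonneg _)]
  set K : ℝ := p / (p - 1) ^ 2 * ((∫ z in Ω, ((s : ℝ) * ‖grad γ η z‖) ^ p) / p +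
    ∫ z in Ω, |g z| * ψ z) with hK
  -- the estimate with `u` replaced by `q = posShift ε u`; the test function is `ψ q ^ (1 - p)`
  have main : ∀ ε : ℝ, 0 < ε →
      ∫⁻ z in Ω, ENNReal.ofReal (ψ z * (‖Du z‖ / posShift ε (u z)) ^ p) ≤ ENNReal.ofReal K := by
    intro ε hε
    set κ : ℝ → ℝ := fun a => posShift ε a ^ (1 - p) with hκ
    have hκd : ∀ a, HasDerivAt κ ((1 - p) * posShift ε a ^ (-p) * deriv (posShift ε) a) a :=
      fun a => by
      have := (hasDerivAt_posShift (ε := ε) a).rpow_const (p := 1 - p)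
        (Or.inl (posShift_pos hε a).ne')
      refine this.congr_deriv ?_
      rw [show 1 - p - 1 = -p by ring]; ring
    have hκs : ContDiff ℝ ∞ κ := (posShift_contDiff ε).rpow_const_of_ne
      fun a => (posShift_pos hε a).ne'
    set Φ : ℝ × ℝ → ℝ := fun s => κ s.1 with hΦ
    have hΦs : ContDiff ℝ ∞ Φ := hκs.comp contDiff_fst
    have hΦ0 : ∀ s, 0 ≤ Φ s := fun s => Real.rpow_nonneg (posShift_pos hε _).le _
    have hfd : ∀ s e, fderiv ℝ Φ s e = deriv κ s.1 * e.1 :=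
      fderiv_comp_fst (hκs.differentiable (by simp))
    have hb0 : ∀ (r : ℝ), r ≤ 0 → ∀ a, posShift ε a ^ r ≤ (ε / 2) ^ r := fun r hr a =>
      Real.rpow_le_rpow_of_nonpos (by positivity) (half_le_posShift hε a) hr
    set M := max ((ε / 2) ^ (1 - p)) ((p - 1) * (ε / 2) ^ (-p) * P) with hM
    have hb1 : ∀ s, |Φ s| ≤ M := fun s => by
      rw [abs_of_nonneg (hΦ0 s)]
      exact (hb0 _ (by linarith) _).trans (le_max_left _ _)
    have hb2 : ∀ s, ‖fderiv ℝ Φ s‖ ≤ M := fun s => by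
      refine (norm_le_abs_add_abs _).trans ?_
      rw [hfd, hfd, (hκd _).deriv]
      simp only [mul_one, mul_zero, abs_zero, add_zero]
      refine le_trans ?_ (le_max_right _ _)
      have hq := Real.rpow_nonneg (posShift_pos hε s.1).le (-p)
      rw [abs_mul, abs_mul, abs_of_nonneg hq, abs_of_neg (by linarith : 1 - p < 0), neg_sub]
      have : 0 ≤ p - 1 := by linarith
      exact mul_le_mul (mul_le_mul_of_nonneg_left (hb0 _ (by linarith) _) this) (hP ε hε _)
        (abs_nonneg _) (by positivity)
    have I := integral_inner_chainGrad_le hγ hpq hΩ (hu.locMemW hp hpN) (hu.locMemW hp hpN)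
      hΦs hb1 hb2 hΦ0
      (fun C _ hC => hAu.neg.mono_measure (Measure.restrict_mono hC le_rfl))
      (fun C hC hCΩ => by
        have := (integrableOn_reaction hp hpN hg hu.memLp hC.measure_lt_top).neg
        rwa [Set.inter_eq_right.2 hCΩ] at this)
      (fun φ hφ hφ0 => by
        simpa only [Pi.neg_apply, inner_neg_left, real_inner_smul_left, neg_mul, integral_neg,
          neg_le_neg_iff] using hu_super φ hφ hφ0) hψ hψ0
    set q : Space m n → ℝ := fun z => posShift ε (u z) with hq
    have hq0 : ∀ z, 0 < q z := fun z => posShift_pos hε _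
    set X : Space m n → ℝ := fun z => ψ z * (‖Du z‖ / q z) ^ p with hX
    have hX0 : ∀ z, 0 ≤ X z := fun z =>
      mul_nonneg (hψ0 z) (Real.rpow_nonneg (div_nonneg (norm_nonneg _) (hq0 z).le) _)
    have hqm : AEStronglyMeasurable q (volume.restrict Ω) :=
      (posShift_contDiff ε).continuous.comp_aestronglyMeasurable hu.memLp.1
    have hXi : Integrable X (volume.restrict Ω) := by
      have h1 := (integrable_norm_rpow hp hu.memLp_grad).bdd_mul (c := (ε / 2) ^ (-p))
        (f := fun z => ψ z * q z ^ (-p))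
        (hψm.mul (hqm.aemeasurable.pow_const _).aestronglyMeasurable) (ae_of_all _ fun z => by
          have h0 := Real.rpow_nonneg (hq0 z).le (-p)
          rw [Real.norm_of_nonneg (mul_nonneg (hψ0 z) h0)]
          exact (mul_le_of_le_one_left h0 (hψ1 z)).trans (hb0 _ (by linarith) _))
      refine h1.congr (ae_of_all _ fun z => ?_)
      simp only [hX]
      rw [Real.div_rpow (norm_nonneg _) (hq0 z).le, Real.rpow_neg (hq0 z).le]
      ring
    set T : Space m n → ℝ := fun z => κ (u z) * (‖Du z‖ ^ (p - 2) * inner ℝ (Du z) (grad γ ψ z))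
      with hT
    have hTi : Integrable T (volume.restrict Ω) := by
      have h1 := (integrable_inner_of_memLp hpq hAu ((hψ.memLp_grad (γ := γ) hγ).restrict Ω)).bdd_mul
        (f := fun z => κ (u z)) (hκs.continuous.comp_aestronglyMeasurable hu.memLp.1)
        (ae_of_all _ fun z => hb1 (u z, 0))
      simpa only [real_inner_smul_left] using h1
    have hXp : ∀ z, X z = ψ z * posShift ε (u z) ^ (-p) * ‖Du z‖ ^ p := fun z => by
      simp only [hX]
      rw [Real.div_rpow (norm_nonneg _) (hq0 z).le, Real.rpow_neg (hq0 z).le]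
      ring
    have hlhs : ∫ z in Ω, inner ℝ ((-fun z => ‖Du z‖ ^ (p - 2) • Du z) z)
        (Φ (u z, u z) • grad γ ψ z + ψ z • chainGrad Φ u u Du Du z) =
        (p - 1) * (∫ z in Ω, X z) - ∫ z in Ω, T z := by
      rw [← integral_const_mul, ← integral_sub (hXi.const_mul _) hTi]
      refine integral_congr_ae ?_
      filter_upwards [hu_pos] with z hz
      simp only [chainGrad, hfd, mul_one, mul_zero, zero_smul, add_zero]
      rw [(hκd _).deriv, deriv_posShift_of_nonneg hε hz.le, hXp,
        ← rpow_sub_two_mul_sq hp (norm_nonneg (Du z))]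
      simp only [Pi.neg_apply, hT, hΦ, inner_neg_left, inner_add_right, real_inner_smul_left,
        real_inner_smul_right, real_inner_self_eq_norm_sq]
      ring
    have hrhs : ∫ z in Ω, (-fun z => g z * |u z| ^ (p - 2) * u z) z * (ψ z * Φ (u z, u z)) ≤
        ∫ z in Ω, |g z| * ψ z := by
      refine (Real.le_norm_self _).trans (norm_integral_le_of_norm_le hgi ?_)
      filter_upwards [hu_pos] with z hz
      have h1 : u z ^ (p - 1) * q z ^ (1 - p) ≤ 1 := by
        rw [show 1 - p = -(p - 1) by ring, Real.rpow_neg (hq0 z).le, ← div_eq_mul_inv,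
          div_le_one (Real.rpow_pos_of_pos (hq0 z) _)]
        exact Real.rpow_le_rpow hz.le (by linarith [le_posShift hε (u z)]) (by linarith)
      have h2 := Real.rpow_nonneg (hq0 z).le (1 - p)
      rw [Pi.neg_apply, abs_of_pos hz, mul_assoc (g z), rpow_sub_two_mul_self hp hz.le, norm_mul,
        norm_neg, norm_mul, norm_mul, Real.norm_of_nonneg (hψ0 z), Real.norm_of_nonneg (hΦ0 _),
        Real.norm_of_nonneg (by positivity : 0 ≤ u z ^ (p - 1)), Real.norm_eq_abs]
      calc _ = |g z| * ψ z * (u z ^ (p - 1) * q z ^ (1 - p)) := by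
            simp only [hΦ, hκ, hq]; ring
        _ ≤ _ := mul_le_of_le_one_right (mul_nonneg (abs_nonneg _) (hψ0 z)) h1
    -- Young's inequality absorbs the term with `∇ψ` into the left-hand side
    have hTle : ∫ z in Ω, T z ≤ (p - 1) / p * (∫ z in Ω, X z) +
        (∫ z in Ω, ((s : ℝ) * ‖grad γ η z‖) ^ p) / p := by
      rw [← integral_const_mul, ← integral_div, ← integral_add (hXi.const_mul _) (hyi.div_const p)]
      refine integral_mono hTi ((hXi.const_mul _).add (hyi.div_const p)) fun z => ?_
      set x := ψ z ^ (1 / p) * (‖Du z‖ / q z) with hx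
      have hdq : 0 ≤ ‖Du z‖ / q z := div_nonneg (norm_nonneg _) (hq0 z).le
      have hψp := Real.rpow_nonneg (hψ0 z) (1 / p)
      have hxp : x ^ p = X z := by
        rw [hx, Real.mul_rpow hψp hdq, ← Real.rpow_mul (hψ0 z), one_div_mul_cancel hp0.ne',
          Real.rpow_one]
      have hxp1 : x ^ (p - 1) = ψ z ^ ((p - 1) / p) * (κ (u z) * ‖Du z‖ ^ (p - 1)) := by
        rw [hx, Real.mul_rpow hψp hdq, ← Real.rpow_mul (hψ0 z), one_div_mul_eq_div,
          Real.div_rpow (norm_nonneg _) (hq0 z).le]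
        simp only [hκ]
        rw [show 1 - p = -(p - 1) by ring, Real.rpow_neg (posShift_pos hε _).le]
        ring
      have hy := young_rpow hp (x := x) (y := s * ‖grad γ η z‖) (mul_nonneg hψp hdq) (by positivity)
      have hκ0 : 0 ≤ κ (u z) := hΦ0 (u z, 0)
      have h1 : T z ≤ x ^ (p - 1) * (s * ‖grad γ η z‖) := by
        calc T z ≤ κ (u z) * (‖Du z‖ ^ (p - 1) * ‖grad γ ψ z‖) :=
              mul_le_mul_of_nonneg_left ((le_abs_self _).trans (abs_rpow_mul_inner_le hp _ _)) hκ0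
          _ ≤ κ (u z) * (‖Du z‖ ^ (p - 1) *
              ((η z ^ s) ^ ((p - 1) / p) * (s * ‖grad γ η z‖))) := by
            gcongr
            exact norm_grad_pow_le hp hη.smooth hη0 hη1 hs z
          _ = _ := by rw [hxp1]; ring
      rw [hxp] at hy
      refine h1.trans ?_
      rw [div_mul_eq_mul_div, ← add_div, le_div_iff₀ hp0]
      linarith
    rw [hlhs] at I
    have hI := I.trans hrhs
    have hle : ∫ z in Ω, X z ≤ K := by
      have hp1 : 0 < p - 1 := by linarith
      rw [hK, div_mul_eq_mul_div, le_div_iff₀ (by positivity)]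
      have h2 := mul_le_mul_of_nonneg_left (hI.trans' (sub_le_sub_left hTle _)) hp0.le
      generalize (∫ z in Ω, X z) = a at h2 ⊢
      generalize (∫ z in Ω, ((s : ℝ) * ‖grad γ η z‖) ^ p) = b at h2 ⊢
      have e1 : p * ((p - 1) * a - ((p - 1) / p * a + b / p)) = (p - 1) ^ 2 * a - b := by
        field_simp
        ring
      have e2 : ∀ c, p * (b / p + c) = b + p * c := fun c => by field_simp
      rw [e2]
      linarith
    rw [← ofReal_integral_eq_lintegral_ofReal hXi (ae_of_all _ hX0)]
    exact ENNReal.ofReal_le_ofReal hle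
  have hmeas : ∀ j : ℕ, AEMeasurable (fun z => ENNReal.ofReal
      (ψ z * (‖Du z‖ / posShift (1 / ((j : ℝ) + 1)) (u z)) ^ p)) (volume.restrict Ω) := fun j =>
    (hψm.aemeasurable.mul ((hu.memLp_grad.1.norm.aemeasurable.div
      ((posShift_contDiff _).continuous.comp_aestronglyMeasurable
        hu.memLp.1).aemeasurable).pow_const p)).ennreal_ofReal
  refine lt_of_le_of_lt ?_ (ENNReal.ofReal_lt_top (r := K))
  calc _ ≤ ∫⁻ z in Ω, liminf (fun j : ℕ => ENNReal.ofReal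
        (ψ z * (‖Du z‖ / posShift (1 / ((j : ℝ) + 1)) (u z)) ^ p)) atTop := by
        refine le_trans (lintegral_mono_ae ?_) (lintegral_mono_set hCΩ)
        filter_upwards [ae_mono (Measure.restrict_mono hCΩ le_rfl) hu_pos,
          ae_restrict_mem hC.measurableSet] with z hz hzC
        have h0 := (tendsto_one_div_add_atTop_nhds_zero_nat (𝕜 := ℝ)).const_add (u z)
        rw [add_zero] at h0
        have h1 := ((Tendsto.div (tendsto_const_nhds (x := ‖Du z‖)) h0
          hz.ne').rpow_const (p := p) (Or.inr hp0.le))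
        have h2 := ENNReal.tendsto_ofReal h1
        refine (h2.congr fun j => ?_).liminf_eq.ge
        rw [hψC z hzC, one_mul, posShift_of_nonneg (by positivity) hz.le]
        rfl
    _ ≤ liminf (fun j : ℕ => ∫⁻ z in Ω, ENNReal.ofReal
        (ψ z * (‖Du z‖ / posShift (1 / ((j : ℝ) + 1)) (u z)) ^ p)) atTop :=
        lintegral_liminf_le' hmeas
    _ ≤ liminf (fun _ : ℕ => ENNReal.ofReal K) atTop :=
        liminf_le_liminf (Eventually.of_forall fun j => main _ (by positivity))
    _ = _ := tendsto_const_nhds.liminf_eq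

end Caccioppoli

/-! ### The weak gradient of the quotient -/

section Quotient

variable {m n : ℕ} {γ p : ℝ} {Ω : Set (Space m n)}

/-- The regularization `F((b + ε) / posShift ε a)` of `F(b / a)`. -/
noncomputable def stepQuot (ε : ℝ) (s : ℝ × ℝ) : ℝ := stepF ((s.2 + ε) / posShift ε s.1)

lemma stepQuot_contDiff {ε : ℝ} (hε : 0 < ε) : ContDiff ℝ ∞ (stepQuot ε) :=
  stepF_contDiff.comp ((contDiff_snd.add contDiff_const).div
    ((posShift_contDiff ε).comp contDiff_fst) fun s => (posShift_pos hε s.1).ne')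

lemma fderiv_stepQuot_fst {ε : ℝ} (hε : 0 < ε) (a b : ℝ) :
    fderiv ℝ (stepQuot ε) (a, b) (1, 0) = -(deriv stepF ((b + ε) / posShift ε a) *
      ((b + ε) / posShift ε a) * deriv (posShift ε) a / posShift ε a) := by
  refine fderiv_apply_one_zero ((stepQuot_contDiff hε).differentiable (by simp)) ?_
  have hq := posShift_pos hε a
  have h := (hasDerivAt_stepF ((b + ε) / posShift ε a)).comp a
    ((hasDerivAt_const a (b + ε)).div (hasDerivAt_posShift (ε := ε) a) hq.ne')
  refine HasDerivAt.congr_deriv h ?_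
  field_simp
  ring

lemma fderiv_stepQuot_snd {ε : ℝ} (hε : 0 < ε) (a b : ℝ) :
    fderiv ℝ (stepQuot ε) (a, b) (0, 1) =
      deriv stepF ((b + ε) / posShift ε a) / posShift ε a := by
  refine fderiv_apply_zero_one ((stepQuot_contDiff hε).differentiable (by simp)) ?_
  have h := (hasDerivAt_stepF ((b + ε) / posShift ε a)).comp b
    (((hasDerivAt_id b).add_const ε).div_const (posShift ε a))
  refine HasDerivAt.congr_deriv h ?_
  ring

lemma abs_deriv_stepF_mul_le {M : ℝ} (hM : ∀ t, |deriv stepF t| ≤ M) (t : ℝ) :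
    |deriv stepF t * t| ≤ M * 2 := by
  have hM0 : 0 ≤ M := (abs_nonneg _).trans (hM 0)
  rcases le_or_gt t 1 with h | h
  · rw [deriv_stepF_of_le_one h]; simpa using hM0
  · rcases le_or_gt t 2 with h' | h'
    · rw [abs_mul, abs_of_pos (by linarith : 0 < t)]
      exact mul_le_mul (hM t) h' (by linarith) hM0
    · rw [deriv_stepF_of_two_lt h']; simpa using hM0

lemma exists_bound_fderiv_stepQuot {ε : ℝ} (hε : 0 < ε) :
    ∃ M, ∀ s, ‖fderiv ℝ (stepQuot ε) s‖ ≤ M := by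
  obtain ⟨M, hM⟩ := exists_bound_deriv_stepF
  obtain ⟨P, hP⟩ := exists_bound_deriv_posShift
  have hM0 : 0 ≤ M := (abs_nonneg _).trans (hM 0)
  refine ⟨M * 2 * P / (ε / 2) + M / (ε / 2), fun s => (norm_le_abs_add_abs _).trans ?_⟩
  obtain ⟨a, b⟩ := s
  have hq := half_le_posShift hε a
  rw [fderiv_stepQuot_fst hε, fderiv_stepQuot_snd hε, abs_neg, abs_div, abs_div, abs_mul,
    abs_of_pos (posShift_pos hε a)]
  have h1 := abs_deriv_stepF_mul_le hM ((b + ε) / posShift ε a)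
  have h2 := hP ε hε a
  have hP0 : 0 ≤ P := (abs_nonneg _).trans h2
  gcongr
  exact hM _

/-- Where `∇ v = (v / u) ∇ u` on `{v > u}`, the gradient of the regularization tends to `0`. -/
lemma norm_chainGrad_stepQuot_le {M : ℝ} (hM : ∀ t, |deriv stepF t| ≤ M) {ε : ℝ} (hε : 0 < ε)
    {u v : Space m n → ℝ} {Du Dv : Space m n → GradSpace m n} {z : Space m n} (hu : 0 < u z)
    (h : u z < v z → Dv z = (v z / u z) • Du z) :
    ‖chainGrad (stepQuot ε) u v Du Dv z‖ ≤ ε / (u z + ε) * (M * (‖Du z‖ / u z)) := by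
  have hM0 : 0 ≤ M := (abs_nonneg _).trans (hM 0)
  have hq : 0 < u z + ε := by linarith
  set t := (v z + ε) / (u z + ε) with ht
  simp only [chainGrad]
  rw [fderiv_stepQuot_fst hε, fderiv_stepQuot_snd hε, deriv_posShift_of_nonneg hε hu.le,
    posShift_of_nonneg hε hu.le, mul_one, ← ht]
  have hR : 0 ≤ ε / (u z + ε) * (M * (‖Du z‖ / u z)) := by positivity
  rcases le_or_gt t 1 with h1 | h1
  · rw [deriv_stepF_of_le_one h1]; simpa using hR
  rcases le_or_gt t 2 with h2 | h2
  swap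
  · rw [deriv_stepF_of_two_lt h2]; simpa using hR
  have hlt : u z < v z := by
    rw [ht, one_lt_div hq] at h1; linarith
  have e : -(deriv stepF t * t / (u z + ε)) • Du z + (deriv stepF t / (u z + ε)) • Dv z =
      (deriv stepF t * ((t - 1) * (ε / (u z + ε) / u z))) • Du z := by
    rw [h hlt, smul_smul, ← add_smul]
    congr 1
    rw [ht]
    field_simp
    ring
  rw [e, norm_smul, norm_mul, norm_mul, Real.norm_of_nonneg (by linarith : 0 ≤ t - 1),
    Real.norm_of_nonneg (by positivity : 0 ≤ ε / (u z + ε) / u z), Real.norm_eq_abs]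
  calc _ ≤ M * (1 * (ε / (u z + ε) / u z)) * ‖Du z‖ := by
        gcongr
        · exact hM t
        · linarith
    _ = _ := by ring

/-- The function `F(v / u)` has vanishing weak gradient. -/
lemma integral_stepF_mul_grad_eq_zero (hγ : 0 < γ) (hp : 1 < p) (hΩ : IsOpen Ω)
    {u v : Space m n → ℝ} {Du Dv : Space m n → GradSpace m n}
    (hu : LocMemW γ p Ω u Du) (hv : LocMemW γ p Ω v Dv)
    (hu_pos : ∀ᵐ z ∂volume.restrict Ω, 0 < u z)
    (hlog : ∀ C, IsCompact C → C ⊆ Ω → ∫⁻ z in C, ENNReal.ofReal ((‖Du z‖ / u z) ^ p) < ⊤)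
    (hD : ∀ᵐ z ∂volume.restrict Ω, u z < v z → Dv z = (v z / u z) • Du z)
    {φ : Space m n → ℝ} (hφ : IsTest Ω φ) (k : Fin m ⊕ Fin n) :
    ∫ z in Ω, stepF (v z / u z) * grad γ φ z k = 0 := by
  obtain ⟨M, hM⟩ := exists_bound_deriv_stepF
  have hM0 : 0 ≤ M := (abs_nonneg _).trans (hM 0)
  have hε : ∀ j : ℕ, 0 < 1 / ((j : ℝ) + 1) := fun j => by positivity
  have h0 := tendsto_one_div_add_atTop_nhds_zero_nat (𝕜 := ℝ)
  set C := tsupport φ with hCdef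
  have hC : IsCompact C := hφ.compact
  have hCΩ : C ⊆ Ω := hφ.supp
  have hrestr : ∀ F : Space m n → ℝ, (∀ z ∉ C, F z = 0) → ∫ z in Ω, F z = ∫ z in C, F z :=
    fun F hF => setIntegral_eq_of_subset_of_forall_sdiff_eq_zero hΩ.measurableSet hCΩ
      fun z hz => hF z hz.2
  have hφz : ∀ z ∉ C, φ z = 0 := fun z hz => image_eq_zero_of_notMem_tsupport hz
  have hgz : ∀ z ∉ C, grad γ φ z = 0 := fun z hz => grad_eq_zero_of_notMem_tsupport hz
  have hgc : Continuous fun z => grad γ φ z k := (EuclideanSpace.proj (𝕜 := ℝ) k).continuous.comp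
    (continuous_grad hγ (hφ.smooth.of_le (by simp)))
  have hum := (hu.memLp C hC hCΩ).1
  have hvm := (hv.memLp C hC hCΩ).1
  have hDum := (hu.memLp_grad C hC hCΩ).1
  have hDvm := (hv.memLp_grad C hC hCΩ).1
  have huC := ae_mono (Measure.restrict_mono hCΩ le_rfl) hu_pos
  have hDC := ae_mono (Measure.restrict_mono hCΩ le_rfl) hD
  have hfin : IsFiniteMeasure (volume.restrict C) := ⟨by simpa using hC.measure_lt_top⟩
  have hint : Integrable (fun z => ‖Du z‖ / u z) (volume.restrict C) := by
    have hm : AEMeasurable (fun z => ‖Du z‖ / u z) (volume.restrict C) :=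
      hDum.norm.aemeasurable.div hum.aemeasurable
    have h1 : Integrable (fun z => (‖Du z‖ / u z) ^ p) (volume.restrict C) := by
      refine (lintegral_ofReal_ne_top_iff_integrable (hm.pow_const _).aestronglyMeasurable ?_).1
        (hlog C hC hCΩ).ne
      filter_upwards [huC] with z hz
      exact Real.rpow_nonneg (div_nonneg (norm_nonneg _) hz.le) _
    refine ((integrable_const (1 : ℝ)).add h1).mono' hm.aestronglyMeasurable ?_
    filter_upwards [huC] with z hz
    have hx : 0 ≤ ‖Du z‖ / u z := div_nonneg (norm_nonneg _) hz.le
    rw [Real.norm_of_nonneg hx, Pi.add_apply]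
    have hxp : 0 ≤ (‖Du z‖ / u z) ^ p := by positivity
    rcases le_total (‖Du z‖ / u z) 1 with h | h
    · linarith
    · have := Real.rpow_le_rpow_of_exponent_le h hp.le
      rw [Real.rpow_one] at this
      linarith
  obtain ⟨B, hB⟩ := hC.exists_bound_of_continuousOn hgc.continuousOn
  obtain ⟨B', hB'⟩ := hC.exists_bound_of_continuousOn hφ.smooth.continuous.continuousOn
  have hcm : ∀ j : ℕ, AEStronglyMeasurable (chainGrad (stepQuot (1 / ((j : ℝ) + 1))) u v Du Dv)
      (volume.restrict C) := fun j => by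
    have hcD : ∀ e : ℝ × ℝ, AEStronglyMeasurable
        (fun z => fderiv ℝ (stepQuot (1 / ((j : ℝ) + 1))) (u z, v z) e) (volume.restrict C) :=
      fun e => (((stepQuot_contDiff (hε j)).continuous_fderiv (by simp)).clm_apply
        continuous_const).comp_aestronglyMeasurable (hum.prodMk hvm)
    exact ((hcD _).smul hDum).add ((hcD _).smul hDvm)
  have t1 : Tendsto (fun j : ℕ => ∫ z in C, stepQuot (1 / ((j : ℝ) + 1)) (u z, v z) *
      grad γ φ z k) atTop (𝓝 (∫ z in C, stepF (v z / u z) * grad γ φ z k)) := by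
    refine tendsto_integral_of_dominated_convergence (fun _ => 1 * B) (fun j => ?_)
      (integrable_const _) (fun j => ?_) ?_
    · exact ((stepQuot_contDiff (hε j)).continuous.comp_aestronglyMeasurable
        (hum.prodMk hvm)).mul hgc.aestronglyMeasurable
    · refine (ae_restrict_iff' hC.measurableSet).2 (ae_of_all _ fun z hz => ?_)
      rw [norm_mul]
      refine mul_le_mul ?_ (hB z hz) (norm_nonneg _) zero_le_one
      rw [stepQuot, Real.norm_of_nonneg (stepF_nonneg _)]
      exact stepF_le_one _
    · filter_upwards [huC] with z hz
      refine Tendsto.mul_const _ ((stepF_contDiff.continuous.tendsto _).comp ?_)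
      have h : Tendsto (fun j : ℕ => (v z + 1 / ((j : ℝ) + 1)) / (u z + 1 / ((j : ℝ) + 1))) atTop
          (𝓝 ((v z + 0) / (u z + 0))) :=
        (h0.const_add _).div (h0.const_add _) (by simpa using hz.ne')
      rw [add_zero, add_zero] at h
      refine h.congr fun j => ?_
      rw [posShift_of_nonneg (hε j) hz.le]
  have t2 : Tendsto (fun j : ℕ => ∫ z in C, chainGrad (stepQuot (1 / ((j : ℝ) + 1))) u v Du Dv z k *
      φ z) atTop (𝓝 (∫ z in C, (0 : ℝ))) := by
    -- the gradient of the regularized quotient is at most `ε / (u + ε) * M |∇ log u|`, which tends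
    -- to zero and is dominated by `M |∇ log u|`
    have hb : ∀ j : ℕ, ∀ᵐ z ∂volume.restrict C,
        ‖chainGrad (stepQuot (1 / ((j : ℝ) + 1))) u v Du Dv z k * φ z‖ ≤
        (1 / ((j : ℝ) + 1)) / (u z + 1 / ((j : ℝ) + 1)) * (M * (‖Du z‖ / u z)) * B' := by
      intro j
      filter_upwards [huC, hDC, ae_restrict_mem hC.measurableSet] with z hz hz' hzC
      rw [norm_mul]
      exact mul_le_mul ((PiLp.norm_apply_le _ k).trans
        (norm_chainGrad_stepQuot_le hM (hε j) hz hz')) (hB' z hzC) (norm_nonneg _)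
        (by have := hε j; positivity)
    refine tendsto_integral_of_dominated_convergence (fun z => M * (‖Du z‖ / u z) * B')
      (fun j => ?_) ((hint.const_mul M).mul_const B') (fun j => ?_) ?_
    · exact ((EuclideanSpace.proj (𝕜 := ℝ) k).continuous.comp_aestronglyMeasurable (hcm j)).mul
        hφ.smooth.continuous.aestronglyMeasurable
    · filter_upwards [hb j, huC, ae_restrict_mem hC.measurableSet] with z hz hzu hzC
      refine hz.trans ?_
      have hB0 : 0 ≤ B' := (norm_nonneg _).trans (hB' z hzC)
      refine mul_le_mul_of_nonneg_right (mul_le_of_le_one_left (by positivity) ?_) hB0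
      rw [div_le_one (by have := hε j; linarith)]
      linarith
    · filter_upwards [ae_all_iff.2 hb, huC] with z hz hzu
      have h1 : Tendsto (fun j : ℕ => (1 / ((j : ℝ) + 1)) / (u z + 1 / ((j : ℝ) + 1)) *
          (M * (‖Du z‖ / u z)) * B') atTop (𝓝 (0 / (u z + 0) * (M * (‖Du z‖ / u z)) * B')) :=
        ((h0.div (h0.const_add _) (by simpa using hzu.ne')).mul_const _).mul_const _
      rw [zero_div, zero_mul, zero_mul] at h1
      exact squeeze_zero_norm hz h1
  rw [integral_zero] at t2
  rw [hrestr _ fun z hz => by rw [hgz z hz]; simp]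
  refine tendsto_nhds_unique t1 ?_
  have t3 := t2.neg
  rw [neg_zero] at t3
  refine t3.congr fun j => ?_
  obtain ⟨K, hK⟩ := exists_bound_fderiv_stepQuot (hε j)
  have := integral_comp_mul_grad hγ hp hΩ hu hv ((stepQuot_contDiff (hε j)).of_le (by simp))
    (M := max 1 K) (fun s => by
      rw [stepQuot, abs_of_nonneg (stepF_nonneg _)]
      exact (stepF_le_one _).trans (le_max_left _ _))
    (fun s => (hK s).trans (le_max_right _ _)) hφ k
  rw [hrestr _ fun z hz => by rw [hgz z hz]; simp,
    hrestr _ fun z hz => by rw [hφz z hz]; simp] at this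
  exact this.symm

end Quotient

/-! ### Functions with vanishing weak Grushin gradient -/

section ZeroGradient

variable {m n : ℕ} {γ : ℝ} {Ω : Set (Space m n)}

lemma fderiv_convolution_mul {W κ : Space m n → ℝ} (hW : LocallyIntegrable W)
    (hκ : ContDiff ℝ ∞ κ) (hκc : HasCompactSupport κ) (x e : Space m n) :
    fderiv ℝ (convolution W κ (ContinuousLinearMap.mul ℝ ℝ) volume) x e =
      ∫ t, W t * fderiv ℝ κ (x - t) e := by
  have hκ1 : ContDiff ℝ 1 κ := hκ.of_le (by simp)
  rw [(hκc.hasFDerivAt_convolution_right (ContinuousLinearMap.mul ℝ ℝ) hW hκ1 x).fderiv,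
    convolution_precompR_apply _ hW (hκc.fderiv (𝕜 := ℝ)) (hκ1.continuous_fderiv (by simp))]
  rfl

/-- Away from `{x = 0}` the weight can be absorbed into the test function. -/
lemma exists_isTest_grad_inr_eq {φ : Space m n → ℝ} (hφ : IsTest Ω φ)
    (h0 : ∀ z ∈ tsupport φ, z.1 ≠ 0) :
    ∃ φ' : Space m n → ℝ, IsTest Ω φ' ∧ ∀ z (j : Fin n),
      grad γ φ' z (Sum.inr j) = fderiv ℝ φ z (0, EuclideanSpace.single j 1) := by
  set φ' : Space m n → ℝ := fun z => φ z * (‖z.1‖ ^ γ)⁻¹ with hφ'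
  have hsub : tsupport φ' ⊆ tsupport φ :=
    closure_mono fun z hz h => hz (by simp only [hφ']; rw [h, zero_mul])
  have hs : ContDiff ℝ ∞ φ' := by
    rw [contDiff_iff_contDiffAt]
    intro z
    by_cases hz : z ∈ tsupport φ
    · have hz0 := h0 z hz
      have hn : 0 < ‖z.1‖ := norm_pos_iff.2 hz0
      have h1 : ContDiffAt ℝ ∞ (fun z : Space m n => ‖z.1‖) z :=
        (contDiffAt_norm ℝ hz0).comp z contDiff_fst.contDiffAt
      exact hφ.smooth.contDiffAt.mul ((h1.rpow_const_of_ne hn.ne').inv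
        (Real.rpow_pos_of_pos hn _).ne')
    · have : φ' =ᶠ[𝓝 z] fun _ => 0 := by
        filter_upwards [(isClosed_tsupport φ).isOpen_compl.mem_nhds hz] with y hy
        simp only [hφ']
        rw [image_eq_zero_of_notMem_tsupport hy, zero_mul]
      exact contDiffAt_const.congr_of_eventuallyEq this
  refine ⟨φ', ⟨hs, hφ.compact.of_isClosed_subset (isClosed_tsupport _) hsub, hsub.trans hφ.supp⟩,
    fun z j => ?_⟩
  set e : Space m n := (0, EuclideanSpace.single j 1) with he
  change ‖z.1‖ ^ γ * fderiv ℝ φ' z e = fderiv ℝ φ z e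
  by_cases hz : z ∈ tsupport φ
  · have hn : 0 < ‖z.1‖ ^ γ := Real.rpow_pos_of_pos (norm_pos_iff.2 (h0 z hz)) _
    have d1 := (hs.differentiable (by simp) z).hasFDerivAt.hasLineDerivAt e
    have d2 := ((hφ.smooth.differentiable (by simp) z).hasFDerivAt.hasLineDerivAt e)
    have d3 : HasDerivAt (fun s : ℝ => φ (z + s • e) * (‖z.1‖ ^ γ)⁻¹)
      (fderiv ℝ φ z e * (‖z.1‖ ^ γ)⁻¹) 0 := HasDerivAt.mul_const d2 _
    have d4 : HasDerivAt (fun s : ℝ => φ (z + s • e) * (‖z.1‖ ^ γ)⁻¹) (fderiv ℝ φ' z e) 0 := by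
      refine HasDerivAt.congr_of_eventuallyEq d1 (Eventually.of_forall fun s => ?_)
      simp [hφ', he]
    rw [d4.unique d3]
    field_simp
  · have h1 : z ∉ tsupport φ' := fun h => hz (hsub h)
    have e1 : fderiv ℝ φ z = 0 := by
      by_contra h
      exact hz (support_fderiv_subset ℝ h)
    have e2 : fderiv ℝ φ' z = 0 := by
      by_contra h
      exact h1 (support_fderiv_subset ℝ h)
    rw [e1, e2]; simp

lemma fderiv_convolution_eq_zero {w : Space m n → ℝ} (hΩ : IsOpen Ω)
    (hW : LocallyIntegrable (Ω.indicator w))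
    (hw : ∀ φ, IsTest Ω φ → ∀ k, ∫ z in Ω, w z * grad γ φ z k = 0)
    {κ : Space m n → ℝ} (hκ : ContDiff ℝ ∞ κ) {δ : ℝ}
    (hκs : tsupport κ ⊆ Metric.closedBall 0 δ) {x : Space m n}
    (hx : Metric.closedBall x δ ⊆ Ω) :
    (∀ i, fderiv ℝ (convolution (Ω.indicator w) κ (ContinuousLinearMap.mul ℝ ℝ) volume) x
      (EuclideanSpace.single i 1, 0) = 0) ∧
    (δ < ‖x.1‖ → ∀ j, fderiv ℝ (convolution (Ω.indicator w) κ (ContinuousLinearMap.mul ℝ ℝ)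
      volume) x (0, EuclideanSpace.single j 1) = 0) := by
  have hκc : HasCompactSupport κ :=
    (isCompact_closedBall _ _).of_isClosed_subset (isClosed_tsupport _) hκs
  set φ : Space m n → ℝ := fun t => κ (x - t) with hφ
  have hφs : tsupport φ ⊆ Metric.closedBall x δ := by
    have : tsupport φ ⊆ (fun t => x - t) ⁻¹' tsupport κ :=
      closure_minimal (fun t ht => subset_tsupport _ ht)
        ((isClosed_tsupport κ).preimage (by fun_prop))
    intro t ht
    have := hκs (this ht)
    rw [mem_closedBall_zero_iff] at this
    rwa [Metric.mem_closedBall, dist_comm, dist_eq_norm]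
  have htest : IsTest Ω φ := ⟨hκ.comp (contDiff_const.sub contDiff_id),
    hκc.comp_homeomorph (Homeomorph.subLeft x), hφs.trans hx⟩
  have hDφ : ∀ t e, fderiv ℝ κ (x - t) e = - fderiv ℝ φ t e := by
    intro t e
    have h1 : HasFDerivAt φ ((fderiv ℝ κ (x - t)).comp (-ContinuousLinearMap.id ℝ (Space m n))) t :=
      HasFDerivAt.comp t ((hκ.differentiable (by simp)) (x - t)).hasFDerivAt
        ((hasFDerivAt_id t).const_sub x)
    rw [h1.fderiv]; simp
  have hconv : ∀ e, fderiv ℝ (convolution (Ω.indicator w) κ (ContinuousLinearMap.mul ℝ ℝ) volume)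
      x e = - ∫ t in Ω, w t * fderiv ℝ φ t e := fun e => by
    rw [fderiv_convolution_mul hW hκ hκc, ← integral_neg, ← integral_indicator hΩ.measurableSet]
    congr 1
    ext t
    by_cases ht : t ∈ Ω
    · simp [ht, hDφ]
    · simp [ht]
  refine ⟨fun i => ?_, fun hδ j => ?_⟩
  · rw [hconv, neg_eq_zero]
    exact hw φ htest (Sum.inl i)
  · obtain ⟨φ', hφ', h⟩ := exists_isTest_grad_inr_eq (γ := γ) htest fun z hz hz0 => by
      have h1 := hφs hz
      rw [Metric.mem_closedBall, dist_comm, dist_eq_norm] at h1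
      have h2 := norm_fst_le (x - z)
      rw [Prod.fst_sub, hz0, sub_zero] at h2
      linarith
    rw [hconv, neg_eq_zero, ← hw φ' hφ' (Sum.inr j)]
    simp only [h]

lemma eq_of_fderiv_single_eq_zero {d : ℕ} {s : Set (EuclideanSpace ℝ (Fin d))} (hs : IsOpen s)
    (hs' : IsPreconnected s) {h : EuclideanSpace ℝ (Fin d) → ℝ} (hh : Differentiable ℝ h)
    (h0 : ∀ x ∈ s, ∀ i, fderiv ℝ h x (EuclideanSpace.single i 1) = 0) {x y} (hx : x ∈ s)
    (hy : y ∈ s) : h x = h y := by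
  refine hs.is_const_of_fderiv_eq_zero hs' hh.differentiableOn (fun x hx => ?_) hx hy
  refine ContinuousLinearMap.coe_injective
    ((EuclideanSpace.basisFun (Fin d) ℝ).toBasis.ext fun i => ?_)
  simpa using h0 x hx i

/-- A function with vanishing weak Grushin gradient is constant near every point. Its mollifications
do not depend on `x`, and they do not depend on `y` on a slice `{x = x₁}` with `x₁ ≠ 0`. -/
lemma exists_ae_eq_const_ball (hm : 1 ≤ m) {w : Space m n → ℝ} (hΩ : IsOpen Ω)
    (hW : LocallyIntegrable (Ω.indicator w))
    (hw : ∀ φ, IsTest Ω φ → ∀ k, ∫ z in Ω, w z * grad γ φ z k = 0) {z₀ : Space m n}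
    (hz₀ : z₀ ∈ Ω) : ∃ r > 0, ∃ c, ∀ᵐ z, z ∈ Metric.ball z₀ r → Ω.indicator w z = c := by
  obtain ⟨R, hR, hball⟩ := Metric.isOpen_iff.1 hΩ z₀ hz₀
  set r := R / 2 with hr
  have hr0 : 0 < r := by positivity
  -- such a point exists because `m ≥ 1`
  obtain ⟨x₁, hx₁, hx₁0⟩ : ∃ x₁ ∈ Metric.ball z₀.1 r, x₁ ≠ 0 := by
    by_cases h : z₀.1 = 0
    · refine ⟨EuclideanSpace.single ⟨0, hm⟩ (r / 2), ?_, ?_⟩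
      · rw [h, mem_ball_zero_iff, PiLp.norm_single, Real.norm_of_nonneg (by positivity)]
        linarith
      · rw [← norm_pos_iff, PiLp.norm_single, Real.norm_of_nonneg (by positivity)]
        linarith
    · exact ⟨z₀.1, Metric.mem_ball_self hr0, h⟩
  have hx₁n : 0 < ‖x₁‖ := norm_pos_iff.2 hx₁0
  set W := Ω.indicator w with hWdef
  -- mollifications at small scale are constant on the ball
  have hconst : ∀ κ : Space m n → ℝ, ContDiff ℝ ∞ κ → ∀ δ, δ < r → δ < ‖x₁‖ →
      tsupport κ ⊆ Metric.closedBall 0 δ → ∀ z ∈ Metric.ball z₀ r,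
      convolution W κ (ContinuousLinearMap.mul ℝ ℝ) volume z =
      convolution W κ (ContinuousLinearMap.mul ℝ ℝ) volume (x₁, z₀.2) := by
    intro κ hκ δ hδr hδx hκs z hz
    set S := convolution W κ (ContinuousLinearMap.mul ℝ ℝ) volume with hS
    have hκc : HasCompactSupport κ :=
      (isCompact_closedBall _ _).of_isClosed_subset (isClosed_tsupport _) hκs
    have hSd : Differentiable ℝ S := fun x => (hκc.hasFDerivAt_convolution_right
      (ContinuousLinearMap.mul ℝ ℝ) hW (hκ.of_le (by simp)) x).differentiableAt
    have hcl : ∀ x ∈ Metric.ball z₀ r, Metric.closedBall x δ ⊆ Ω := fun x hx y hy => by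
      refine hball ?_
      rw [Metric.mem_ball] at hx ⊢
      rw [Metric.mem_closedBall] at hy
      linarith [dist_triangle y x z₀]
    have hmem : ∀ x ∈ Metric.ball z₀.1 r, ∀ y ∈ Metric.ball z₀.2 r, (x, y) ∈ Metric.ball z₀ r := by
      intro x hx y hy
      rw [← ball_prod_same]
      exact ⟨hx, hy⟩
    have hz' : z.1 ∈ Metric.ball z₀.1 r ∧ z.2 ∈ Metric.ball z₀.2 r := by
      rwa [← Prod.mk.eta (p := z₀), ← ball_prod_same, Set.mem_prod] at hz
    have s1 : S (z.1, z.2) = S (x₁, z.2) := by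
      refine eq_of_fderiv_single_eq_zero Metric.isOpen_ball
        (convex_ball z₀.1 r).isPreconnected (h := fun x => S (x, z.2))
        (hSd.comp (differentiable_id.prodMk (differentiable_const _))) (fun x hx i => ?_) hz'.1 hx₁
      have h1 : HasFDerivAt (fun x => S (x, z.2)) ((fderiv ℝ S (x, z.2)).comp
          (ContinuousLinearMap.inl ℝ _ _)) x :=
        HasFDerivAt.comp (g := S) x (hSd (x, z.2)).hasFDerivAt (hasFDerivAt_prodMk_left x z.2)
      rw [h1.fderiv]
      exact (fderiv_convolution_eq_zero hΩ hW hw hκ hκs (hcl _ (hmem x hx _ hz'.2))).1 i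
    have s2 : S (x₁, z.2) = S (x₁, z₀.2) := by
      refine eq_of_fderiv_single_eq_zero Metric.isOpen_ball
        (convex_ball z₀.2 r).isPreconnected (h := fun y => S (x₁, y))
        (hSd.comp ((differentiable_const _).prodMk differentiable_id)) (fun y hy j => ?_) hz'.2
        (Metric.mem_ball_self hr0)
      have h1 : HasFDerivAt (fun y => S (x₁, y)) ((fderiv ℝ S (x₁, y)).comp
          (ContinuousLinearMap.inr ℝ _ _)) y :=
        HasFDerivAt.comp (g := S) y (hSd (x₁, y)).hasFDerivAt (hasFDerivAt_prodMk_right x₁ y)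
      rw [h1.fderiv]
      exact (fderiv_convolution_eq_zero hΩ hW hw hκ hκs (hcl _ (hmem _ hx₁ y hy))).2 hδx j
    exact s1.trans s2
  -- pass to the limit along a sequence of mollifiers
  have hs : ∀ i : ℕ, 0 < 1 / ((i : ℝ) + 1) := fun i => by positivity
  let b : ℕ → ContDiffBump (0 : Space m n) := fun i =>
    ⟨1 / ((i : ℝ) + 1) / 2, 1 / ((i : ℝ) + 1), half_pos (hs i), half_lt_self (hs i)⟩
  have h0 := tendsto_one_div_add_atTop_nhds_zero_nat (𝕜 := ℝ)
  have hlim := ContDiffBump.ae_convolution_tendsto_right_of_locallyIntegrable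
    (μ := (volume : Measure (Space m n))) (φ := b) (l := atTop) (K := 2) h0
    (Eventually.of_forall fun i => by
      change 1 / ((i : ℝ) + 1) ≤ 2 * (1 / ((i : ℝ) + 1) / 2); linarith) hW
  have hswap : ∀ i z, convolution ((b i).normed volume) W (ContinuousLinearMap.lsmul ℝ ℝ) volume z =
      convolution W ((b i).normed volume) (ContinuousLinearMap.mul ℝ ℝ) volume z := fun i z => by
    rw [convolution_eq_swap]
    simp only [convolution, ContinuousLinearMap.lsmul_apply, ContinuousLinearMap.mul_apply',
      smul_eq_mul, mul_comm]
  have hev : ∀ᶠ i in atTop, ∀ z ∈ Metric.ball z₀ r,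
      convolution ((b i).normed volume) W (ContinuousLinearMap.lsmul ℝ ℝ) volume z =
      convolution ((b i).normed volume) W (ContinuousLinearMap.lsmul ℝ ℝ) volume (x₁, z₀.2) := by
    filter_upwards [h0.eventually (gt_mem_nhds hr0), h0.eventually (gt_mem_nhds hx₁n)]
      with i h1 h2 z hz
    rw [hswap, hswap]
    refine hconst _ (b i).contDiff_normed _ h1 h2 ?_ z hz
    rw [(b i).tsupport_normed_eq]
  have hne : ∃ z₁ ∈ Metric.ball z₀ r, Tendsto (fun i => convolution ((b i).normed volume) W
      (ContinuousLinearMap.lsmul ℝ ℝ) volume z₁) atTop (𝓝 (W z₁)) := by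
    by_contra! hcon
    have : volume (Metric.ball z₀ r) = 0 := by
      refine measure_mono_null (fun z hz => ?_) hlim
      exact hcon z hz
    exact (Metric.measure_ball_pos volume z₀ hr0).ne' this
  obtain ⟨z₁, hz₁, hz₁t⟩ := hne
  refine ⟨r, hr0, W z₁, ?_⟩
  filter_upwards [hlim] with z hz hzb
  refine tendsto_nhds_unique hz (hz₁t.congr' ?_)
  filter_upwards [hev] with i hi
  rw [hi z hzb, hi z₁ hz₁]

/-- A function with vanishing weak Grushin gradient on a connected open set is constant. -/
lemma exists_ae_eq_const (hm : 1 ≤ m) {w : Space m n → ℝ} (hΩ : IsOpen Ω) (hconn : IsConnected Ω)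
    (hW : LocallyIntegrable (Ω.indicator w))
    (hw : ∀ φ, IsTest Ω φ → ∀ k, ∫ z in Ω, w z * grad γ φ z k = 0) :
    ∃ c, ∀ᵐ z ∂volume.restrict Ω, w z = c := by
  have hloc := fun z (hz : z ∈ Ω) => exists_ae_eq_const_ball hm hΩ hW hw hz
  obtain ⟨z₀, hz₀⟩ := hconn.nonempty
  obtain ⟨r₀, hr₀, c₀, h₀⟩ := hloc z₀ hz₀
  -- the points near which the function is constant, with a value in `S`
  let A : Set ℝ → Set (Space m n) := fun S =>
    {z | ∃ r > 0, ∃ c ∈ S, ∀ᵐ y, y ∈ Metric.ball z r → Ω.indicator w y = c}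
  have hA : ∀ S, IsOpen (A S) := by
    intro S
    rw [Metric.isOpen_iff]
    rintro z ⟨r, hr, c, hc, h⟩
    refine ⟨r / 2, half_pos hr, fun y hy => ⟨r / 2, half_pos hr, c, hc, ?_⟩⟩
    filter_upwards [h] with t ht hty
    refine ht ?_
    rw [Metric.mem_ball] at *
    linarith [dist_triangle t y z]
  have hdisj : Disjoint (A {c₀}) (A {c₀}ᶜ) := by
    rw [Set.disjoint_left]
    rintro z ⟨r, hr, c, hc, h⟩ ⟨r', hr', c', hc', h'⟩
    refine (Metric.measure_ball_pos volume z (lt_min hr hr')).ne' ?_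
    have : ∀ᵐ y, y ∉ Metric.ball z (min r r') := by
      filter_upwards [h, h'] with y hy hy' hyz
      have e1 := hy (Metric.ball_subset_ball (min_le_left _ _) hyz)
      have e2 := hy' (Metric.ball_subset_ball (min_le_right _ _) hyz)
      exact hc' (by rw [← e2, e1]; exact hc)
    exact measure_mono_null (fun y hy => not_not.2 hy) this
  have hsub : Ω ⊆ A {c₀} := by
    refine hconn.isPreconnected.subset_left_of_subset_union (hA _) (hA _) hdisj (fun z hz => ?_)
      ⟨z₀, hz₀, r₀, hr₀, c₀, rfl, h₀⟩
    obtain ⟨r, hr, c, h⟩ := hloc z hz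
    by_cases hc : c = c₀
    · exact Or.inl ⟨r, hr, c, hc, h⟩
    · exact Or.inr ⟨r, hr, c, hc, h⟩
  refine ⟨c₀, ?_⟩
  rw [ae_restrict_iff' hΩ.measurableSet]
  have hnull : volume {z | ¬ (z ∈ Ω → w z = c₀)} = 0 := by
    refine measure_null_of_locally_null _ fun z hz => ?_
    have hzΩ : z ∈ Ω := by
      by_contra h
      exact hz fun h' => absurd h' h
    obtain ⟨r, hr, c, hc, h⟩ := hsub hzΩ
    refine ⟨_, inter_mem_nhdsWithin _ (Metric.ball_mem_nhds z hr), ?_⟩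
    refine measure_mono_null (fun y hy => ?_) h
    intro hcon
    refine hy.1 fun hyΩ => ?_
    have := hcon hy.2
    rw [Set.indicator_of_mem hyΩ] at this
    exact this.trans hc
  exact hnull

end ZeroGradient

/-! ### Capacity of the complement -/

section Capacity

variable {m n : ℕ} {γ p : ℝ} {Ω : Set (Space m n)}

lemma lintegral_ofReal_norm_rpow {α V : Type*} [MeasurableSpace α] {μ : Measure α}
    [NormedAddCommGroup V] (hp : 0 < p) (G : α → V) :
    ∫⁻ z, ENNReal.ofReal (‖G z‖ ^ p) ∂μ = eLpNorm G (ENNReal.ofReal p) μ ^ p := by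
  rw [eLpNorm_eq_lintegral_rpow_enorm_toReal (by simpa using hp) (by simp),
    ENNReal.toReal_ofReal hp.le, ← ENNReal.rpow_mul, one_div_mul_cancel hp.ne', ENNReal.rpow_one]
  congr 1
  ext z
  rw [← ENNReal.ofReal_rpow_of_nonneg (norm_nonneg _) hp.le, ofReal_norm]

lemma tendsto_eLpNorm_add_smul {α V : Type*} [MeasurableSpace α] {μ : Measure α}
    [NormedAddCommGroup V] [NormedSpace ℝ V] {r : ℝ≥0∞} (hr : 1 ≤ r) {f g : α → V}
    {fs gs : ℕ → α → V} (hfm : ∀ k, AEStronglyMeasurable (fun z => fs k z - f z) μ)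
    (hgm : ∀ k, AEStronglyMeasurable (fun z => gs k z - g z) μ)
    (hf : Tendsto (fun k => eLpNorm (fun z => fs k z - f z) r μ) atTop (𝓝 0))
    (hg : Tendsto (fun k => eLpNorm (fun z => gs k z - g z) r μ) atTop (𝓝 0)) (a b : ℝ) :
    Tendsto (fun k => eLpNorm (fun z => (a • fs k z + b • gs k z) - (a • f z + b • g z)) r μ)
      atTop (𝓝 0) := by
  have h := (ENNReal.Tendsto.const_mul (a := ‖a‖ₑ) hf (Or.inr enorm_ne_top)).add
    (ENNReal.Tendsto.const_mul (a := ‖b‖ₑ) hg (Or.inr enorm_ne_top))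
  rw [mul_zero, mul_zero, add_zero] at h
  refine tendsto_of_tendsto_of_tendsto_of_le_of_le tendsto_const_nhds h (fun _ => zero_le)
    fun k => ?_
  have e : (fun z => (a • fs k z + b • gs k z) - (a • f z + b • g z)) =
      (a • fun z => fs k z - f z) + b • fun z => gs k z - g z := by
    ext z
    simp only [Pi.add_apply, Pi.smul_apply]
    module
  rw [e, ← eLpNorm_const_smul, ← eLpNorm_const_smul]
  exact eLpNorm_add_le ((hfm k).const_smul a) ((hgm k).const_smul b) hr

lemma IsTest.add_smul {φ ψ : Space m n → ℝ} (hφ : IsTest Ω φ) (hψ : IsTest Ω ψ) (a b : ℝ) :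
    IsTest Ω fun z => a • φ z + b • ψ z := by
  have hsub : tsupport (fun z => a • φ z + b • ψ z) ⊆ tsupport φ ∪ tsupport ψ := by
    refine closure_minimal (fun z hz => ?_)
      ((isClosed_tsupport φ).union (isClosed_tsupport ψ))
    by_contra h
    rw [Set.mem_union, not_or] at h
    refine hz ?_
    simp only
    rw [image_eq_zero_of_notMem_tsupport h.1, image_eq_zero_of_notMem_tsupport h.2, smul_zero,
      smul_zero, add_zero]
  exact ⟨(hφ.smooth.const_smul a).add (hψ.smooth.const_smul b),
    (hφ.compact.isCompact.union hψ.compact.isCompact).of_isClosed_subset (isClosed_tsupport _) hsub,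
    hsub.trans (Set.union_subset hφ.supp hψ.supp)⟩

lemma IsTest.grad_add_smul {φ ψ : Space m n → ℝ} (hφ : IsTest Ω φ) (hψ : IsTest Ω ψ) (a b : ℝ)
    (z : Space m n) :
    grad γ (fun z => a • φ z + b • ψ z) z = a • grad γ φ z + b • grad γ ψ z := by
  have h1 := ((hφ.smooth.differentiable (by simp) z).hasFDerivAt.const_smul a).add
    ((hψ.smooth.differentiable (by simp) z).hasFDerivAt.const_smul b)
  have h2 : fderiv ℝ (fun z => a • φ z + b • ψ z) z = a • fderiv ℝ φ z + b • fderiv ℝ ψ z :=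
    h1.fderiv
  simp only [smul_eq_mul] at h2
  ext i
  rcases i with i | i
  · simp [grad, h2]
  · simp [grad, h2]; ring

/-- If a limit of test functions in `Ω` dominates a cutoff function of the complement of `Ω`, then
the complement has capacity zero. -/
lemma capacity_eq_zero_of_tendsto (hγ : 0 < γ) (hp : 1 < p) (hΩ : IsOpen Ω) {χ : Space m n → ℝ}
    (hχ : IsTest Set.univ χ) (hχ1 : ∀ z ∈ Ωᶜ, ∀ᶠ y in 𝓝 z, χ y = 1) {W : Space m n → ℝ}
    {G : Space m n → GradSpace m n} {φ : ℕ → Space m n → ℝ} (hφ : ∀ k, IsTest Ω (φ k))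
    (hG : MemLp G (ENNReal.ofReal p) (volume.restrict Ω))
    (hφW : ∀ᵐ z ∂volume.restrict Ω, Tendsto (fun k => φ k z) atTop (𝓝 (W z)))
    (hφG : Tendsto (fun k => eLpNorm (fun z => grad γ (φ k) z - G z)
        (ENNReal.ofReal p) (volume.restrict Ω)) atTop (𝓝 0))
    (hW : ∀ᵐ z ∂volume.restrict Ω, χ z ≤ W z) : capacity γ p Ωᶜ = 0 := by
  -- The functions `(χ - φ k)^+`, smoothed, are admissible for the capacity of `Ωᶜ`, and their
  -- gradients tend to zero in `L^p` because `χ ≤ W`.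
  have hp0 : 0 < p := by linarith
  obtain ⟨M, hM⟩ := exists_bound_deriv_smoothPos
  have hM0 : 0 ≤ M := (abs_nonneg _).trans (hM 0)
  set f : ℕ → Space m n → ℝ := fun k z => smoothPos (χ z - φ k z) with hf
  have hfs : ∀ k, ContDiff ℝ ∞ (f k) := fun k =>
    smoothPos_contDiff.comp (hχ.smooth.sub (hφ k).smooth)
  have hftest : ∀ k, IsTest Set.univ (f k) := fun k => by
    refine ⟨hfs k, ?_, Set.subset_univ _⟩
    refine HasCompactSupport.intro (hχ.compact.isCompact.union (hφ k).compact.isCompact)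
      fun z hz => ?_
    simp only [Set.mem_union, not_or] at hz
    simp only [hf]
    rw [image_eq_zero_of_notMem_tsupport hz.1, image_eq_zero_of_notMem_tsupport hz.2, sub_zero,
      smoothPos_of_nonpos le_rfl]
  have hnear : ∀ k, ∀ z ∈ Ωᶜ, ∀ᶠ y in 𝓝 z, f k y = 1 := fun k z hz => by
    have h2 : z ∉ tsupport (φ k) := fun h => hz ((hφ k).supp h)
    filter_upwards [hχ1 z hz, (isClosed_tsupport (φ k)).isOpen_compl.mem_nhds h2] with y hy hy2
    simp only [hf]
    rw [hy, image_eq_zero_of_notMem_tsupport hy2, sub_zero, smoothPos_of_one_le le_rfl]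
  have hgrad : ∀ k z, grad γ (f k) z =
      deriv smoothPos (χ z - φ k z) • (grad γ χ z - grad γ (φ k) z) := fun k z => by
    have h1 := (hasDerivAt_smoothPos (χ z - φ k z)).comp_hasFDerivAt z
      ((hχ.smooth.differentiable (by simp) z).hasFDerivAt.sub
        ((hφ k).smooth.differentiable (by simp) z).hasFDerivAt)
    have h2 : fderiv ℝ (f k) z =
        deriv smoothPos (χ z - φ k z) • (fderiv ℝ χ z - fderiv ℝ (φ k) z) := h1.fderiv
    ext i
    rcases i with i | i
    · simp [grad, h2]
    · simp [grad, h2]; ring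
  have hgrad0 : ∀ k z, z ∉ Ω → grad γ (f k) z = 0 := fun k z hz =>
    grad_eq_zero_of_eventually_eq_const (hnear k z hz)
  set D : Space m n → GradSpace m n := fun z => grad γ χ z - G z with hD
  have hDp : MemLp D (ENNReal.ofReal p) (volume.restrict Ω) :=
    ((hχ.memLp_grad (γ := γ) hγ).restrict Ω).sub hG
  have hcd : Continuous (deriv smoothPos) := smoothPos_contDiff.continuous_deriv (by simp)
  have hWm : AEStronglyMeasurable W (volume.restrict Ω) := aestronglyMeasurable_of_tendsto_ae atTop
    (fun k => (hφ k).smooth.continuous.aestronglyMeasurable) hφW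
  have hdm : ∀ k, Continuous fun z => deriv smoothPos (χ z - φ k z) := fun k =>
    hcd.comp (hχ.smooth.continuous.sub (hφ k).smooth.continuous)
  have t1 : Tendsto (fun k => ∫⁻ z in Ω, ENNReal.ofReal
      (‖deriv smoothPos (χ z - φ k z) • D z‖ ^ p)) atTop (𝓝 (∫⁻ _ in Ω, 0)) := by
    refine tendsto_lintegral_of_dominated_convergence'
      (fun z => ENNReal.ofReal (M ^ p * ‖D z‖ ^ p)) (fun k => ?_) (fun k => ae_of_all _ fun z => ?_)
      ?_ ?_
    · exact (((hdm k).aestronglyMeasurable.smul hDp.1).norm.aemeasurable.pow_const p).ennreal_ofReal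
    · refine ENNReal.ofReal_le_ofReal ?_
      rw [norm_smul, Real.mul_rpow (norm_nonneg _) (norm_nonneg _)]
      gcongr
      exact hM _
    · exact (((integrable_norm_rpow hp hDp).const_mul _).lintegral_lt_top).ne
    · filter_upwards [hφW, hW] with z hz hz'
      have h1 : Tendsto (fun k => deriv smoothPos (χ z - φ k z)) atTop (𝓝 0) := by
        have := (hcd.tendsto _).comp (hz.const_sub (χ z))
        rwa [deriv_smoothPos_of_nonpos (by linarith)] at this
      have h2 := ENNReal.tendsto_ofReal (((h1.smul_const (D z)).norm).rpow_const (p := p)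
        (Or.inr hp0.le))
      rwa [zero_smul, norm_zero, Real.zero_rpow hp0.ne', ENNReal.ofReal_zero] at h2
  rw [lintegral_zero] at t1
  have t2 : Tendsto (fun k => eLpNorm (fun z => deriv smoothPos (χ z - φ k z) • D z)
      (ENNReal.ofReal p) (volume.restrict Ω)) atTop (𝓝 0) := by
    have h1 := (ENNReal.continuous_rpow_const (y := p⁻¹)).tendsto 0 |>.comp t1
    rw [ENNReal.zero_rpow_of_pos (by positivity)] at h1
    refine h1.congr fun k => ?_
    simp only [Function.comp_def]
    rw [lintegral_ofReal_norm_rpow hp0, ← ENNReal.rpow_mul, mul_inv_cancel₀ hp0.ne',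
      ENNReal.rpow_one]
  have hle : ∀ k, capacity γ p Ωᶜ ≤ (eLpNorm (fun z => deriv smoothPos (χ z - φ k z) • D z)
      (ENNReal.ofReal p) (volume.restrict Ω) + ENNReal.ofReal M *
      eLpNorm (fun z => grad γ (φ k) z - G z) (ENNReal.ofReal p) (volume.restrict Ω)) ^ p := by
    intro k
    refine (iInf₂_le_of_le (f k) (hftest k) (iInf_le_of_le
      (fun z hz => (hnear k z hz).self_of_nhds.ge) le_rfl)).trans ?_
    have e1 : ∫⁻ z, ENNReal.ofReal (‖grad γ (f k) z‖ ^ p) =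
        ∫⁻ z in Ω, ENNReal.ofReal (‖grad γ (f k) z‖ ^ p) := by
      rw [← lintegral_indicator hΩ.measurableSet]
      congr 1
      ext z
      by_cases hz : z ∈ Ω
      · rw [Set.indicator_of_mem hz]
      · rw [Set.indicator_of_notMem hz, hgrad0 k z hz, norm_zero, Real.zero_rpow hp0.ne',
          ENNReal.ofReal_zero]
    rw [e1, lintegral_ofReal_norm_rpow hp0]
    refine ENNReal.rpow_le_rpow ?_ hp0.le
    have e2 : grad γ (f k) = (fun z => deriv smoothPos (χ z - φ k z) • D z) -
        fun z => deriv smoothPos (χ z - φ k z) • (grad γ (φ k) z - G z) := by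
      ext1 z
      rw [hgrad, Pi.sub_apply, ← smul_sub]
      simp only [hD]
      congr 1
      abel
    have hm2 : AEStronglyMeasurable (fun z => grad γ (φ k) z - G z) (volume.restrict Ω) :=
      (continuous_grad hγ ((hφ k).smooth.of_le (by simp))).aestronglyMeasurable.sub hG.1
    rw [e2]
    refine (eLpNorm_sub_le ((hdm k).aestronglyMeasurable.smul hDp.1)
      ((hdm k).aestronglyMeasurable.smul hm2) (by simpa using hp.le)).trans
      (add_le_add le_rfl ?_)
    refine eLpNorm_le_mul_eLpNorm_of_ae_le_mul (ae_of_all _ fun z => ?_) _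
    rw [Pi.smul_apply', norm_smul]
    exact mul_le_mul_of_nonneg_right (hM _) (norm_nonneg _)
  have hlim := (ENNReal.continuous_rpow_const (y := p)).tendsto _ |>.comp
    (t2.add (ENNReal.Tendsto.const_mul (a := ENNReal.ofReal M) hφG (Or.inr ENNReal.ofReal_ne_top)))
  rw [mul_zero, add_zero, ENNReal.zero_rpow_of_pos hp0] at hlim
  exact le_antisymm (ge_of_tendsto' hlim hle) bot_le

/-- A positive function `u` with `u ≥ δ > 0` and `u ≥ v` on the boundary cannot satisfy
`(1 + a) u ≤ v` in all of `Ω`: otherwise `δ χ ≤ χ (δ - u)^+ + χ (v - u)^+ / a` would vanish on the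
boundary of `Ω`. -/
lemma capacity_eq_zero_of_mul_le (hγ : 0 < γ) (hp : 1 < p) (hpN : p < homDim m n γ)
    (hΩ : IsOpen Ω) (hK : IsCompact Ωᶜ) {u v : Space m n → ℝ} {δ a : ℝ} (hδ : 0 < δ) (ha : 0 < a)
    (hδu : LeOnBoundary γ p Ω (fun _ => δ) u) (hvu : LeOnBoundary γ p Ω v u)
    (h : ∀ᵐ z ∂volume.restrict Ω, (1 + a) * u z ≤ v z) : capacity γ p Ωᶜ = 0 := by
  have hcrit : 1 < critExp m n γ p := by linarith [le_critExp hp hpN]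
  obtain ⟨R, hR, hKR⟩ := exists_subset_homBall hγ hK
  have hR0 : 0 < R := by linarith
  set χ : Space m n → ℝ := cutoff γ R with hχdef
  have hχ : IsTest Set.univ χ := isTest_cutoff hγ hR0
  obtain ⟨G₁, hG₁, φ₁, hφ₁, hφ₁t, hgφ₁t⟩ := hδu χ hχ
  obtain ⟨G₂, hG₂, φ₂, hφ₂, hφ₂t, hgφ₂t⟩ := hvu χ hχ
  set W₁ : Space m n → ℝ := fun z => χ z * max (δ - u z) 0
  set W₂ : Space m n → ℝ := fun z => χ z * max (v z - u z) 0
  set b₁ := δ⁻¹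
  set b₂ := (a * δ)⁻¹
  set φ : ℕ → Space m n → ℝ := fun k z => b₁ • φ₁ k z + b₂ • φ₂ k z with hφdef
  have hφ : ∀ k, IsTest Ω (φ k) := fun k => (hφ₁ k).add_smul (hφ₂ k) b₁ b₂
  have hgrad : ∀ k z, grad γ (φ k) z = b₁ • grad γ (φ₁ k) z + b₂ • grad γ (φ₂ k) z := fun k z =>
    (hφ₁ k).grad_add_smul (hφ₂ k) b₁ b₂ z
  have hsm : ∀ {ψ : Space m n → ℝ}, IsTest Ω ψ → AEStronglyMeasurable ψ (volume.restrict Ω) :=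
    fun hψ => hψ.smooth.continuous.aestronglyMeasurable
  have hgm : ∀ {ψ : Space m n → ℝ}, IsTest Ω ψ →
      AEStronglyMeasurable (grad γ ψ) (volume.restrict Ω) :=
    fun hψ => (continuous_grad hγ (hψ.smooth.of_le (by simp))).aestronglyMeasurable
  have T1 := tendsto_eLpNorm_add_smul (by simpa using hcrit.le)
    (fun k => (hsm (hφ₁ k)).sub hG₁.memLp.1) (fun k => (hsm (hφ₂ k)).sub hG₂.memLp.1)
    hφ₁t hφ₂t b₁ b₂
  have T2 := tendsto_eLpNorm_add_smul (by simpa using hp.le)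
    (fun k => (hgm (hφ₁ k)).sub hG₁.memLp_grad.1) (fun k => (hgm (hφ₂ k)).sub hG₂.memLp_grad.1)
    hgφ₁t hgφ₂t b₁ b₂
  obtain ⟨ns, hns, hae⟩ := (tendstoInMeasure_of_tendsto_eLpNorm
    (by simpa using by linarith) (fun k => hsm (hφ k))
    ((hG₁.memLp.1.const_smul b₁).add (hG₂.memLp.1.const_smul b₂)) T1).exists_seq_tendsto_ae
  refine capacity_eq_zero_of_tendsto hγ hp hΩ hχ (fun z hz => ?_) (fun k => hφ (ns k))
    ((hG₁.memLp_grad.const_smul b₁).add (hG₂.memLp_grad.const_smul b₂)) hae ?_ ?_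
  · filter_upwards [(isOpen_homBall hγ R).mem_nhds (hKR hz)] with y hy
      using cutoff_eq_one hγ hR0 hy
  · refine (T2.comp hns.tendsto_atTop).congr fun k => ?_
    simp only [Function.comp_def, hgrad]
    rfl
  · filter_upwards [h] with z hz
    have hχ0 : 0 ≤ χ z := cutoff_nonneg R z
    have h1 := le_max_left (δ - u z) 0
    have h2 := le_max_left (v z - u z) 0
    have h3 : δ ≤ max (δ - u z) 0 + max (v z - u z) 0 / a := by
      have : u z ≤ max (v z - u z) 0 / a := by
        rw [le_div_iff₀ ha]; linarith
      linarith
    have h4 : b₁ • W₁ z + b₂ • W₂ z =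
        χ z * ((max (δ - u z) 0 + max (v z - u z) 0 / a) / δ) := by
      simp only [b₁, b₂, W₁, W₂, smul_eq_mul]
      field_simp
    change χ z ≤ b₁ • W₁ z + b₂ • W₂ z
    rw [h4]
    exact le_mul_of_one_le_right hχ0 ((one_le_div hδ).2 h3)

end Capacity

end Grushin

open Grushin in
theorem theorem4p6 (m n : ℕ) (hm : 1 ≤ m) (hn : 1 ≤ n) (γ p : ℝ) (hγ : 0 < γ)
    (hp1 : 1 < p) (hpN : p < homDim m n γ)
    (Ω : Set (Space m n)) (hΩ : IsExteriorDomain γ p Ω)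
    (f g : Space m n → ℝ)
    (hf : MemLp f (ENNReal.ofReal (homDim m n γ / p)) (volume.restrict Ω))
    (hg : MemLp g (ENNReal.ofReal (homDim m n γ / p)) (volume.restrict Ω))
    (hfg : ∀ᵐ z ∂volume.restrict Ω, f z ≤ g z)
    (u v : Space m n → ℝ) (Du Dv : Space m n → GradSpace m n)
    (hv : MemD γ p Ω v Dv) (hu : MemD γ p Ω u Du)
    (hu_pos : ∀ᵐ z ∂volume.restrict Ω, 0 < u z)
    (hv_sub : IsWeakSubsolution γ p Ω f v Dv)
    (hu_super : IsWeakSupersolution γ p Ω g u Du)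
    (hu_bdry : ∃ δ : ℝ, 0 < δ ∧ LeOnBoundary γ p Ω (fun _ => δ) u)
    (h_growth : limsup (fun R : ℝ => ENNReal.ofReal (1 / R) *
      ∫⁻ z in homBall m n γ (2 * R) \ homBall m n γ R,
        ENNReal.ofReal (max (v z) 0 ^ p * (‖Du z‖ / u z) ^ (p - 1))) atTop = 0)
    (hvu_bdry : LeOnBoundary γ p Ω v u) :
    ∀ᵐ z ∂volume.restrict Ω, v z ≤ u z := by
  have hgrad := grad_eq_smul_of_lt hγ hp1 hpN hΩ.isOpen hf hg hfg hv hu hu_pos hv_sub hu_super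
    h_growth hvu_bdry
  have hW : LocallyIntegrable (Ω.indicator fun z => stepF (v z / u z)) := by
    have hm : AEStronglyMeasurable (Ω.indicator fun z => stepF (v z / u z)) volume := by
      rw [aestronglyMeasurable_indicator_iff hΩ.isOpen.measurableSet]
      exact (stepF_contDiff.continuous.measurable.comp_aemeasurable
        (hv.memLp.1.aemeasurable.div hu.memLp.1.aemeasurable)).aestronglyMeasurable
    refine (memLp_top_of_bound hm 1 (ae_of_all _ fun z => ?_)).locallyIntegrable le_top
    refine (norm_indicator_le_norm_self _ _).trans ?_
    rw [Real.norm_of_nonneg (stepF_nonneg _)]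
    exact stepF_le_one _
  -- `F (v / u)` is constant, where `F` vanishes on `(-∞, 1]` and is positive on `(1, ∞)`
  obtain ⟨c, hc⟩ := exists_ae_eq_const hm hΩ.isOpen hΩ.isConnected hW fun φ hφ k =>
    integral_stepF_mul_grad_eq_zero hγ hp1 hΩ.isOpen (hu.locMemW hp1 hpN) (hv.locMemW hp1 hpN)
      hu_pos (fun C hC hCΩ => lintegral_log_grad_lt_top hγ hp1 hpN hΩ.isOpen hg hu hu_pos hu_super
        hC hCΩ) hgrad hφ k
  -- If `c ≤ 0`, then `v ≤ u`. If `c > 0`, then `v ≥ (1 + a) u` in all of `Ω` for some `a > 0`,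
  -- which contradicts the boundary values.
  rcases le_or_gt c 0 with hc0 | hc0
  · filter_upwards [hc, hu_pos] with z hz hzu
    by_contra hlt
    have := stepF_pos ((one_lt_div hzu).2 (not_le.1 hlt))
    linarith
  · exfalso
    obtain ⟨a, ha, hac⟩ : ∃ a > 0, stepF (1 + a) < c := by
      have h1 : stepF 1 < c := by rwa [stepF_of_le_one le_rfl]
      obtain ⟨ε, hε, h⟩ := Metric.eventually_nhds_iff.1
        (stepF_contDiff.continuous.continuousAt.eventually (gt_mem_nhds h1))
      refine ⟨ε / 2, half_pos hε, h ?_⟩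
      rw [Real.dist_eq, add_sub_cancel_left, abs_of_pos (half_pos hε)]
      exact half_lt_self hε
    obtain ⟨δ, hδ, hδu⟩ := hu_bdry
    refine hΩ.capacity_pos.ne' (capacity_eq_zero_of_mul_le hγ hp1 hpN hΩ.isOpen hΩ.isCompact_compl
      hδ ha hδu hvu_bdry ?_)
    filter_upwards [hc, hu_pos] with z hz hzu
    rw [← le_div_iff₀ hzu]
    by_contra hlt
    have := stepF_mono (not_le.1 hlt).le
    linarith
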